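/- **Theorem (Exact recovery).** For $x\in\mathbb R^n$ let $\operatorname{supp}(x)=\{j: x_j\neq 0\}$, $x_{\min}=\min_{j\in\operatorname{supp}(x)}|x_j|$ and $\mathrm{dist}(z,x)=\min\{\|z+x\|_2,\|z-x\|_2\}$. Let $a_1,\dots,a_m$ ($m\ge 1$) be i.i.d. $\mathcal N(0,I_n)$ vectors and let $\psi_i=|a_i^{T}x|$, $1\le i\le m$. *SPARTA* with sparsity level $k$, selection size $l$, step size $\mu$ and truncation threshold $\gamma\in[0,\infty]$ is the following procedure (ties may be broken in any way). 1. Support selection: $\hat S$ is a set of indices of the $k$ largest values among $\frac1m\sum_{i=1}^m\psi_i^2a_{i,j}^2$, $1\le j\le n$. 2. Initialization: $\bar I$ is a set of indices of the $l$ largest values of $\psi_i/\|a_{i,\hat S}\|_2$, $1\le i\le m$, where $a_{i,\hat S}\in\mathbb R^{k}$ keeps the entries of $a_i$ in $\hat S$. Let $\tilde z$ be a unit principal eigenvector of $\frac1{|\bar I|}\sum_{i\in\bar I} a_{i,\hat S}a_{i,\hat S}^{T}/\|a_{i,\hat S}\|_2^2$, padded with zeros outside $\hat S$, and let $z^0=\sqrt{\sum_{i=1}^m\psi_i^2/m}\;\tilde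 z$. 3. Refinement: for $t=0,1,\dots$ $$z^{t+1}=\mathcal H_k\Big(z^t-\frac{\mu}{m}\sum_{i\in I^{t+1}}\Big(a_i^{T}z^t-\psi_i\frac{a_i^{T}z^t}{|a_i^{T}z^t|}\Big)a_i\Big),\qquad I^{t+1}=\Big\{i:|a_i^{T}z^t|\ge\frac{\psi_i}{1+\gamma}\Big\},$$ where $\mathcal H_k$ sets all entries to zero except for $k$ entries of largest magnitude, $0/0:=0$, and $I^{t+1}=\{1,\dots,m\}$ if $\gamma=\infty$. There are numerical constants $c_0,c_1,C_2>0$ such that for every $C_1>0$ there is a constant $C_0>0$ (depending only on $C_1$) for which the following two statements hold. (i) Let $x\in\mathbb R^n$ have exactly $k$ nonzero entries and $x_{\min}^2=\frac{C_1}{k}\|x\|_2^2$. If $m\ge C_0k^2\log(mn)$ and, in addition, $\log m\le k$ or $m\ge\log^3(mn)$, then with probability at least $1-6/m$ the support selection step recovers the support exactly: $\hat S=\operatorname{supp}(x)$. (ii) There are constants $0<\underline\mu<\overline\mu$ (depending only on $C_1$ and $C_0$) such that for every $\mu\in[\underline\mu,\overline\mu]$ there is $\nu\in(0,1)$ (depending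 only on $\mu$, $C_1$ and $C_0$) with the following property. Let $x\in\mathbb R^n$ have exactly $k$ nonzero entries and $x_{\min}^2=\frac{C_1}{k}\|x\|_2^2$. If $m\ge C_2\,l\ge C_0k^2\log(mn)$, then, with probability exceeding $1-c_1me^{-c_0k}-7/m$, all SPARTA iterates with step size $\mu$ and $\gamma=\infty$ satisfy $$\mathrm{dist}(z^t,x)\le\tfrac1{10}(1-\nu)^t\|x\|_2,\qquad t=0,1,2,\dots$$ -/

import Mathlib

open MeasureTheory ProbabilityTheory
open scoped ENNReal

noncomputable section

namespace Sparta

/-- The support of a vector: the set of indices of its nonzero entries. -/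
def supp {n : ℕ} (x : EuclideanSpace ℝ (Fin n)) : Finset (Fin n) :=
  Finset.univ.filter fun j => x j ≠ 0

/-- `r` is the minimum nonzero entry of `x` in modulus, `min_{j ∈ supp x} |x_j|`. -/
def IsMinNonzeroEntry {n : ℕ} (x : EuclideanSpace ℝ (Fin n)) (r : ℝ) : Prop :=
  IsLeast {s : ℝ | ∃ j ∈ supp x, s = |x j|} r

/-- The distance to the solution set `{x, -x}`. -/
def signDist {n : ℕ} (z x : EuclideanSpace ℝ (Fin n)) : ℝ :=
  min ‖z + x‖ ‖z - x‖

/-- `S` is a set of indices of the `k` largest values of `f` (ties broken in any way). -/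
def IsTopSet {ι : Type*} (k : ℕ) (f : ι → ℝ) (S : Finset ι) : Prop :=
  S.card = k ∧ ∀ i ∈ S, ∀ j ∉ S, f j ≤ f i

/-- The noiseless amplitude measurements `ψ_i = |a_iᵀ x|`. -/
def measurement {n m : ℕ} (a : Fin m → EuclideanSpace ℝ (Fin n))
    (x : EuclideanSpace ℝ (Fin n)) (i : Fin m) : ℝ :=
  |inner ℝ (a i) x|

/-- The statistics `(1/m) ∑ᵢ ψ_i² a_{i,j}²`, `j = 1, …, n`. -/
def suppStat {n m : ℕ} (a : Fin m → EuclideanSpace ℝ (Fin n)) (ψ : Fin m → ℝ)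
    (j : Fin n) : ℝ :=
  (1 / (m : ℝ)) * ∑ i, ψ i ^ 2 * (a i j) ^ 2

/-- `S` is a possible outcome of the support selection step with sparsity level `k`. -/
def IsSupportEstimate {n m : ℕ} (a : Fin m → EuclideanSpace ℝ (Fin n)) (ψ : Fin m → ℝ)
    (k : ℕ) (S : Finset (Fin n)) : Prop :=
  IsTopSet k (suppStat a ψ) S

/-- The vector `v_S` that keeps only the entries of `v` with index in `S`. -/
def restrict {n : ℕ} (S : Finset (Fin n)) (v : EuclideanSpace ℝ (Fin n)) :
    EuclideanSpace ℝ S :=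
  WithLp.toLp 2 fun j => v j

/-- Augmenting a vector indexed by `S` with zeros outside `S`. -/
def zeroPad {n : ℕ} (S : Finset (Fin n)) (w : EuclideanSpace ℝ S) :
    EuclideanSpace ℝ (Fin n) :=
  WithLp.toLp 2 fun j => if h : j ∈ S then w ⟨j, h⟩ else 0

/-- The matrix `Y = (1/|I|) ∑_{i ∈ I} a_{i,S} a_{i,S}ᵀ / ‖a_{i,S}‖²`. -/
def initMatrix {n m : ℕ} (a : Fin m → EuclideanSpace ℝ (Fin n)) (S : Finset (Fin n))
    (I : Finset (Fin m)) : Matrix S S ℝ :=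
  (1 / (I.card : ℝ)) • ∑ i ∈ I, (1 / ‖restrict S (a i)‖ ^ 2) •
    Matrix.vecMulVec (restrict S (a i)).ofLp (restrict S (a i)).ofLp

/-- `w` is a unit principal eigenvector of the symmetric matrix `Y`: it maximizes `vᵀ Y v`
over the unit sphere. -/
def IsPrincipalEigenvector {ι : Type*} [Fintype ι] (Y : Matrix ι ι ℝ)
    (w : EuclideanSpace ℝ ι) : Prop :=
  ‖w‖ = 1 ∧ ∀ v : EuclideanSpace ℝ ι, ‖v‖ = 1 →
    v.ofLp ⬝ᵥ Y.mulVec v.ofLp ≤ w.ofLp ⬝ᵥ Y.mulVec w.ofLp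

/-- `z` is a possible sparse orthogonality-promoting initialization, computed from the data
`(a_i, ψ_i)` with sparsity level `k` and selection size `l`. -/
def IsInitialization {n m : ℕ} (a : Fin m → EuclideanSpace ℝ (Fin n)) (ψ : Fin m → ℝ)
    (k l : ℕ) (z : EuclideanSpace ℝ (Fin n)) : Prop :=
  ∃ (S : Finset (Fin n)) (I : Finset (Fin m)) (w : EuclideanSpace ℝ S),
    IsSupportEstimate a ψ k S ∧
    IsTopSet l (fun i => ψ i / ‖restrict S (a i)‖) I ∧
    IsPrincipalEigenvector (initMatrix a S I) w ∧
    z = √((∑ i, ψ i ^ 2) / m) • zeroPad S w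

open scoped Classical in
/-- The index set `{i : |a_iᵀ z| ≥ ψ_i / (1 + γ)}`, where `γ = ∞` is allowed. -/
def truncSet {n m : ℕ} (a : Fin m → EuclideanSpace ℝ (Fin n)) (ψ : Fin m → ℝ)
    (γ : ℝ≥0∞) (z : EuclideanSpace ℝ (Fin n)) : Finset (Fin m) :=
  Finset.univ.filter fun i =>
    ENNReal.ofReal (ψ i) / (1 + γ) ≤ ENNReal.ofReal |inner ℝ (a i) z|

/-- The truncated generalized gradient of the amplitude loss; the sign `aᵀz / |aᵀz|` is `0`
where `aᵀz = 0`. -/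
def truncGrad {n m : ℕ} (a : Fin m → EuclideanSpace ℝ (Fin n)) (ψ : Fin m → ℝ)
    (γ : ℝ≥0∞) (z : EuclideanSpace ℝ (Fin n)) : EuclideanSpace ℝ (Fin n) :=
  (1 / (m : ℝ)) • ∑ i ∈ truncSet a ψ γ z,
    (inner ℝ (a i) z - ψ i * (inner ℝ (a i) z / |inner ℝ (a i) z|)) • a i

/-- `v` is a `k`-sparse hard thresholding of `u`: all entries of `u` are set to zero except for
`k` entries of largest magnitude (ties broken in any way). -/
def IsHardThreshold {n : ℕ} (k : ℕ) (u v : EuclideanSpace ℝ (Fin n)) : Prop :=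
  ∃ S : Finset (Fin n), IsTopSet k (fun j => |u j|) S ∧ ∀ j, v j = if j ∈ S then u j else 0

/-- `z⁰, z¹, z², …` is a possible sequence of SPARTA iterates on the data `(a_i, ψ_i)`, with
sparsity level `k`, selection size `l`, step size `μ` and truncation threshold `γ`. -/
def IsSpartaSequence {n m : ℕ} (a : Fin m → EuclideanSpace ℝ (Fin n)) (ψ : Fin m → ℝ)
    (k l : ℕ) (μ : ℝ) (γ : ℝ≥0∞) (z : ℕ → EuclideanSpace ℝ (Fin n)) : Prop :=
  IsInitialization a ψ k l (z 0) ∧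
  ∀ t, IsHardThreshold k (z t - μ • truncGrad a ψ γ (z t)) (z (t + 1))

/-- `a_1, …, a_m` are i.i.d. standard Gaussian vectors `𝒩(0, I_n)`. -/
def IsGaussianDesign {Ω : Type*} [MeasurableSpace Ω] (P : Measure Ω) {n m : ℕ}
    (a : Fin m → Ω → EuclideanSpace ℝ (Fin n)) : Prop :=
  iIndepFun a P ∧ ∀ i, HasLaw (a i) (stdGaussian (EuclideanSpace ℝ (Fin n))) P

/-- `x` has exactly `k` nonzero entries, and its minimum nonzero entry satisfies
`x_min² = (C₁ / k) ‖x‖²`. -/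
def IsAdmissibleSignal {n : ℕ} (C₁ : ℝ) (k : ℕ) (x : EuclideanSpace ℝ (Fin n)) : Prop :=
  (supp x).card = k ∧ ∃ r, IsMinNonzeroEntry x r ∧ r ^ 2 = C₁ / k * ‖x‖ ^ 2

end Sparta

end

/-!
Everything is deterministic on the intersection of a few events about the Gaussian design, whose
failure probabilities are exponentially small and add up by union bounds.

*Support recovery.* For a unit vector `x` the statistic `ψᵢ² a_{i,j}²` has expectation
`1 + 2 x_j²`. Averages of nonnegative variables have sub-Gaussian lower tails, so
the statistics on the support exceed `1 + t / 2` with `t = C₁ / k`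
(`measure_sum_sq_mul_sq_le`). Off the support `a_{i,j}` is independent of `ψᵢ`; with `ψᵢ²`
truncated at a multiple of `log m` the upper tail is exponential as well
(`measure_sum_trunc_sq_mul_sq_ge`), and `m ≥ C₀ k² log (m n)` makes both union bounds work
(`measure_support_failure_le`).

*Initialization.* On the support `S`, split `a_{i,S}` into its component along `x` and the
orthogonal part. The direction of the orthogonal part is uniform and independent of the pair
(component along `x`, length of the orthogonal part), which determines the selection of the `l`
indices. Hence the selected normalized vectors carry energy at most `64 l / k` in every direction
orthogonal to `x` (`measure_not_smallOrthogonalEnergy_le`). On the other hand, for every `R`, a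
positive fraction of all measurements has `⟨aᵢ, x⟩² ≥ R`, so for `l` small compared with `m` the
selected vectors carry energy at least a multiple of `l R / k` along `x`. A large `R` forces the
principal eigenvector to be close to `x` or `-x` (`principal_eigenvector_close`,
`initialization_close`).

*Refinement.* Near the signal, the gradient of the amplitude loss is the least squares gradient
except at the measurements with a wrong sign. Entrywise closeness of the sample Gram matrix to the
identity up to a small multiple of `1 / k` (`GramClose`) gives the restricted isometry on sparse
vectors. A wrong sign needs a small `|⟨aᵢ, x⟩|` or a large `|⟨aᵢ, z - x⟩|`, so these measurements
are a small fraction of all, and small subsets carry little energy of any sparse vector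
(`exists_measure_not_smallSubsetEnergy_le`). Therefore one step halves the error
(`norm_refine_sub_le`), hard thresholding costing only a constant factor.

The stated probability is negative unless `log m < k` and `m ≥ 8`; in that range `k` exceeds any
prescribed constant once `C₀` is large, which is what the initialization needs.
-/

noncomputable section

namespace Sparta

/-! ### Gaussian integrals and linear functionals of a Gaussian vector -/

lemma integral_exp_mul_sq {c : ℝ} (hc : c < 1 / 2) :
    Integrable (fun g : ℝ => Real.exp (c * g ^ 2)) (gaussianReal 0 1) ∧
      ∫ g, Real.exp (c * g ^ 2) ∂gaussianReal 0 1 = 1 / √(1 - 2 * c) := by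
  have hb : (0 : ℝ) < 1 / 2 - c := by linarith
  have hfun : (fun g : ℝ => gaussianPDFReal 0 1 g • Real.exp (c * g ^ 2))
      = fun g => (√(2 * Real.pi))⁻¹ * Real.exp (-(1 / 2 - c) * g ^ 2) := by
    funext g
    rw [gaussianPDFReal, smul_eq_mul, mul_assoc, ← Real.exp_add]
    simp only [NNReal.coe_one, mul_one, sub_zero]
    congr 2
    ring
  constructor
  · rw [gaussianReal_of_var_ne_zero _ one_ne_zero]
    have hm : Measurable (gaussianPDF 0 1) := measurable_gaussianPDF 0 1
    rw [integrable_withDensity_iff_integrable_smul₀' hm.aemeasurable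
      (ae_of_all _ fun x => gaussianPDF_lt_top)]
    simp_rw [toReal_gaussianPDF]
    rw [hfun]
    exact (integrable_exp_neg_mul_sq hb).const_mul _
  · rw [integral_gaussianReal_eq_integral_smul one_ne_zero, hfun, integral_const_mul,
      integral_gaussian, ← Real.sqrt_inv, ← Real.sqrt_mul (by positivity),
      show 1 / √(1 - 2 * c) = √(1 / (1 - 2 * c)) by simp]
    congr 1
    have : (1 - 2 * c) ≠ 0 := by intro h; linarith
    have := Real.pi_pos.ne'
    field_simp

lemma lintegral_exp_mul_sq {c : ℝ} (hc : c < 1 / 2) :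
    ∫⁻ g, ENNReal.ofReal (Real.exp (c * g ^ 2)) ∂gaussianReal 0 1
      = ENNReal.ofReal (1 / √(1 - 2 * c)) := by
  obtain ⟨h1, h2⟩ := integral_exp_mul_sq hc
  rw [← ofReal_integral_eq_lintegral_ofReal h1 (ae_of_all _ fun x => (Real.exp_pos _).le), h2]

lemma map_inner_stdGaussian {n : ℕ} {v : EuclideanSpace ℝ (Fin n)} (hv : ‖v‖ = 1) :
    (stdGaussian (EuclideanSpace ℝ (Fin n))).map (fun a => inner ℝ a v) = gaussianReal 0 1 := by
  have h := IsGaussian.map_eq_gaussianReal (μ := stdGaussian (EuclideanSpace ℝ (Fin n)))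
    (InnerProductSpace.toDual ℝ _ v)
  rw [integral_strongDual_stdGaussian, variance_dual_stdGaussian] at h
  simp only [LinearIsometryEquiv.norm_map, hv] at h
  have e : (fun a => inner ℝ a v) = ⇑(InnerProductSpace.toDual ℝ (EuclideanSpace ℝ (Fin n)) v) := by
    funext a
    simp [real_inner_comm]
  rw [e, h]
  simp

lemma covariance_inner_stdGaussian {n : ℕ} (u v : EuclideanSpace ℝ (Fin n)) :
    cov[fun a => inner ℝ u a, fun a => inner ℝ v a; stdGaussian (EuclideanSpace ℝ (Fin n))]
      = inner ℝ u v := by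
  have h := covarianceBilin_apply_eq_cov (μ := stdGaussian (EuclideanSpace ℝ (Fin n)))
    IsGaussian.memLp_two_id u v
  rw [covarianceBilin_stdGaussian] at h
  rw [← h]
  simp [innerSL_apply_apply ℝ]

lemma indepFun_inner_clm {n : ℕ} {F : Type*} [NormedAddCommGroup F] [InnerProductSpace ℝ F]
    [FiniteDimensional ℝ F] [MeasurableSpace F] [BorelSpace F]
    (x : EuclideanSpace ℝ (Fin n)) (L : EuclideanSpace ℝ (Fin n) →L[ℝ] F)
    (h : L x = 0) :
    IndepFun (fun a => inner ℝ a x) (fun a => L a)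
      (stdGaussian (EuclideanSpace ℝ (Fin n))) := by
  have hL : (fun a => inner ℝ a x) = fun a => (innerSL ℝ x) a := by
    funext a
    simp [innerSL_apply_apply ℝ, real_inner_comm]
  rw [hL]
  have hG : HasGaussianLaw (fun a => ((innerSL ℝ x) a, L a))
      (stdGaussian (EuclideanSpace ℝ (Fin n))) := by
    have := (HasGaussianLaw.mk (P := stdGaussian (EuclideanSpace ℝ (Fin n))) (X := id)
      (by rw [Measure.map_id]; infer_instance)).map ((innerSL ℝ x).prod L)
    exact this
  refine hG.indepFun_of_covariance_inner fun r y => ?_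
  have e1 : (fun a => inner ℝ r ((innerSL ℝ x) a)) = fun a => inner ℝ (r • x) a := by
    funext a
    simp [innerSL_apply_apply ℝ, inner_smul_left, mul_comm]
  have e2 : (fun a => inner ℝ y (L a)) = fun a => inner ℝ (L.adjoint y) a := by
    funext a
    rw [ContinuousLinearMap.adjoint_inner_left]
  rw [e1, e2, covariance_inner_stdGaussian, ContinuousLinearMap.adjoint_inner_right]
  simp [h]

lemma lintegral_comp_inner {n : ℕ} {v : EuclideanSpace ℝ (Fin n)} (hv : ‖v‖ = 1)
    {f : ℝ → ℝ≥0∞} (hf : Measurable f) :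
    ∫⁻ a, f (inner ℝ a v) ∂stdGaussian (EuclideanSpace ℝ (Fin n))
      = ∫⁻ g, f g ∂gaussianReal 0 1 := by
  rw [← map_inner_stdGaussian hv, lintegral_map hf (by fun_prop)]

lemma integral_comp_inner {n : ℕ} {v : EuclideanSpace ℝ (Fin n)} (hv : ‖v‖ = 1)
    {f : ℝ → ℝ} (hf : Measurable f) :
    ∫ a, f (inner ℝ a v) ∂stdGaussian (EuclideanSpace ℝ (Fin n))
      = ∫ g, f g ∂gaussianReal 0 1 := by
  rw [← map_inner_stdGaussian hv, integral_map (by fun_prop) hf.aestronglyMeasurable]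

lemma integrable_comp_inner {n : ℕ} {v : EuclideanSpace ℝ (Fin n)} (hv : ‖v‖ = 1)
    {f : ℝ → ℝ} (hf : Measurable f) (hi : Integrable f (gaussianReal 0 1)) :
    Integrable (fun a => f (inner ℝ a v)) (stdGaussian (EuclideanSpace ℝ (Fin n))) := by
  rw [← map_inner_stdGaussian hv] at hi
  exact (integrable_map_measure hf.aestronglyMeasurable (by fun_prop)).1 hi

lemma integrable_pow_gaussianReal (p : ℕ) :
    Integrable (fun g : ℝ => g ^ p) (gaussianReal 0 1) := by
  have h : MemLp (fun g : ℝ => g) (p : ℝ≥0∞) (gaussianReal 0 1) :=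
    memLp_id_gaussianReal' _ (by simp)
  rcases Nat.eq_zero_or_pos p with rfl | hp
  · simp
  · have := h.integrable_norm_pow (p := p) hp.ne'
    refine this.mono (by fun_prop) (ae_of_all _ fun g => ?_)
    simp

lemma integral_sq_gaussianReal : ∫ g : ℝ, g ^ 2 ∂gaussianReal 0 1 = 1 := by
  have h := variance_fun_id_gaussianReal (μ := 0) (v := 1)
  rw [variance_of_integral_eq_zero (by fun_prop) (by simp)] at h
  simpa using h

lemma exp_neg_le_quadratic {y : ℝ} (hy : 0 ≤ y) : Real.exp (-y) ≤ 1 - y + y ^ 2 / 2 := by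
  rw [Real.exp_neg, inv_le_iff_one_le_mul₀ (Real.exp_pos y)]
  have h := Real.quadratic_le_exp_of_nonneg hy
  have hpos : 0 ≤ 1 - y + y ^ 2 / 2 := by nlinarith [sq_nonneg (y - 1)]
  nlinarith [mul_le_mul_of_nonneg_left h hpos, sq_nonneg (y ^ 2)]

/-- The exact value is `3`; the bound follows by integrating `exp (-y) ≤ 1 - y + y ^ 2 / 2` at
`y = g ^ 2 / 4`. -/
lemma two_le_integral_pow_four : 2 ≤ ∫ g : ℝ, g ^ 4 ∂gaussianReal 0 1 := by
  obtain ⟨h1, h2⟩ := integral_exp_mul_sq (c := -(1 / 4)) (by norm_num)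
  have hle : ∀ g : ℝ, Real.exp (-(1 / 4) * g ^ 2) ≤ 1 - (1 / 4) * g ^ 2 + (1 / 32) * g ^ 4 := by
    intro g
    have h := exp_neg_le_quadratic (y := g ^ 2 / 4) (by positivity)
    rw [show -(1 / 4) * g ^ 2 = -(g ^ 2 / 4) by ring]
    refine h.trans (le_of_eq ?_)
    ring
  have hi2 := (integrable_pow_gaussianReal 2).const_mul (1 / 4)
  have hi4 := (integrable_pow_gaussianReal 4).const_mul (1 / 32)
  have hint := integral_mono h1 (((integrable_const (1 : ℝ)).sub hi2).add hi4) hle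
  rw [h2, integral_add' ((integrable_const (1 : ℝ)).sub hi2) hi4,
    integral_sub' (integrable_const (1 : ℝ)) hi2, integral_const_mul, integral_const_mul,
    integral_sq_gaussianReal] at hint
  have hs : √(1 - 2 * -(1 / 4)) ≤ 16 / 13 := by
    rw [Real.sqrt_le_left (by norm_num)]
    norm_num
  have hs' : (13 : ℝ) / 16 ≤ 1 / √(1 - 2 * -(1 / 4)) := by
    rw [le_div_iff₀ (Real.sqrt_pos.2 (by norm_num))]
    linarith
  simp at hint
  norm_num at hs' hint ⊢
  linarith

/-! ### Chernoff bounds for independent copies -/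

/-- Chernoff's bound for a sum of independent copies: only an upper bound for one exponential
moment is needed. -/
lemma pi_chernoff {α : Type*} [MeasurableSpace α] {m : ℕ} (ρ : Measure α)
    [IsProbabilityMeasure ρ] (I : Finset (Fin m)) {f : α → ℝ} (hf : Measurable f) {c b : ℝ}
    (h : ∫⁻ a, ENNReal.ofReal (Real.exp (f a)) ∂ρ ≤ ENNReal.ofReal (Real.exp (c - b))) :
    Measure.pi (fun _ : Fin m => ρ) {a | I.card * c ≤ ∑ i ∈ I, f (a i)}
      ≤ ENNReal.ofReal (Real.exp (-(I.card * b))) := by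
  have hind : iIndepFun (fun (i : Fin m) (a : Fin m → α) => ENNReal.ofReal (Real.exp (f (a i))))
      (Measure.pi (fun _ : Fin m => ρ)) :=
    iIndepFun_pi (X := fun _ x => ENNReal.ofReal (Real.exp (f x)))
      fun i => (by fun_prop : Measurable fun x => ENNReal.ofReal (Real.exp (f x))).aemeasurable
  have hprod := lintegral_prod_eq_prod_lintegral_of_indepFun I _ hind (fun i => by fun_prop)
  have hone : ∀ i : Fin m, ∫⁻ a, ENNReal.ofReal (Real.exp (f (a i)))
      ∂Measure.pi (fun _ : Fin m => ρ) ≤ ENNReal.ofReal (Real.exp (c - b)) := by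
    intro i
    refine le_trans (le_of_eq ?_) h
    exact (measurePreserving_eval (fun _ : Fin m => ρ) i).lintegral_comp
      (f := fun x => ENNReal.ofReal (Real.exp (f x))) (by fun_prop)
  have hbound : ∫⁻ a, ∏ i ∈ I, ENNReal.ofReal (Real.exp (f (a i)))
      ∂Measure.pi (fun _ : Fin m => ρ) ≤ ENNReal.ofReal (Real.exp (I.card * (c - b))) := by
    rw [hprod]
    refine (Finset.prod_le_prod' fun i _ => hone i).trans ?_
    rw [Finset.prod_const, ← ENNReal.ofReal_pow (Real.exp_pos _).le, ← Real.exp_nat_mul]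
  have hmarkov := mul_meas_ge_le_lintegral (μ := Measure.pi (fun _ : Fin m => ρ))
    (f := fun a => ∏ i ∈ I, ENNReal.ofReal (Real.exp (f (a i))))
    (Finset.measurable_prod _ fun i _ => by fun_prop) (ENNReal.ofReal (Real.exp (I.card * c)))
  have hset : {a : Fin m → α | I.card * c ≤ ∑ i ∈ I, f (a i)} ⊆
      {a | ENNReal.ofReal (Real.exp (I.card * c))
        ≤ ∏ i ∈ I, ENNReal.ofReal (Real.exp (f (a i)))} := by
    intro a ha
    simp only [Set.mem_ofPred_eq] at ha ⊢
    rw [← ENNReal.ofReal_prod_of_nonneg (fun i _ => (Real.exp_pos _).le), ← Real.exp_sum]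
    exact ENNReal.ofReal_le_ofReal (Real.exp_le_exp.2 ha)
  refine (measure_mono hset).trans ?_
  have h2 := hmarkov.trans hbound
  have hpos : ENNReal.ofReal (Real.exp (I.card * c)) ≠ 0 := by
    simp [Real.exp_pos]
  rw [mul_comm, ← ENNReal.le_div_iff_mul_le (Or.inl hpos) (Or.inl ENNReal.ofReal_ne_top),
    ← ENNReal.ofReal_div_of_pos (Real.exp_pos _), ← Real.exp_sub] at h2
  refine h2.trans (le_of_eq ?_)
  congr 2
  ring

/-- Chernoff's bound for the sum over all indices. -/
lemma pi_chernoff_univ {α : Type*} [MeasurableSpace α] {m : ℕ} (ρ : Measure α)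
    [IsProbabilityMeasure ρ] {f : α → ℝ} (hf : Measurable f) {c b : ℝ}
    (h : ∫⁻ a, ENNReal.ofReal (Real.exp (f a)) ∂ρ ≤ ENNReal.ofReal (Real.exp (c - b))) :
    Measure.pi (fun _ : Fin m => ρ) {a | m * c ≤ ∑ i, f (a i)}
      ≤ ENNReal.ofReal (Real.exp (-(m * b))) := by
  simpa using pi_chernoff ρ (Finset.univ : Finset (Fin m)) hf h

/-- The law of the design: `m` independent standard Gaussian vectors. -/
abbrev designMeasure (n m : ℕ) : Measure (Fin m → EuclideanSpace ℝ (Fin n)) :=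
  Measure.pi fun _ => stdGaussian (EuclideanSpace ℝ (Fin n))

lemma one_div_sqrt_le_exp {c : ℝ} (hc : |c| ≤ 1 / 4) :
    1 / √(1 - 2 * c) ≤ Real.exp (c + 2 * c ^ 2) := by
  obtain ⟨h1, h2⟩ := abs_le.1 hc
  have key : 1 ≤ (1 - 2 * c) * Real.exp (2 * c + 4 * c ^ 2) := by
    rcases le_total 0 c with h | h
    · have := Real.quadratic_le_exp_of_nonneg (x := 2 * c + 4 * c ^ 2) (by positivity)
      have h3 := mul_le_mul_of_nonneg_left this (show 0 ≤ 1 - 2 * c by linarith)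
      refine le_trans ?_ h3
      have h4 : 0 ≤ (2 * c) ^ 2 * (1 - 2 * c - (2 * c) ^ 2 - (2 * c) ^ 3) := by
        have h5 : (2 * c) ^ 2 ≤ 1 / 4 := by nlinarith
        have h6 : (2 * c) ^ 3 ≤ 1 / 8 := by
          calc (2 * c) ^ 3 ≤ (1 / 2) ^ 3 := by gcongr; linarith
            _ = 1 / 8 := by norm_num
        exact mul_nonneg (sq_nonneg _) (by linarith)
      nlinarith
    · have := Real.add_one_le_exp (2 * c + 4 * c ^ 2)
      have h3 := mul_le_mul_of_nonneg_left this (show 0 ≤ 1 - 2 * c by linarith)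
      refine le_trans ?_ h3
      nlinarith [mul_nonneg (sq_nonneg c) (neg_nonneg.2 h)]
  have hpos : 0 < 1 - 2 * c := by linarith
  rw [div_le_iff₀ (Real.sqrt_pos.2 hpos)]
  have h : Real.exp (c + 2 * c ^ 2) = √(Real.exp (2 * c + 4 * c ^ 2)) := by
    rw [← Real.exp_half]
    congr 1
    ring
  rw [h, ← Real.sqrt_mul (Real.exp_pos _).le]
  exact Real.one_le_sqrt.2 (by linarith)

lemma lintegral_exp_mul_sq_sub_one_le {c : ℝ} (hc : |c| ≤ 1 / 4) :
    ∫⁻ g, ENNReal.ofReal (Real.exp (c * (g ^ 2 - 1))) ∂gaussianReal 0 1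
      ≤ ENNReal.ofReal (Real.exp (2 * c ^ 2)) := by
  have h : ∀ g : ℝ, ENNReal.ofReal (Real.exp (c * (g ^ 2 - 1)))
      = ENNReal.ofReal (Real.exp (-c)) * ENNReal.ofReal (Real.exp (c * g ^ 2)) := by
    intro g
    rw [← ENNReal.ofReal_mul (Real.exp_pos _).le, ← Real.exp_add]
    congr 2
    ring
  simp_rw [h]
  rw [lintegral_const_mul _ (by fun_prop), lintegral_exp_mul_sq (by linarith [(abs_le.1 hc).2]),
    ← ENNReal.ofReal_mul (Real.exp_pos _).le]
  refine ENNReal.ofReal_le_ofReal ?_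
  refine (mul_le_mul_of_nonneg_left (one_div_sqrt_le_exp hc) (Real.exp_pos _).le).trans ?_
  rw [← Real.exp_add]
  simp

lemma measure_sum_sq_inner_unit {n m : ℕ} {v : EuclideanSpace ℝ (Fin n)} (hv : ‖v‖ = 1) {t : ℝ}
    (ht : 0 < t) (ht1 : t ≤ 1) :
    designMeasure n m {a | m * t ≤ |∑ i, (inner ℝ (a i) v ^ 2 - 1)|}
      ≤ 2 * ENNReal.ofReal (Real.exp (-(m * (t ^ 2 / 8)))) := by
  have side : ∀ s : ℝ, |s| = 1 →
      designMeasure n m {a | m * (t ^ 2 / 4) ≤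
        ∑ i, (s * t / 4) * (inner ℝ (a i) v ^ 2 - 1)}
        ≤ ENNReal.ofReal (Real.exp (-(m * (t ^ 2 / 8)))) := by
    intro s hs
    have hs2 : s ^ 2 = 1 := by rw [← sq_abs, hs]; norm_num
    refine pi_chernoff_univ (stdGaussian (EuclideanSpace ℝ (Fin n)))
      (f := fun a => (s * t / 4) * (inner ℝ a v ^ 2 - 1)) (by fun_prop) ?_
    rw [lintegral_comp_inner hv
      (f := fun g => ENNReal.ofReal (Real.exp ((s * t / 4) * (g ^ 2 - 1)))) (by fun_prop)]
    refine (lintegral_exp_mul_sq_sub_one_le ?_).trans (le_of_eq ?_)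
    · rw [abs_div, abs_mul, hs, abs_of_pos ht]
      norm_num
      linarith
    · congr 2
      rw [div_pow, mul_pow, hs2]
      ring
  have hsub : {a : Fin m → EuclideanSpace ℝ (Fin n) |
      m * t ≤ |∑ i, (inner ℝ (a i) v ^ 2 - 1)|} ⊆
      {a | m * (t ^ 2 / 4) ≤ ∑ i, (1 * t / 4) * (inner ℝ (a i) v ^ 2 - 1)} ∪
      {a | m * (t ^ 2 / 4) ≤ ∑ i, (-1 * t / 4) * (inner ℝ (a i) v ^ 2 - 1)} := by
    intro a ha
    simp only [Set.mem_union, Set.mem_ofPred_eq, ← Finset.mul_sum] at ha ⊢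
    rcases le_abs.1 ha with h | h
    · left; nlinarith
    · right; nlinarith
  refine (measure_mono hsub).trans ((measure_union_le _ _).trans ?_)
  rw [two_mul]
  exact add_le_add (side 1 (by simp)) (side (-1) (by simp))

/-- Concentration of the sample second moment of a linear functional. -/
lemma measure_sum_sq_inner {n m : ℕ} (v : EuclideanSpace ℝ (Fin n)) {t : ℝ}
    (ht : 0 < t) (ht1 : t ≤ 1) :
    designMeasure n m {a | m * (t * ‖v‖ ^ 2) < |∑ i, inner ℝ (a i) v ^ 2 - m * ‖v‖ ^ 2|}
      ≤ 2 * ENNReal.ofReal (Real.exp (-(m * (t ^ 2 / 8)))) := by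
  rcases eq_or_ne v 0 with rfl | hv
  · simp
  have hn : 0 < ‖v‖ := norm_pos_iff.2 hv
  refine (measure_mono ?_).trans (measure_sum_sq_inner_unit (v := (‖v‖⁻¹) • v)
    (by rw [norm_smul, norm_inv, norm_norm, inv_mul_cancel₀ hn.ne']) ht ht1)
  intro a ha
  simp only [Set.mem_ofPred_eq, inner_smul_right] at ha ⊢
  have e : ∑ i, ((‖v‖⁻¹ * inner ℝ (a i) v) ^ 2 - 1)
      = (‖v‖ ^ 2)⁻¹ * (∑ i, inner ℝ (a i) v ^ 2 - m * ‖v‖ ^ 2) := by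
    rw [mul_sub, Finset.mul_sum, Finset.sum_sub_distrib]
    have : (‖v‖ ^ 2)⁻¹ * (m * ‖v‖ ^ 2) = m := by field_simp
    rw [this]
    simp [mul_pow]
  rw [e, abs_mul, abs_of_pos (by positivity : 0 < (‖v‖ ^ 2)⁻¹), le_inv_mul_iff₀ (by positivity)]
  nlinarith

/-! ### Restricted isometry from the entries of the Gram matrix -/

/-- The standard basis vectors. -/
abbrev stdVec {n : ℕ} (j : Fin n) : EuclideanSpace ℝ (Fin n) := EuclideanSpace.single j 1

lemma inner_stdVec {n : ℕ} (a : EuclideanSpace ℝ (Fin n)) (j : Fin n) :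
    inner ℝ a (stdVec j) = a j := by
  simp [stdVec, EuclideanSpace.inner_single_right]

/-- All entries of `(1/m) ∑ᵢ aᵢ aᵢᵀ - 1` are at most `t` in modulus; the inequality is multiplied
by `m`. -/
def GramClose {n m : ℕ} (t : ℝ) (a : Fin m → EuclideanSpace ℝ (Fin n)) : Prop :=
  ∀ j j', |∑ i, a i j * a i j' - m * (if j = j' then 1 else 0)| ≤ m * t

/-- The entries of the Gram matrix are differences of sample second moments, by polarization. -/
lemma measure_not_gramClose_le {n m : ℕ} {t : ℝ} (ht : 0 < t) (ht1 : t ≤ 1) :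
    designMeasure n m {a | ¬ GramClose t a}
      ≤ ENNReal.ofReal (4 * n ^ 2 * Real.exp (-(m * (t ^ 2 / 8)))) := by
  set bad : EuclideanSpace ℝ (Fin n) → Set (Fin m → EuclideanSpace ℝ (Fin n)) := fun v =>
    {a | m * (t * ‖v‖ ^ 2) < |∑ i, inner ℝ (a i) v ^ 2 - m * ‖v‖ ^ 2|} with hbad
  have hsub : {a : Fin m → EuclideanSpace ℝ (Fin n) | ¬ GramClose t a} ⊆
      ⋃ p : Fin n × Fin n, (bad (stdVec p.1 + stdVec p.2) ∪ bad (stdVec p.1 - stdVec p.2)) := by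
    intro a ha
    by_contra hcon
    refine ha fun j j' => ?_
    simp only [Set.mem_iUnion, not_exists, Set.mem_union, not_or, hbad, Set.mem_ofPred_eq,
      not_lt] at hcon
    obtain ⟨h1, h2⟩ := hcon (j, j')
    have hpar := parallelogram_law_with_norm ℝ (stdVec j) (stdVec j' : EuclideanSpace ℝ (Fin n))
    have hnj : ∀ j : Fin n, ‖(stdVec j : EuclideanSpace ℝ (Fin n))‖ = 1 := by
      intro j; simp [stdVec]
    rw [hnj, hnj] at hpar
    have hpol : ‖(stdVec j : EuclideanSpace ℝ (Fin n)) + stdVec j'‖ ^ 2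
        - ‖(stdVec j : EuclideanSpace ℝ (Fin n)) - stdVec j'‖ ^ 2
        = 4 * (if j = j' then 1 else 0) := by
      rw [norm_add_sq_real, norm_sub_sq_real, inner_stdVec]
      simp only [stdVec, PiLp.single_apply]
      by_cases h : j = j'
      · simp [h]; norm_num
      · simp [h, Ne.symm h]
    have hsum : ∑ i, a i j * a i j' = (1 / 4) * (∑ i, inner ℝ (a i) (stdVec j + stdVec j') ^ 2
        - ∑ i, inner ℝ (a i) (stdVec j - stdVec j') ^ 2) := by
      rw [← Finset.sum_sub_distrib, Finset.mul_sum]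
      refine Finset.sum_congr rfl fun i _ => ?_
      rw [inner_add_right, inner_sub_right, inner_stdVec, inner_stdVec]
      ring
    rw [hsum]
    rw [abs_le] at h1 h2 ⊢
    have hm : (0 : ℝ) ≤ m := Nat.cast_nonneg m
    have e1 := congrArg (fun y => (m : ℝ) * t * y) hpar
    have e2 := congrArg (fun y => (m : ℝ) * y) hpol
    constructor <;> nlinarith
  refine (measure_mono hsub).trans ((measure_iUnion_fintype_le _ _).trans ?_)
  refine (Finset.sum_le_sum fun p _ => (measure_union_le _ _).trans
    (add_le_add (measure_sum_sq_inner _ ht ht1) (measure_sum_sq_inner _ ht ht1))).trans ?_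
  rw [Finset.sum_const, Finset.card_univ, Fintype.card_prod, Fintype.card_fin, nsmul_eq_mul,
    ENNReal.ofReal_mul (by positivity)]
  refine le_of_eq ?_
  rw [← add_mul, ← mul_assoc]
  congr 1
  rw [ENNReal.ofReal_mul (by norm_num), ENNReal.ofReal_pow (by positivity)]
  simp
  ring

lemma inner_eq_sum {n : ℕ} (u v : EuclideanSpace ℝ (Fin n)) :
    inner ℝ u v = ∑ j, u j * v j := by
  simp [PiLp.inner_apply, mul_comm]

lemma sum_abs_le_sqrt_mul_norm {n s : ℕ} {h : EuclideanSpace ℝ (Fin n)} {Θ : Finset (Fin n)}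
    (hs : ∀ j ∉ Θ, h j = 0) (hc : Θ.card ≤ s) : ∑ j, |h j| ≤ √s * ‖h‖ := by
  have e : ∑ j, |h j| = ∑ j ∈ Θ, |h j| := by
    symm
    refine Finset.sum_subset (Finset.subset_univ _) fun j _ hj => ?_
    simp [hs j hj]
  rw [e, EuclideanSpace.norm_eq, ← Real.sqrt_mul (Nat.cast_nonneg s)]
  refine Real.le_sqrt_of_sq_le ?_
  refine (sq_sum_le_card_mul_sum_sq (s := Θ) (f := fun j => |h j|)).trans ?_
  have h1 : ∑ j ∈ Θ, |h j| ^ 2 ≤ ∑ j, ‖h j‖ ^ 2 := by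
    simp only [Real.norm_eq_abs]
    exact Finset.sum_le_sum_of_subset_of_nonneg (Finset.subset_univ _) fun j _ _ => by positivity
  exact mul_le_mul (by exact_mod_cast hc) h1 (by positivity) (by positivity)

/-- Entrywise closeness of the Gram matrix to the identity gives a restricted isometry on
`s`-sparse vectors, because their `ℓ¹` norm is at most `√s` times their `ℓ²` norm. -/
lemma GramClose.abs_sum_inner_mul_inner_sub_le {n m s : ℕ} {t : ℝ}
    {a : Fin m → EuclideanSpace ℝ (Fin n)}
    (ha : GramClose t a) (ht : 0 ≤ t) {h y : EuclideanSpace ℝ (Fin n)} {Θ Θ' : Finset (Fin n)}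
    (hs : ∀ j ∉ Θ, h j = 0) (hc : Θ.card ≤ s) (hs' : ∀ j ∉ Θ', y j = 0) (hc' : Θ'.card ≤ s) :
    |∑ i, inner ℝ (a i) h * inner ℝ (a i) y - m * inner ℝ h y| ≤ m * (t * s) * (‖h‖ * ‖y‖) := by
  have e : ∑ i, inner ℝ (a i) h * inner ℝ (a i) y - m * inner ℝ h y
      = ∑ j, ∑ j', h j * y j' * (∑ i, a i j * a i j' - m * (if j = j' then 1 else 0)) := by
    have e1 : ∑ i, inner ℝ (a i) h * inner ℝ (a i) y
        = ∑ j, ∑ j', h j * y j' * ∑ i, a i j * a i j' := by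
      simp_rw [inner_eq_sum, Finset.sum_mul_sum, Finset.mul_sum]
      rw [Finset.sum_comm]
      refine Finset.sum_congr rfl fun j _ => ?_
      rw [Finset.sum_comm]
      refine Finset.sum_congr rfl fun j' _ => Finset.sum_congr rfl fun i _ => ?_
      ring
    have e2 : m * inner ℝ h y
        = ∑ j, ∑ j', h j * y j' * ((m : ℝ) * (if j = j' then 1 else 0)) := by
      simp only [mul_ite, mul_one, mul_zero, Finset.sum_ite_eq, Finset.mem_univ, if_true]
      rw [inner_eq_sum, Finset.mul_sum]
      exact Finset.sum_congr rfl fun j _ => by ring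
    rw [e1, e2, ← Finset.sum_sub_distrib]
    refine Finset.sum_congr rfl fun j _ => ?_
    rw [← Finset.sum_sub_distrib]
    exact Finset.sum_congr rfl fun j' _ => by ring
  rw [e]
  have hm : (0 : ℝ) ≤ m := Nat.cast_nonneg m
  calc _ ≤ ∑ j, ∑ j', |h j| * |y j'| * (m * t) := by
        refine (Finset.abs_sum_le_sum_abs _ _).trans (Finset.sum_le_sum fun j _ => ?_)
        refine (Finset.abs_sum_le_sum_abs _ _).trans (Finset.sum_le_sum fun j' _ => ?_)
        rw [abs_mul, abs_mul]
        exact mul_le_mul_of_nonneg_left (ha j j') (by positivity)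
    _ = (∑ j, |h j|) * (∑ j, |y j|) * (m * t) := by
        rw [Finset.sum_mul_sum, Finset.sum_mul]
        refine Finset.sum_congr rfl fun j _ => ?_
        rw [Finset.sum_mul]
    _ ≤ (√s * ‖h‖) * (√s * ‖y‖) * (m * t) := by
        refine mul_le_mul_of_nonneg_right ?_ (by positivity)
        exact mul_le_mul (sum_abs_le_sqrt_mul_norm hs hc) (sum_abs_le_sqrt_mul_norm hs' hc')
          (Finset.sum_nonneg fun _ _ => abs_nonneg _) (by positivity)
    _ = m * (t * s) * (‖h‖ * ‖y‖) := by
        have := Real.mul_self_sqrt (Nat.cast_nonneg (α := ℝ) s)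
        linear_combination (‖h‖ * ‖y‖ * (m * t)) * this

lemma GramClose.abs_sum_sq_inner_sub_le {n m s : ℕ} {t : ℝ} {a : Fin m → EuclideanSpace ℝ (Fin n)}
    (ha : GramClose t a) (ht : 0 ≤ t) {h : EuclideanSpace ℝ (Fin n)} {Θ : Finset (Fin n)}
    (hs : ∀ j ∉ Θ, h j = 0) (hc : Θ.card ≤ s) :
    |∑ i, inner ℝ (a i) h ^ 2 - m * ‖h‖ ^ 2| ≤ m * (t * s) * ‖h‖ ^ 2 := by
  have := ha.abs_sum_inner_mul_inner_sub_le ht hs hc hs hc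
  simpa [real_inner_self_eq_norm_sq, ← pow_two] using this

/-! ### Nets of sparse vectors -/

/-- The points of the grid of mesh `1 / (2 d)` with coordinates at most `1` in modulus, supported
on the indices listed by `θ`. A coordinate `q / (2 d)` is encoded by `q + 2 d ∈ {0, …, 4 d}`. -/
def gridPoint {n d : ℕ} (p : (Fin d → Fin n) × (Fin d → Fin (4 * d + 1))) :
    EuclideanSpace ℝ (Fin n) :=
  WithLp.toLp 2 fun j => if h : ∃ r, p.1 r = j then
    (((p.2 h.choose : ℕ) : ℝ) - 2 * d) / (2 * d) else 0

/-- Rounding a vector of the unit ball supported on `Θ` towards zero gives a grid point at distance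
at most `1 / 2`, in the unit ball and with the same support. -/
lemma exists_gridPoint {n d : ℕ} {h : EuclideanSpace ℝ (Fin n)}
    (θ : Fin d → Fin n) (hs : ∀ j, (∀ r, θ r ≠ j) → h j = 0) (hh : ‖h‖ ≤ 1) :
    ∃ c : Fin d → Fin (4 * d + 1), ‖gridPoint (θ, c)‖ ≤ 1 ∧ ‖h - gridPoint (θ, c)‖ ≤ 1 / 2 ∧
      ∀ j, (∀ r, θ r ≠ j) → gridPoint (θ, c) j = 0 := by
  classical
  rcases Nat.eq_zero_or_pos d with rfl | hd
  · have h0 : h = 0 := by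
      ext j
      exact hs j fun r => r.elim0
    have hg : ∀ c, gridPoint (θ, c) = 0 := by
      intro c
      ext j
      simp [gridPoint]
    refine ⟨fun _ => 0, by simp [hg], by simp [hg, h0], by simp [hg]⟩
  have hd' : (0 : ℝ) < d := by exact_mod_cast hd
  have hcoord : ∀ j, |h j| ≤ 1 := fun j => by
    have := (PiLp.norm_apply_le h j).trans hh
    simpa using this
  -- rounding towards zero, so that the norm does not grow
  have hround : ∀ y : ℝ, |y| ≤ 1 → ∃ q : Fin (4 * d + 1),
      |(((q : ℕ) : ℝ) - 2 * d) / (2 * d)| ≤ |y| ∧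
      |y - (((q : ℕ) : ℝ) - 2 * d) / (2 * d)| ≤ 1 / (2 * d) := by
    intro y hy
    obtain ⟨hy1, hy2⟩ := abs_le.1 hy
    rcases le_total 0 y with h0 | h0
    · have hf := Nat.floor_le (show 0 ≤ 2 * d * y by positivity)
      have hf' := Nat.lt_floor_add_one (2 * d * y)
      have hle : ⌊2 * d * y⌋₊ ≤ 2 * d := by
        have : ((⌊2 * d * y⌋₊ : ℕ) : ℝ) ≤ ((2 * d : ℕ) : ℝ) := by push_cast; nlinarith
        exact_mod_cast this
      refine ⟨⟨2 * d + ⌊2 * d * y⌋₊, by omega⟩, ?_, ?_⟩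
      · simp only [Nat.cast_add, Nat.cast_mul, Nat.cast_ofNat, add_sub_cancel_left]
        rw [abs_of_nonneg h0, abs_of_nonneg (by positivity), div_le_iff₀ (by positivity)]
        linarith
      · simp only [Nat.cast_add, Nat.cast_mul, Nat.cast_ofNat, add_sub_cancel_left]
        rw [show y - (⌊2 * d * y⌋₊ : ℝ) / (2 * d) = (2 * d * y - ⌊2 * d * y⌋₊) / (2 * d) by
          field_simp, abs_of_nonneg (by apply div_nonneg <;> linarith)]
        gcongr
        linarith
    · have hf := Nat.floor_le (show 0 ≤ 2 * d * (-y) by nlinarith)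
      have hf' := Nat.lt_floor_add_one (2 * d * (-y))
      have hle : ⌊2 * d * (-y)⌋₊ ≤ 2 * d := by
        have : ((⌊2 * d * (-y)⌋₊ : ℕ) : ℝ) ≤ ((2 * d : ℕ) : ℝ) := by push_cast; nlinarith
        exact_mod_cast this
      refine ⟨⟨2 * d - ⌊2 * d * (-y)⌋₊, by omega⟩, ?_, ?_⟩
      · simp only [Nat.cast_sub hle, Nat.cast_mul, Nat.cast_ofNat, sub_sub_cancel_left]
        rw [abs_of_nonpos h0, neg_div, abs_neg, abs_of_nonneg (by positivity),
          div_le_iff₀ (by positivity)]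
        linarith
      · simp only [Nat.cast_sub hle, Nat.cast_mul, Nat.cast_ofNat, sub_sub_cancel_left]
        rw [show y - -(⌊2 * d * (-y)⌋₊ : ℝ) / (2 * d)
          = -((2 * d * (-y) - ⌊2 * d * (-y)⌋₊) / (2 * d)) by field_simp; ring, abs_neg,
          abs_of_nonneg (by apply div_nonneg <;> linarith)]
        gcongr
        linarith
  choose q hq1 hq2 using fun j => hround (h j) (hcoord j)
  have hval : ∀ j, (∃ r, θ r = j) → gridPoint (θ, fun r => q (θ r)) j
      = (((q j : ℕ) : ℝ) - 2 * d) / (2 * d) := by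
    intro j hj
    simp only [gridPoint]
    rw [dif_pos hj, hj.choose_spec]
  have hval0 : ∀ j, (∀ r, θ r ≠ j) → gridPoint (θ, fun r => q (θ r)) j = 0 := by
    intro j hj
    simp only [gridPoint]
    rw [dif_neg (by simpa using hj)]
  refine ⟨fun r => q (θ r), ?_, ?_, hval0⟩
  · refine le_trans ?_ hh
    rw [EuclideanSpace.norm_eq, EuclideanSpace.norm_eq]
    refine Real.sqrt_le_sqrt (Finset.sum_le_sum fun j _ => ?_)
    by_cases hj : ∃ r, θ r = j
    · rw [hval j hj]
      simp only [Real.norm_eq_abs]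
      exact pow_le_pow_left₀ (abs_nonneg _) (hq1 j) 2
    · rw [hval0 j (by simpa using hj)]
      simp
      positivity
  · rw [EuclideanSpace.norm_eq]
    refine Real.sqrt_le_iff.2 ⟨by norm_num, ?_⟩
    have e : ∑ j, ‖(h - gridPoint (θ, fun r => q (θ r))) j‖ ^ 2
        = ∑ j ∈ Finset.univ.image θ, ‖(h - gridPoint (θ, fun r => q (θ r))) j‖ ^ 2 := by
      symm
      refine Finset.sum_subset (Finset.subset_univ _) fun j _ hj => ?_
      have hj' : ∀ r, θ r ≠ j := by simpa using hj
      simp [hs j hj', hval0 j hj']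
    rw [e]
    have hb : ∀ j ∈ Finset.univ.image θ, ‖(h - gridPoint (θ, fun r => q (θ r))) j‖ ^ 2
        ≤ (1 / (2 * d)) ^ 2 := by
      intro j hj
      have hj' : ∃ r, θ r = j := by simpa using hj
      rw [PiLp.sub_apply, hval j hj', Real.norm_eq_abs]
      exact pow_le_pow_left₀ (abs_nonneg _) (hq2 j) 2
    refine (Finset.sum_le_card_nsmul _ _ _ hb).trans ?_
    have hcard : ((Finset.univ.image θ).card : ℝ) ≤ d := by
      have := Finset.card_image_le (s := Finset.univ) (f := θ)
      simp only [Finset.card_univ, Fintype.card_fin] at this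
      exact_mod_cast this
    have hd1 : (1 : ℝ) ≤ d := by exact_mod_cast hd
    rw [nsmul_eq_mul]
    calc ((Finset.univ.image θ).card : ℝ) * (1 / (2 * d)) ^ 2
        ≤ (d : ℝ) * (1 / (2 * d)) ^ 2 := by gcongr
      _ = 1 / (4 * (d : ℝ)) := by field_simp; norm_num
      _ ≤ (1 / 2) ^ 2 := by
        rw [div_le_iff₀ (by positivity)]
        linarith

/-- A seminorm that is at most `M` on the grid points supported on `θ` is at most `2 M` on the
unit ball of the vectors supported on `θ`: halve the rounding error repeatedly. -/
lemma le_two_mul_of_gridPoint_le {n d : ℕ} (θ : Fin d → Fin n)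
    (p : Seminorm ℝ (EuclideanSpace ℝ (Fin n))) {C M : ℝ} (hC : ∀ h, p h ≤ C * ‖h‖)
    (hM : ∀ c, ‖gridPoint (θ, c)‖ ≤ 1 → p (gridPoint (θ, c)) ≤ M)
    {h : EuclideanSpace ℝ (Fin n)} (hs : ∀ j, (∀ r, θ r ≠ j) → h j = 0) (hh : ‖h‖ ≤ 1) :
    p h ≤ 2 * M := by
  have hM0 : 0 ≤ M := by
    obtain ⟨c, hc, -⟩ := exists_gridPoint θ hs hh
    exact (apply_nonneg p _).trans (hM c hc)
  have hstep : ∀ r : ℕ, ∀ h : EuclideanSpace ℝ (Fin n), (∀ j, (∀ r, θ r ≠ j) → h j = 0) →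
      ‖h‖ ≤ 1 → p h ≤ 2 * M + |C| * (1 / 2) ^ r := by
    intro r
    induction r with
    | zero =>
      intro h _ hh
      have := hC h
      have h2 : C * ‖h‖ ≤ |C| * 1 :=
        mul_le_mul (le_abs_self C) hh (norm_nonneg _) (abs_nonneg _)
      simp only [pow_zero]
      linarith
    | succ r ih =>
      intro h hs hh
      obtain ⟨c, hc1, hc2, hc3⟩ := exists_gridPoint θ hs hh
      have h1 := ih ((2 : ℝ) • (h - gridPoint (θ, c))) (fun j hj => by
        simp [hs j hj, hc3 j hj]) (by
        rw [norm_smul]; norm_num; linarith)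
      rw [map_smul_eq_mul] at h1
      have h2 : p h ≤ p (gridPoint (θ, c)) + p (h - gridPoint (θ, c)) := by
        have := map_add_le_add p (gridPoint (θ, c)) (h - gridPoint (θ, c))
        simpa using this
      have h3 := hM c hc1
      norm_num at h1
      rw [pow_succ]
      linarith
  have hlim : Filter.Tendsto (fun r : ℕ => 2 * M + |C| * (1 / 2 : ℝ) ^ r) Filter.atTop
      (nhds (2 * M + |C| * 0)) :=
    ((tendsto_pow_atTop_nhds_zero_of_lt_one (by norm_num) (by norm_num)).const_mul _).const_add _
  have := ge_of_tendsto' hlim fun r => hstep r h hs hh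
  simpa using this

lemma exists_tuple_covering {n d : ℕ} {Θ : Finset (Fin n)} (hne : Θ.Nonempty) (hc : Θ.card ≤ d) :
    ∃ θ : Fin d → Fin n, ∀ j, (∀ r, θ r ≠ j) → j ∉ Θ := by
  obtain ⟨j0, hj0⟩ := hne
  refine ⟨fun r => if h : (r : ℕ) < Θ.card then Θ.equivFin.symm ⟨r, h⟩ else j0, ?_⟩
  intro j hj hmem
  have hlt := (Θ.equivFin ⟨j, hmem⟩).2
  refine hj ⟨Θ.equivFin ⟨j, hmem⟩, hlt.trans_le hc⟩ ?_
  simp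

/-- The linear map whose coordinates are the functionals `⟨bᵢ, ·⟩`, `i ∈ I`. -/
def innerMap {n : ℕ} {ι : Type*} (I : Finset ι) (b : ι → EuclideanSpace ℝ (Fin n)) :
    EuclideanSpace ℝ (Fin n) →ₗ[ℝ] EuclideanSpace ℝ I where
  toFun h := WithLp.toLp 2 fun i : I => inner ℝ (b i) h
  map_add' h h' := by
    ext i
    simp [inner_add_right]
  map_smul' r h := by
    ext i
    simp [inner_smul_right]

/-- The root of a sum of squares of linear functionals, as a seminorm. -/
def sumSqSeminorm {n : ℕ} {ι : Type*} (I : Finset ι) (b : ι → EuclideanSpace ℝ (Fin n)) :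
    Seminorm ℝ (EuclideanSpace ℝ (Fin n)) :=
  (normSeminorm ℝ (EuclideanSpace ℝ I)).comp (innerMap I b)

lemma sumSqSeminorm_apply {n : ℕ} {ι : Type*} (I : Finset ι) (b : ι → EuclideanSpace ℝ (Fin n))
    (h : EuclideanSpace ℝ (Fin n)) :
    sumSqSeminorm I b h = √(∑ i ∈ I, inner ℝ (b i) h ^ 2) := by
  simp only [sumSqSeminorm, Seminorm.comp_apply, coe_normSeminorm, innerMap, LinearMap.coe_mk,
    AddHom.coe_mk, EuclideanSpace.norm_eq, Real.norm_eq_abs, sq_abs]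
  rw [Finset.sum_coe_sort I fun i => inner ℝ (b i) h ^ 2]

/-- A quadratic form that is at most `M` on the grid points of the unit ball is at most
`4 M ‖h‖ ^ 2` at the vectors `h` supported on `θ`. -/
lemma sum_sq_inner_le_of_gridPoint_le {n d : ℕ} {ι : Type*} (I : Finset ι)
    (b : ι → EuclideanSpace ℝ (Fin n)) (θ : Fin d → Fin n) {M : ℝ}
    (hM : ∀ c, ‖gridPoint (θ, c)‖ ≤ 1 → ∑ i ∈ I, inner ℝ (b i) (gridPoint (θ, c)) ^ 2 ≤ M)
    {h : EuclideanSpace ℝ (Fin n)} (hs : ∀ j, (∀ r, θ r ≠ j) → h j = 0) :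
    ∑ i ∈ I, inner ℝ (b i) h ^ 2 ≤ 4 * M * ‖h‖ ^ 2 := by
  rcases eq_or_ne h 0 with rfl | hne
  · simp
  have hn : 0 < ‖h‖ := norm_pos_iff.2 hne
  have hC : ∀ y, sumSqSeminorm I b y ≤ √(∑ i ∈ I, ‖b i‖ ^ 2) * ‖y‖ := by
    intro y
    rw [sumSqSeminorm_apply]
    rw [← Real.sqrt_sq (norm_nonneg y),
      ← Real.sqrt_mul (Finset.sum_nonneg fun i _ => sq_nonneg ‖b i‖)]
    refine Real.sqrt_le_sqrt ?_
    rw [Finset.sum_mul]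
    refine Finset.sum_le_sum fun i _ => ?_
    have h1 := abs_real_inner_le_norm (b i) y
    have h2 : 0 ≤ ‖b i‖ * ‖y‖ := by positivity
    rw [← mul_pow]
    exact sq_le_sq.2 (h1.trans_eq (abs_of_nonneg h2).symm)
  have hmain := le_two_mul_of_gridPoint_le θ (sumSqSeminorm I b) hC (M := √M) (fun c hc => by
    rw [sumSqSeminorm_apply]
    exact Real.sqrt_le_sqrt (hM c hc)) (h := ‖h‖⁻¹ • h) (fun j hj => by simp [hs j hj])
    (by rw [norm_smul, norm_inv, norm_norm, inv_mul_cancel₀ hn.ne'])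
  have hM0 : 0 ≤ M := by
    obtain ⟨c, hc, -⟩ := exists_gridPoint (h := 0) θ (fun _ _ => rfl) (by simp)
    exact (Finset.sum_nonneg fun i _ => sq_nonneg _).trans (hM c hc)
  rw [map_smul_eq_mul, norm_inv, norm_norm, inv_mul_le_iff₀ hn, sumSqSeminorm_apply,
    Real.sqrt_le_left (by positivity)] at hmain
  refine hmain.trans (le_of_eq ?_)
  rw [mul_pow, mul_pow, Real.sq_sqrt hM0]
  ring

/-! ### Small subsets of the measurements carry little energy -/

lemma lintegral_exp_sq_inner_div_four_le {n : ℕ} {v : EuclideanSpace ℝ (Fin n)} (hv : ‖v‖ ≤ 1) :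
    ∫⁻ a, ENNReal.ofReal (Real.exp (inner ℝ a v ^ 2 / 4))
      ∂stdGaussian (EuclideanSpace ℝ (Fin n)) ≤ ENNReal.ofReal √2 := by
  rcases eq_or_ne v 0 with rfl | h0
  · simp
  have hn : 0 < ‖v‖ := norm_pos_iff.2 h0
  have hu : ‖‖v‖⁻¹ • v‖ = 1 := by rw [norm_smul, norm_inv, norm_norm, inv_mul_cancel₀ hn.ne']
  have hle : ∀ a : EuclideanSpace ℝ (Fin n),
      inner ℝ a v ^ 2 / 4 ≤ 1 / 4 * inner ℝ a (‖v‖⁻¹ • v) ^ 2 := by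
    intro a
    have e : inner ℝ a v = ‖v‖ * inner ℝ a (‖v‖⁻¹ • v) := by
      rw [inner_smul_right, mul_inv_cancel_left₀ hn.ne']
    rw [e, mul_pow]
    have : ‖v‖ ^ 2 ≤ 1 := pow_le_one₀ hn.le hv
    nlinarith [sq_nonneg (inner ℝ a (‖v‖⁻¹ • v))]
  refine (lintegral_mono fun a => ENNReal.ofReal_le_ofReal (Real.exp_le_exp.2 (hle a))).trans ?_
  rw [lintegral_comp_inner hu
    (f := fun g => ENNReal.ofReal (Real.exp (1 / 4 * g ^ 2))) (by fun_prop),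
    lintegral_exp_mul_sq (by norm_num)]
  refine ENNReal.ofReal_le_ofReal (le_of_eq ?_)
  rw [show (1 : ℝ) - 2 * (1 / 4) = 2⁻¹ by norm_num, Real.sqrt_inv]
  simp

/-- The excesses of `⟨aᵢ, v⟩ ^ 2` over a high level `M` have a small mean. -/
lemma measure_sum_excess_le {n m : ℕ} {v : EuclideanSpace ℝ (Fin n)} (hv : ‖v‖ ≤ 1) {M τ : ℝ}
    (hM : √2 * Real.exp (-(M / 4)) ≤ τ / 8) :
    designMeasure n m {a | m * (τ / 4) ≤ ∑ i, max (inner ℝ (a i) v ^ 2 - M) 0 / 4}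
      ≤ ENNReal.ofReal (Real.exp (-(m * (τ / 8)))) := by
  refine pi_chernoff_univ _ (f := fun a => max (inner ℝ a v ^ 2 - M) 0 / 4) (by fun_prop) ?_
  have hle : ∀ a : EuclideanSpace ℝ (Fin n),
      ENNReal.ofReal (Real.exp (max (inner ℝ a v ^ 2 - M) 0 / 4))
      ≤ 1 + ENNReal.ofReal (Real.exp (-(M / 4))) *
        ENNReal.ofReal (Real.exp (inner ℝ a v ^ 2 / 4)) := by
    intro a
    rw [← ENNReal.ofReal_mul (Real.exp_pos _).le, ← Real.exp_add, ← ENNReal.ofReal_one,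
      ← ENNReal.ofReal_add zero_le_one (Real.exp_pos _).le]
    refine ENNReal.ofReal_le_ofReal ?_
    rcases le_total (inner ℝ a v ^ 2 - M) 0 with h | h
    · rw [max_eq_right h]
      simp [(Real.exp_pos _).le]
    · rw [max_eq_left h, show -(M / 4) + inner ℝ a v ^ 2 / 4 = (inner ℝ a v ^ 2 - M) / 4 by ring]
      linarith
  refine (lintegral_mono hle).trans ?_
  rw [lintegral_add_left measurable_const, lintegral_const_mul _ (by fun_prop)]
  simp only [lintegral_const, measure_univ, mul_one]
  refine (add_le_add_right (mul_le_mul_right (lintegral_exp_sq_inner_div_four_le hv) _) _).trans ?_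
  rw [← ENNReal.ofReal_mul (Real.exp_pos _).le, ← ENNReal.ofReal_one,
    ← ENNReal.ofReal_add zero_le_one (by positivity)]
  refine ENNReal.ofReal_le_ofReal ?_
  have := Real.add_one_le_exp (τ / 4 - τ / 8)
  linarith

/-- Sets of at most `η m` measurements carry at most the fraction `ε` of the energy of every
`d`-sparse vector. -/
def SmallSubsetEnergy {n m : ℕ} (η ε : ℝ) (d : ℕ) (a : Fin m → EuclideanSpace ℝ (Fin n)) : Prop :=
  ∀ B : Finset (Fin m), (B.card : ℝ) ≤ η * m → ∀ (h : EuclideanSpace ℝ (Fin n))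
    (Θ : Finset (Fin n)), Θ.card ≤ d → (∀ j ∉ Θ, h j = 0) →
    ∑ i ∈ B, inner ℝ (a i) h ^ 2 ≤ m * ε * ‖h‖ ^ 2

/-- No union bound over the subsets is needed: a sum over a set `B` is at most `M |B|` plus the
sum of all excesses over the level `M`. -/
lemma exists_measure_not_smallSubsetEnergy_le {ε : ℝ} (hε : 0 < ε) :
    ∃ η c : ℝ, 0 < η ∧ η ≤ 1 ∧ 0 < c ∧ ∀ n m d : ℕ,
      designMeasure n m {a | ¬ SmallSubsetEnergy η ε d a}
        ≤ ENNReal.ofReal ((n * (4 * d + 1)) ^ d * Real.exp (-(c * m))) := by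
  obtain ⟨M, hM1, hM⟩ : ∃ M : ℝ, 1 ≤ M ∧ √2 * Real.exp (-(M / 4)) ≤ (ε / 8) / 8 := by
    have h : Filter.Tendsto (fun M : ℝ => √2 * Real.exp (-(M / 4))) Filter.atTop
        (nhds (√2 * 0)) :=
      (Real.tendsto_exp_neg_atTop_nhds_zero.comp
        (Filter.tendsto_id.atTop_div_const (by norm_num : (0 : ℝ) < 4))).const_mul _
    rw [mul_zero] at h
    have h1 := h.eventually (gt_mem_nhds (show (0 : ℝ) < (ε / 8) / 8 by positivity))
    obtain ⟨M, h1, h2⟩ := (h1.and (Filter.eventually_ge_atTop 1)).exists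
    exact ⟨M, h2, h1.le⟩
  refine ⟨min (ε / (8 * M)) 1, ε / 64, by positivity, min_le_right _ _, by positivity, ?_⟩
  intro n m d
  set bad : (Fin d → Fin n) × (Fin d → Fin (4 * d + 1)) → Set (Fin m → EuclideanSpace ℝ (Fin n)) :=
    fun p => {a | ‖(gridPoint p : EuclideanSpace ℝ (Fin n))‖ ≤ 1 ∧
      m * ((ε / 8) / 4) ≤ ∑ i, max (inner ℝ (a i) (gridPoint p) ^ 2 - M) 0 / 4} with hbad
  have hsub : {a : Fin m → EuclideanSpace ℝ (Fin n) |
      ¬ SmallSubsetEnergy (min (ε / (8 * M)) 1) ε d a} ⊆ ⋃ p, bad p := by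
    intro a ha
    by_contra hcon
    refine ha fun B hB h Θ hΘ hs => ?_
    simp only [Set.mem_iUnion, not_exists, hbad, Set.mem_ofPred_eq, not_and, not_le] at hcon
    rcases Θ.eq_empty_or_nonempty with rfl | hne
    · have h0 : h = 0 := by
        ext j
        exact hs j (by simp)
      simp [h0]
    obtain ⟨θ, hθ⟩ := exists_tuple_covering hne hΘ
    have hbd : ∀ c, ‖gridPoint (θ, c)‖ ≤ 1 →
        ∑ i ∈ B, inner ℝ (a i) (gridPoint (θ, c)) ^ 2 ≤ m * (ε / 4) := by
      intro c hc
      have h1 := hcon (θ, c) hc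
      rw [← Finset.sum_div] at h1
      have h2 : ∑ i ∈ B, inner ℝ (a i) (gridPoint (θ, c)) ^ 2
          ≤ ∑ i ∈ B, (M + max (inner ℝ (a i) (gridPoint (θ, c)) ^ 2 - M) 0) :=
        Finset.sum_le_sum fun i _ => by
          linarith [le_max_left (inner ℝ (a i) (gridPoint (θ, c)) ^ 2 - M) 0]
      rw [Finset.sum_add_distrib, Finset.sum_const, nsmul_eq_mul] at h2
      have h3 : ∑ i ∈ B, max (inner ℝ (a i) (gridPoint (θ, c)) ^ 2 - M) 0
          ≤ ∑ i, max (inner ℝ (a i) (gridPoint (θ, c)) ^ 2 - M) 0 :=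
        Finset.sum_le_sum_of_subset_of_nonneg (Finset.subset_univ _)
          fun i _ _ => le_max_right _ _
      have h4 : (B.card : ℝ) * M ≤ m * (ε / 8) := by
        have hm : (0 : ℝ) ≤ m := Nat.cast_nonneg m
        have : (B.card : ℝ) ≤ ε / (8 * M) * m :=
          hB.trans (mul_le_mul_of_nonneg_right (min_le_left _ _) hm)
        calc (B.card : ℝ) * M ≤ (ε / (8 * M) * m) * M := by gcongr
          _ = m * (ε / 8) := by field_simp
      linarith
    have := sum_sq_inner_le_of_gridPoint_le B a θ hbd (h := h) fun j hj => hs j (hθ j hj)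
    linarith
  refine (measure_mono hsub).trans ((measure_iUnion_fintype_le _ _).trans ?_)
  have hone : ∀ p, designMeasure n m (bad p) ≤ ENNReal.ofReal (Real.exp (-(ε / 64 * m))) := by
    intro p
    by_cases hp : ‖(gridPoint p : EuclideanSpace ℝ (Fin n))‖ ≤ 1
    · refine (measure_mono fun a ha => ha.2).trans ((measure_sum_excess_le hp hM).trans
        (le_of_eq ?_))
      congr 3
      ring
    · have : bad p = ∅ := by
        ext a
        simp [hbad, hp]
      simp [this]
  refine (Finset.sum_le_sum fun p _ => hone p).trans (le_of_eq ?_)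
  rw [Finset.sum_const, Finset.card_univ, nsmul_eq_mul, ENNReal.ofReal_mul (by positivity)]
  congr 1
  rw [← ENNReal.ofReal_natCast]
  congr 1
  simp [mul_pow]

/-! ### Few measurements are small -/

lemma measure_sum_indicator_ge_le {α : Type*} [MeasurableSpace α] {m : ℕ} (ρ : Measure α)
    [IsProbabilityMeasure ρ] {s : Set α} (hs : MeasurableSet s) {p : ℝ} (hp : 0 ≤ p)
    (h : ρ s ≤ ENNReal.ofReal p) {c : ℝ} (hc : 4 * p ≤ c) :
    Measure.pi (fun _ : Fin m => ρ) {a | m * c ≤ ∑ i, s.indicator 1 (a i)}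
      ≤ ENNReal.ofReal (Real.exp (-(m * (c / 2)))) := by
  refine pi_chernoff_univ ρ (f := s.indicator 1) (measurable_one.indicator hs) ?_
  have hle : ∀ a, ENNReal.ofReal (Real.exp (s.indicator 1 a))
      ≤ 1 + s.indicator (fun _ => 2) a := by
    intro a
    by_cases ha : a ∈ s
    · simp only [Set.indicator_of_mem ha, Pi.one_apply]
      rw [show (1 + 2 : ℝ≥0∞) = ENNReal.ofReal 3 by norm_num]
      exact ENNReal.ofReal_le_ofReal (by linarith [Real.exp_one_lt_d9])
    · simp [Set.indicator_of_notMem ha]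
  refine (lintegral_mono hle).trans ?_
  rw [lintegral_add_left measurable_const, lintegral_indicator_const hs]
  simp only [lintegral_const, measure_univ, mul_one]
  refine (add_le_add_right (mul_le_mul_right h 2) 1).trans ?_
  rw [show (2 : ℝ≥0∞) = ENNReal.ofReal 2 by norm_num, ← ENNReal.ofReal_mul (by norm_num),
    ← ENNReal.ofReal_one, ← ENNReal.ofReal_add zero_le_one (by positivity)]
  refine ENNReal.ofReal_le_ofReal ?_
  have := Real.add_one_le_exp (c - c / 2)
  linarith

lemma gaussianReal_abs_le_le (η : ℝ) :
    gaussianReal 0 1 {g | |g| ≤ η} ≤ ENNReal.ofReal (2 * η) := by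
  have hset : {g : ℝ | |g| ≤ η} = Set.Icc (-η) η := by
    ext g
    simp [abs_le]
  rw [hset, gaussianReal_apply _ one_ne_zero]
  have hpdf : ∀ g, gaussianPDF 0 1 g ≤ 1 := by
    intro g
    rw [gaussianPDF, ← ENNReal.ofReal_one]
    refine ENNReal.ofReal_le_ofReal ?_
    rw [gaussianPDFReal]
    refine mul_le_one₀ ?_ (Real.exp_pos _).le (Real.exp_le_one_iff.2 ?_)
    · refine inv_le_one_of_one_le₀ (Real.one_le_sqrt.2 ?_)
      simp only [NNReal.coe_one, mul_one]
      linarith [Real.pi_gt_three]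
    · rw [neg_div]
      exact neg_nonpos.2 (by positivity)
  refine (lintegral_mono hpdf).trans (le_of_eq ?_)
  simp only [lintegral_const, MeasurableSet.univ, Measure.restrict_apply, Set.univ_inter,
    Real.volume_Icc, one_mul]
  congr 1
  ring

open scoped Classical in
lemma measure_card_small_inner_ge_le {n m : ℕ} {x : EuclideanSpace ℝ (Fin n)} (hx : ‖x‖ = 1)
    {η c : ℝ} (hη : 0 ≤ η) (hc : 8 * η ≤ c) :
    designMeasure n m {a | m * c ≤ (Finset.univ.filter fun i => |inner ℝ (a i) x| ≤ η).card}
      ≤ ENNReal.ofReal (Real.exp (-(m * (c / 2)))) := by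
  have hs : MeasurableSet {a : EuclideanSpace ℝ (Fin n) | |inner ℝ a x| ≤ η} :=
    measurableSet_le (by fun_prop) measurable_const
  refine le_trans (le_of_eq ?_) (measure_sum_indicator_ge_le (stdGaussian _) hs
    (p := 2 * η) (by positivity) ?_ (c := c) (by linarith))
  · congr 1
    ext a
    simp [Set.indicator_apply]
  · have : MeasurableSet {g : ℝ | |g| ≤ η} := measurableSet_le (by fun_prop) measurable_const
    rw [show {a : EuclideanSpace ℝ (Fin n) | |inner ℝ a x| ≤ η}
      = (fun a => inner ℝ a x) ⁻¹' {g : ℝ | |g| ≤ η} from rfl,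
      ← Measure.map_apply (by fun_prop) this, map_inner_stdGaussian hx]
    exact gaussianReal_abs_le_le η

/-! ### Concentration of the support statistics -/

/-- A common bound for the moments of order `4` and `8` of a standard Gaussian variable. -/
def momentBound : ℝ := 1 + ∫ g : ℝ, g ^ 8 ∂gaussianReal 0 1

lemma one_le_momentBound : 1 ≤ momentBound := by
  have : 0 ≤ ∫ g : ℝ, g ^ 8 ∂gaussianReal 0 1 := integral_nonneg fun g => by positivity
  unfold momentBound
  linarith

lemma integral_pow_four_le_momentBound : ∫ g : ℝ, g ^ 4 ∂gaussianReal 0 1 ≤ momentBound := by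
  have h : ∀ g : ℝ, g ^ 4 ≤ 1 + g ^ 8 := fun g => by
    nlinarith [sq_nonneg (g ^ 4 - 1), sq_nonneg (g ^ 4)]
  have := integral_mono (integrable_pow_gaussianReal 4)
    ((integrable_const (1 : ℝ)).add (integrable_pow_gaussianReal 8)) h
  rw [integral_add' (integrable_const (1 : ℝ)) (integrable_pow_gaussianReal 8)] at this
  simpa [momentBound] using this

lemma integral_inner_sq {n : ℕ} (b : EuclideanSpace ℝ (Fin n)) :
    ∫ a, inner ℝ a b ^ 2 ∂stdGaussian (EuclideanSpace ℝ (Fin n)) = ‖b‖ ^ 2 := by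
  rcases eq_or_ne b 0 with rfl | h0
  · simp
  have hn : 0 < ‖b‖ := norm_pos_iff.2 h0
  have hu : ‖‖b‖⁻¹ • b‖ = 1 := by rw [norm_smul, norm_inv, norm_norm, inv_mul_cancel₀ hn.ne']
  have h := integral_comp_inner hu (f := fun g => ‖b‖ ^ 2 * g ^ 2) (by fun_prop)
  rw [integral_const_mul (μ := gaussianReal 0 1), integral_sq_gaussianReal, mul_one] at h
  rw [← h]
  congr 1
  funext a
  rw [inner_smul_right, ← mul_pow, mul_inv_cancel_left₀ hn.ne']

lemma integral_inner_eq_zero {n : ℕ} (b : EuclideanSpace ℝ (Fin n)) :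
    ∫ a, inner ℝ a b ∂stdGaussian (EuclideanSpace ℝ (Fin n)) = 0 := by
  have h := integral_strongDual_stdGaussian (InnerProductSpace.toDual ℝ _ b)
  simpa [real_inner_comm] using h

lemma integrable_inner_pow {n : ℕ} (b : EuclideanSpace ℝ (Fin n)) (p : ℕ) :
    Integrable (fun a => inner ℝ a b ^ p) (stdGaussian (EuclideanSpace ℝ (Fin n))) := by
  rcases eq_or_ne b 0 with rfl | h0
  · simp
  have hn : 0 < ‖b‖ := norm_pos_iff.2 h0
  have hu : ‖‖b‖⁻¹ • b‖ = 1 := by rw [norm_smul, norm_inv, norm_norm, inv_mul_cancel₀ hn.ne']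
  have h := (integrable_comp_inner hu (f := fun g => g ^ p) (by fun_prop)
    (integrable_pow_gaussianReal p)).const_mul (‖b‖ ^ p)
  refine h.congr (ae_of_all _ fun a => ?_)
  simp only
  rw [inner_smul_right, ← mul_pow, mul_inv_cancel_left₀ hn.ne']

lemma indepFun_inner_inner {n : ℕ} {x b : EuclideanSpace ℝ (Fin n)} (h : inner ℝ b x = (0 : ℝ)) :
    IndepFun (fun a => inner ℝ a x) (fun a => inner ℝ a b)
      (stdGaussian (EuclideanSpace ℝ (Fin n))) := by
  have := indepFun_inner_clm x (innerSL ℝ b) (by simpa [innerSL_apply_apply ℝ] using h)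
  simpa [innerSL_apply_apply ℝ, real_inner_comm] using this

lemma integrable_sq_mul_sq {n : ℕ} {x u : EuclideanSpace ℝ (Fin n)} (hx : ‖x‖ = 1)
    (hu : ‖u‖ = 1) :
    Integrable (fun a => inner ℝ a x ^ 2 * inner ℝ a u ^ 2)
        (stdGaussian (EuclideanSpace ℝ (Fin n))) ∧
      Integrable (fun a => (inner ℝ a x ^ 2 * inner ℝ a u ^ 2) ^ 2)
        (stdGaussian (EuclideanSpace ℝ (Fin n))) ∧
      ∫ a, (inner ℝ a x ^ 2 * inner ℝ a u ^ 2) ^ 2 ∂stdGaussian (EuclideanSpace ℝ (Fin n))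
        ≤ momentBound := by
  have hx4 := integrable_inner_pow x 4
  have hu4 := integrable_inner_pow u 4
  have hx8 := integrable_inner_pow x 8
  have hu8 := integrable_inner_pow u 8
  have hi2 : Integrable (fun a => (inner ℝ a x ^ 2 * inner ℝ a u ^ 2) ^ 2)
      (stdGaussian (EuclideanSpace ℝ (Fin n))) := by
    refine (hx8.add hu8).mono' (by fun_prop) (ae_of_all _ fun a => ?_)
    rw [Real.norm_of_nonneg (by positivity), Pi.add_apply]
    nlinarith [sq_nonneg (inner ℝ a x ^ 4 - inner ℝ a u ^ 4), sq_nonneg (inner ℝ a x ^ 4),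
      sq_nonneg (inner ℝ a u ^ 4)]
  refine ⟨?_, hi2, ?_⟩
  · refine (hx4.add hu4).mono' (by fun_prop) (ae_of_all _ fun a => ?_)
    rw [Real.norm_of_nonneg (by positivity), Pi.add_apply]
    nlinarith [sq_nonneg (inner ℝ a x ^ 2 - inner ℝ a u ^ 2), sq_nonneg (inner ℝ a x ^ 2),
      sq_nonneg (inner ℝ a u ^ 2)]
  · have hle : ∀ a : EuclideanSpace ℝ (Fin n), (inner ℝ a x ^ 2 * inner ℝ a u ^ 2) ^ 2
        ≤ (1 / 2) * inner ℝ a x ^ 8 + (1 / 2) * inner ℝ a u ^ 8 := fun a => by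
      nlinarith [sq_nonneg (inner ℝ a x ^ 4 - inner ℝ a u ^ 4)]
    have h := integral_mono hi2 ((hx8.const_mul (1 / 2)).add (hu8.const_mul (1 / 2))) hle
    rw [integral_add' (hx8.const_mul (1 / 2)) (hu8.const_mul (1 / 2)), integral_const_mul,
      integral_const_mul, integral_comp_inner hx (f := fun g => g ^ 8) (by fun_prop),
      integral_comp_inner hu (f := fun g => g ^ 8) (by fun_prop)] at h
    unfold momentBound
    linarith

/-- Decompose `u = ⟨u, x⟩ x + b` with `b` orthogonal to `x`, so that `⟨a, b⟩` is independent of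
`⟨a, x⟩`. -/
lemma one_add_sq_le_integral_sq_mul_sq {n : ℕ} {x u : EuclideanSpace ℝ (Fin n)} (hx : ‖x‖ = 1)
    (hu : ‖u‖ = 1) :
    1 + inner ℝ u x ^ 2 ≤ ∫ a, inner ℝ a x ^ 2 * inner ℝ a u ^ 2
      ∂stdGaussian (EuclideanSpace ℝ (Fin n)) := by
  set r : ℝ := inner ℝ u x with hr
  set b := u - r • x with hb
  have hbx : inner ℝ b x = (0 : ℝ) := by
    rw [hb, inner_sub_left, inner_smul_left, real_inner_self_eq_norm_sq, hx]
    simp [hr]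
  have hbn : ‖b‖ ^ 2 = 1 - r ^ 2 := by
    rw [hb, norm_sub_sq_real, norm_smul, inner_smul_right, hx, hu, ← hr, Real.norm_eq_abs, mul_one,
      sq_abs]
    ring
  have hind := indepFun_inner_inner hbx
  have hau : ∀ a : EuclideanSpace ℝ (Fin n), inner ℝ a u = r * inner ℝ a x + inner ℝ a b := by
    intro a
    rw [hb, inner_sub_right, inner_smul_right]
    ring
  have e : ∀ a : EuclideanSpace ℝ (Fin n), inner ℝ a x ^ 2 * inner ℝ a u ^ 2
      = r ^ 2 * inner ℝ a x ^ 4 + (2 * r) * (inner ℝ a x ^ 3 * inner ℝ a b)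
        + inner ℝ a x ^ 2 * inner ℝ a b ^ 2 := by
    intro a
    rw [hau]
    ring
  have hi3 : IndepFun (fun a => inner ℝ a x ^ 3) (fun a => inner ℝ a b)
      (stdGaussian (EuclideanSpace ℝ (Fin n))) :=
    hind.comp (φ := fun g => g ^ 3) (ψ := fun g => g) (by fun_prop) (by fun_prop)
  have hi2 : IndepFun (fun a => inner ℝ a x ^ 2) (fun a => inner ℝ a b ^ 2)
      (stdGaussian (EuclideanSpace ℝ (Fin n))) :=
    hind.comp (φ := fun g => g ^ 2) (ψ := fun g => g ^ 2) (by fun_prop) (by fun_prop)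
  have hb1 : Integrable (fun a => inner ℝ a b) (stdGaussian (EuclideanSpace ℝ (Fin n))) := by
    simpa using integrable_inner_pow b 1
  have I1 := (integrable_inner_pow x 4).const_mul (r ^ 2)
  have I2 : Integrable (fun a => (2 * r) * (inner ℝ a x ^ 3 * inner ℝ a b)) (stdGaussian _) :=
    (hi3.integrable_mul (integrable_inner_pow x 3) hb1).const_mul (2 * r)
  have I12 : Integrable (fun a => r ^ 2 * inner ℝ a x ^ 4
      + (2 * r) * (inner ℝ a x ^ 3 * inner ℝ a b)) (stdGaussian _) := I1.add I2
  have I3 : Integrable (fun a => inner ℝ a x ^ 2 * inner ℝ a b ^ 2) (stdGaussian _) :=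
    hi2.integrable_mul (integrable_inner_pow x 2) (integrable_inner_pow b 2)
  have hM3 := hi3.integral_fun_mul_eq_mul_integral (integrable_inner_pow x 3).aestronglyMeasurable
    hb1.aestronglyMeasurable
  have hM2 := hi2.integral_fun_mul_eq_mul_integral (integrable_inner_pow x 2).aestronglyMeasurable
    (integrable_inner_pow b 2).aestronglyMeasurable
  have key : ∫ a, inner ℝ a x ^ 2 * inner ℝ a u ^ 2 ∂stdGaussian (EuclideanSpace ℝ (Fin n))
      = r ^ 2 * ∫ a, inner ℝ a x ^ 4 ∂stdGaussian (EuclideanSpace ℝ (Fin n)) + (1 - r ^ 2) := by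
    simp_rw [e]
    rw [integral_add I12 I3, integral_add I1 I2, integral_const_mul, integral_const_mul,
      hM3, hM2, integral_inner_eq_zero, integral_inner_sq, integral_inner_sq, hbn, hx]
    ring
  rw [key, integral_comp_inner hx (f := fun g => g ^ 4) (by fun_prop)]
  nlinarith [two_le_integral_pow_four, sq_nonneg r]

/-- The lower tail of the support statistic at an index of the support. -/
lemma measure_sum_sq_mul_sq_le {n m : ℕ} {x u : EuclideanSpace ℝ (Fin n)} (hx : ‖x‖ = 1)
    (hu : ‖u‖ = 1) {t : ℝ} (ht : 0 < t) (htx : t ≤ inner ℝ u x ^ 2) :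
    designMeasure n m {a | ∑ i, inner ℝ (a i) x ^ 2 * inner ℝ (a i) u ^ 2 ≤ m * (1 + t / 2)}
      ≤ ENNReal.ofReal (Real.exp (-(m * (t ^ 2 / (8 * momentBound))))) := by
  have hK := one_le_momentBound
  -- minimizes the exponent `-c t / 2 + c ^ 2 momentBound / 2`
  set c : ℝ := t / (2 * momentBound) with hc
  have hc0 : 0 < c := by positivity
  obtain ⟨J1, J2, J3⟩ := integrable_sq_mul_sq hx hu
  have hchern := pi_chernoff_univ (m := m) (stdGaussian (EuclideanSpace ℝ (Fin n)))
    (f := fun a => -(c * (inner ℝ a x ^ 2 * inner ℝ a u ^ 2))) (by fun_prop)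
    (c := -(c * (1 + t / 2))) (b := t ^ 2 / (8 * momentBound)) ?_
  · refine (measure_mono fun a ha => ?_).trans hchern
    simp only [Set.mem_ofPred_eq, Finset.sum_neg_distrib, ← Finset.mul_sum] at ha ⊢
    nlinarith
  · have hle : ∀ a : EuclideanSpace ℝ (Fin n),
        Real.exp (-(c * (inner ℝ a x ^ 2 * inner ℝ a u ^ 2)))
        ≤ 1 - c * (inner ℝ a x ^ 2 * inner ℝ a u ^ 2)
          + c ^ 2 / 2 * (inner ℝ a x ^ 2 * inner ℝ a u ^ 2) ^ 2 := by
      intro a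
      refine (exp_neg_le_quadratic (by positivity)).trans (le_of_eq ?_)
      ring
    have hint : Integrable (fun a : EuclideanSpace ℝ (Fin n) =>
        Real.exp (-(c * (inner ℝ a x ^ 2 * inner ℝ a u ^ 2)))) (stdGaussian _) := by
      refine (integrable_const (1 : ℝ)).mono' (by fun_prop) (ae_of_all _ fun a => ?_)
      rw [Real.norm_of_nonneg (Real.exp_pos _).le, Real.exp_le_one_iff]
      exact neg_nonpos.2 (by positivity)
    rw [← ofReal_integral_eq_lintegral_ofReal hint (ae_of_all _ fun a => (Real.exp_pos _).le)]
    refine ENNReal.ofReal_le_ofReal ?_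
    have h1 := integral_mono hint (((integrable_const (1 : ℝ)).sub (J1.const_mul c)).add
      (J2.const_mul (c ^ 2 / 2))) hle
    rw [integral_add' ((integrable_const (1 : ℝ)).sub (J1.const_mul c)) (J2.const_mul (c ^ 2 / 2)),
      integral_sub' (integrable_const (1 : ℝ)) (J1.const_mul c), integral_const_mul,
      integral_const_mul] at h1
    simp only [integral_const, probReal_univ, smul_eq_mul, mul_one] at h1
    have h2 := one_add_sq_le_integral_sq_mul_sq hx hu
    have h3 : c * (1 + t) ≤ c * ∫ a, inner ℝ a x ^ 2 * inner ℝ a u ^ 2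
        ∂stdGaussian (EuclideanSpace ℝ (Fin n)) := by gcongr; linarith
    have h4 : c ^ 2 / 2 * ∫ a, (inner ℝ a x ^ 2 * inner ℝ a u ^ 2) ^ 2
        ∂stdGaussian (EuclideanSpace ℝ (Fin n)) ≤ c ^ 2 / 2 * momentBound := by gcongr
    have h5 := Real.add_one_le_exp (-(c * (1 + t / 2)) - t ^ 2 / (8 * momentBound))
    have h6 : c ^ 2 / 2 * momentBound = t ^ 2 / (8 * momentBound) := by
      rw [hc]; field_simp; norm_num
    have h7 : c * (t / 2) = 2 * (t ^ 2 / (8 * momentBound)) := by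
      rw [hc]; field_simp; norm_num
    nlinarith

/-- The exponential moment of a truncated product of squares of independent Gaussian variables:
integrate over `⟨a, u⟩` first. -/
lemma lintegral_exp_trunc_sq_mul_sq_le {n : ℕ} {x u : EuclideanSpace ℝ (Fin n)} (hx : ‖x‖ = 1)
    (hu : ‖u‖ = 1) (hux : inner ℝ u x = (0 : ℝ)) {M c : ℝ} (hc : 0 ≤ c)
    (hcM : c * M ≤ 1 / 4) :
    ∫⁻ a, ENNReal.ofReal (Real.exp (c * ({g : ℝ | g ^ 2 ≤ M}.indicator (fun g => g ^ 2)
        (inner ℝ a x) * inner ℝ a u ^ 2))) ∂stdGaussian (EuclideanSpace ℝ (Fin n))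
      ≤ ENNReal.ofReal (Real.exp (c + 5 * momentBound * c ^ 2)) := by
  have hs : MeasurableSet {g : ℝ | g ^ 2 ≤ M} := measurableSet_le (by fun_prop) measurable_const
  set ψ : ℝ → ℝ := {g : ℝ | g ^ 2 ≤ M}.indicator (fun g => g ^ 2) with hψ
  have hψm : Measurable ψ := (by fun_prop : Measurable fun g : ℝ => g ^ 2).indicator hs
  have hψ0 : ∀ g, 0 ≤ ψ g := fun g => Set.indicator_nonneg (fun g _ => sq_nonneg g) g
  have hψ1 : ∀ g, ψ g ≤ g ^ 2 := fun g => Set.indicator_le_self' (fun g _ => sq_nonneg g) g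
  have hψM : ∀ g, c * ψ g ≤ 1 / 4 := by
    intro g
    by_cases hg : g ∈ {g : ℝ | g ^ 2 ≤ M}
    · rw [hψ, Set.indicator_of_mem hg]
      exact (mul_le_mul_of_nonneg_left hg hc).trans hcM
    · rw [hψ, Set.indicator_of_notMem hg]
      norm_num
  have hlaw := (indepFun_iff_map_prod_eq_prod_map_map (by fun_prop) (by fun_prop)).1
    (indepFun_inner_inner hux)
  rw [map_inner_stdGaussian hx, map_inner_stdGaussian hu] at hlaw
  have hmeas : Measurable fun p : ℝ × ℝ => ENNReal.ofReal (Real.exp (c * (ψ p.1 * p.2 ^ 2))) := by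
    fun_prop
  have e := lintegral_map (μ := stdGaussian (EuclideanSpace ℝ (Fin n))) hmeas
    (g := fun a => (inner ℝ a x, inner ℝ a u)) (by fun_prop)
  simp only at e
  rw [← e, hlaw, lintegral_prod _ hmeas.aemeasurable]
  have hinner : ∀ g : ℝ, ∫⁻ y, ENNReal.ofReal (Real.exp (c * (ψ g * y ^ 2))) ∂gaussianReal 0 1
      ≤ ENNReal.ofReal (1 + c * g ^ 2 + 5 * c ^ 2 * g ^ 4) := by
    intro g
    have h0 : 0 ≤ c * ψ g := mul_nonneg hc (hψ0 g)
    have h1 := hψM g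
    simp_rw [← mul_assoc]
    rw [lintegral_exp_mul_sq (by linarith)]
    refine ENNReal.ofReal_le_ofReal ?_
    refine (one_div_sqrt_le_exp (by rw [abs_of_nonneg h0]; exact h1)).trans ?_
    set y := c * ψ g with hy
    have hw : |y + 2 * y ^ 2| ≤ 1 := by
      rw [abs_of_nonneg (by positivity)]
      nlinarith
    have h2 := (abs_le.1 (Real.abs_exp_sub_one_sub_id_le hw)).2
    have h3 : y ≤ c * g ^ 2 := mul_le_mul_of_nonneg_left (hψ1 g) hc
    have h4 : y ^ 2 ≤ c ^ 2 * g ^ 4 := by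
      calc y ^ 2 ≤ (c * g ^ 2) ^ 2 := by gcongr
        _ = c ^ 2 * g ^ 4 := by ring
    nlinarith [mul_nonneg h0 h0, mul_nonneg (mul_nonneg h0 h0) (sub_nonneg.2 h1),
      mul_nonneg (mul_nonneg (mul_nonneg h0 h0) h0) (sub_nonneg.2 h1)]
  refine (lintegral_mono hinner).trans ?_
  have I2 := (integrable_pow_gaussianReal 2).const_mul c
  have I4 := (integrable_pow_gaussianReal 4).const_mul (5 * c ^ 2)
  have I12 : Integrable (fun g : ℝ => 1 + c * g ^ 2) (gaussianReal 0 1) :=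
    (integrable_const (1 : ℝ)).add I2
  have hI : Integrable (fun g : ℝ => 1 + c * g ^ 2 + 5 * c ^ 2 * g ^ 4) (gaussianReal 0 1) :=
    I12.add I4
  rw [← ofReal_integral_eq_lintegral_ofReal hI (ae_of_all _ fun g => by positivity)]
  refine ENNReal.ofReal_le_ofReal ?_
  rw [integral_add I12 I4, integral_add (integrable_const _) I2,
    integral_const_mul, integral_const_mul, integral_sq_gaussianReal]
  simp only [integral_const, probReal_univ, smul_eq_mul, mul_one]
  have h1 : 5 * c ^ 2 * ∫ g : ℝ, g ^ 4 ∂gaussianReal 0 1 ≤ 5 * c ^ 2 * momentBound := by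
    gcongr
    exact integral_pow_four_le_momentBound
  have h2 := Real.add_one_le_exp (c + 5 * momentBound * c ^ 2)
  nlinarith

/-- The upper tail of the truncated support statistic at an index outside the support. -/
lemma measure_sum_trunc_sq_mul_sq_ge {n m : ℕ} {x u : EuclideanSpace ℝ (Fin n)} (hx : ‖x‖ = 1)
    (hu : ‖u‖ = 1) (hux : inner ℝ u x = (0 : ℝ)) {M c t : ℝ} (hc : 0 ≤ c)
    (hcM : c * M ≤ 1 / 4) (hct : 20 * momentBound * c ≤ t) :
    designMeasure n m {a | m * (c * (1 + t / 2)) ≤ ∑ i, c * ({g : ℝ | g ^ 2 ≤ M}.indicator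
        (fun g => g ^ 2) (inner ℝ (a i) x) * inner ℝ (a i) u ^ 2)}
      ≤ ENNReal.ofReal (Real.exp (-(m * (c * t / 4)))) := by
  have hs : MeasurableSet {g : ℝ | g ^ 2 ≤ M} := measurableSet_le (by fun_prop) measurable_const
  have hψm : Measurable ({g : ℝ | g ^ 2 ≤ M}.indicator (fun g => g ^ 2)) :=
    (by fun_prop : Measurable fun g : ℝ => g ^ 2).indicator hs
  refine pi_chernoff_univ _ (f := fun a => c * ({g : ℝ | g ^ 2 ≤ M}.indicator
    (fun g => g ^ 2) (inner ℝ a x) * inner ℝ a u ^ 2)) (by fun_prop) ?_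
  refine (lintegral_exp_trunc_sq_mul_sq_le hx hu hux hc hcM).trans
    (ENNReal.ofReal_le_ofReal (Real.exp_le_exp.2 ?_))
  nlinarith

lemma measure_exists_sq_inner_gt_le {n m : ℕ} {x : EuclideanSpace ℝ (Fin n)} (hx : ‖x‖ = 1)
    (M : ℝ) :
    designMeasure n m {a | ∃ i, M < inner ℝ (a i) x ^ 2}
      ≤ ENNReal.ofReal (m * (2 * Real.exp (-(M / 4)))) := by
  have hset : {a : Fin m → EuclideanSpace ℝ (Fin n) | ∃ i, M < inner ℝ (a i) x ^ 2}
      = ⋃ i, {a | M < inner ℝ (a i) x ^ 2} := by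
    ext a
    simp
  rw [hset]
  refine (measure_iUnion_fintype_le _ _).trans ?_
  have hone : ∀ i : Fin m, designMeasure n m {a | M < inner ℝ (a i) x ^ 2}
      ≤ ENNReal.ofReal (2 * Real.exp (-(M / 4))) := by
    intro i
    have hchern := pi_chernoff (m := m) (stdGaussian (EuclideanSpace ℝ (Fin n))) {i}
      (f := fun a => inner ℝ a x ^ 2 / 4) (by fun_prop) (c := M / 4)
      (b := M / 4 - Real.log 2) ?_
    · simp only [Finset.card_singleton, Nat.cast_one, one_mul, Finset.sum_singleton] at hchern
      refine (measure_mono fun a ha => ?_).trans (hchern.trans (le_of_eq ?_))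
      · simp only [Set.mem_ofPred_eq] at ha ⊢
        linarith
      · rw [neg_sub, sub_eq_add_neg, Real.exp_add, Real.exp_log (by norm_num)]
    · refine (lintegral_exp_sq_inner_div_four_le hx.le).trans (ENNReal.ofReal_le_ofReal ?_)
      rw [sub_sub_cancel, Real.exp_log (by norm_num), Real.sqrt_le_left (by norm_num)]
      norm_num
  refine (Finset.sum_le_sum fun i _ => hone i).trans (le_of_eq ?_)
  rw [Finset.sum_const, Finset.card_univ, nsmul_eq_mul, ENNReal.ofReal_mul (by positivity)]
  simp

/-! ### Radius and direction of the part of a Gaussian vector orthogonal to the signal -/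

/-- The projection onto the vectors supported on `S`. -/
def coordProj {n : ℕ} (S : Finset (Fin n)) :
    EuclideanSpace ℝ (Fin n) →L[ℝ] EuclideanSpace ℝ (Fin n) :=
  LinearMap.toContinuousLinearMap
    { toFun := fun v => WithLp.toLp 2 fun j => if j ∈ S then v j else 0
      map_add' := fun v w => by
        ext j
        by_cases h : j ∈ S <;> simp [h]
      map_smul' := fun r v => by
        ext j
        by_cases h : j ∈ S <;> simp [h] }

lemma coordProj_apply {n : ℕ} (S : Finset (Fin n)) (v : EuclideanSpace ℝ (Fin n)) (j : Fin n) :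
    coordProj S v j = if j ∈ S then v j else 0 := rfl

lemma coordProj_eq_self {n : ℕ} {S : Finset (Fin n)} {v : EuclideanSpace ℝ (Fin n)}
    (hv : ∀ j ∉ S, v j = 0) : coordProj S v = v := by
  ext j
  rw [coordProj_apply]
  split_ifs with h
  · rfl
  · exact (hv j h).symm

lemma inner_coordProj {n : ℕ} {S : Finset (Fin n)} (a : EuclideanSpace ℝ (Fin n))
    {v : EuclideanSpace ℝ (Fin n)} (hv : ∀ j ∉ S, v j = 0) :
    inner ℝ (coordProj S a) v = inner ℝ a v := by
  rw [inner_eq_sum, inner_eq_sum]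
  refine Finset.sum_congr rfl fun j _ => ?_
  rw [coordProj_apply]
  split_ifs with h
  · rfl
  · simp [hv j h]

lemma norm_sq_coordProj {n : ℕ} (S : Finset (Fin n)) (a : EuclideanSpace ℝ (Fin n)) :
    ‖coordProj S a‖ ^ 2 = ∑ j ∈ S, a j ^ 2 := by
  rw [← real_inner_self_eq_norm_sq, inner_eq_sum]
  simp only [coordProj_apply, mul_ite, ite_mul, mul_zero, zero_mul]
  rw [Finset.sum_ite_mem_eq]
  refine Finset.sum_congr rfl fun j hj => ?_
  rw [if_pos hj, pow_two]

lemma norm_restrict {n : ℕ} (S : Finset (Fin n)) (a : EuclideanSpace ℝ (Fin n)) :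
    ‖restrict S a‖ = ‖coordProj S a‖ := by
  have h : ‖restrict S a‖ ^ 2 = ‖coordProj S a‖ ^ 2 := by
    rw [norm_sq_coordProj, EuclideanSpace.real_norm_sq_eq, ← Finset.sum_coe_sort S]
    rfl
  exact (pow_left_inj₀ (norm_nonneg _) (norm_nonneg _) two_ne_zero).1 h

/-- The component of `a_S` orthogonal to `x`. -/
def orthPart {n : ℕ} (S : Finset (Fin n)) (x : EuclideanSpace ℝ (Fin n)) :
    EuclideanSpace ℝ (Fin n) →L[ℝ] EuclideanSpace ℝ (Fin n) :=
  coordProj S - (innerSL ℝ x).smulRight x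

lemma orthPart_apply {n : ℕ} (S : Finset (Fin n)) (x a : EuclideanSpace ℝ (Fin n)) :
    orthPart S x a = coordProj S a - (inner ℝ a x : ℝ) • x := by
  simp [orthPart, innerSL_apply_apply ℝ, real_inner_comm]

section

variable {n : ℕ} {S : Finset (Fin n)} {x : EuclideanSpace ℝ (Fin n)}

lemma orthPart_apply_eq_zero (hxS : ∀ j ∉ S, x j = 0) (a : EuclideanSpace ℝ (Fin n)) :
    ∀ j ∉ S, orthPart S x a j = 0 := by
  intro j hj
  rw [orthPart_apply, PiLp.sub_apply, coordProj_apply, if_neg hj, PiLp.smul_apply, hxS j hj]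
  simp

lemma inner_orthPart_self (hx : ‖x‖ = 1) (hxS : ∀ j ∉ S, x j = 0)
    (a : EuclideanSpace ℝ (Fin n)) : inner ℝ (orthPart S x a) x = (0 : ℝ) := by
  rw [orthPart_apply, inner_sub_left, inner_coordProj a hxS, inner_smul_left,
    real_inner_self_eq_norm_sq, hx]
  simp

lemma orthPart_self (hx : ‖x‖ = 1) (hxS : ∀ j ∉ S, x j = 0) : orthPart S x x = 0 := by
  rw [orthPart_apply, coordProj_eq_self hxS, real_inner_self_eq_norm_sq, hx]
  simp

lemma orthPart_eq_self {y : EuclideanSpace ℝ (Fin n)} (hyS : ∀ j ∉ S, y j = 0)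
    (hyx : inner ℝ y x = (0 : ℝ)) : orthPart S x y = y := by
  rw [orthPart_apply, coordProj_eq_self hyS, hyx]
  simp

lemma inner_orthPart {y : EuclideanSpace ℝ (Fin n)} (hyS : ∀ j ∉ S, y j = 0)
    (hyx : inner ℝ y x = (0 : ℝ)) (a : EuclideanSpace ℝ (Fin n)) :
    inner ℝ (orthPart S x a) y = (inner ℝ a y : ℝ) := by
  have hxy : inner ℝ x y = (0 : ℝ) := by rw [real_inner_comm]; exact hyx
  rw [orthPart_apply, inner_sub_left, inner_coordProj a hyS, inner_smul_left, hxy]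
  simp

lemma norm_sq_coordProj_eq (hx : ‖x‖ = 1) (hxS : ∀ j ∉ S, x j = 0)
    (a : EuclideanSpace ℝ (Fin n)) :
    ‖coordProj S a‖ ^ 2 = inner ℝ a x ^ 2 + ‖orthPart S x a‖ ^ 2 := by
  have h : coordProj S a = orthPart S x a + (inner ℝ a x : ℝ) • x := by
    rw [orthPart_apply]
    abel
  rw [h, norm_add_sq_real, inner_smul_right, inner_orthPart_self hx hxS, norm_smul, hx]
  simp
  ring

/-- The coordinate along `x` and the length of the orthogonal part. -/
def axialRadial (S : Finset (Fin n)) (x a : EuclideanSpace ℝ (Fin n)) : ℝ × ℝ :=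
  (inner ℝ a x, ‖orthPart S x a‖)

lemma measurable_axialRadial : Measurable (axialRadial S x) := by
  unfold axialRadial
  fun_prop

/-- A reflection exchanging two unit vectors of the space of the vectors supported on `S` and
orthogonal to `x` commutes with the projection onto that space. -/
lemma measure_axialRadial_direction_congr {y y' : EuclideanSpace ℝ (Fin n)}
    (hy : ‖y‖ = 1) (hyS : ∀ j ∉ S, y j = 0) (hyx : inner ℝ y x = (0 : ℝ))
    (hy' : ‖y'‖ = 1) (hyS' : ∀ j ∉ S, y' j = 0) (hyx' : inner ℝ y' x = (0 : ℝ))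
    {A : Set (ℝ × ℝ)} (hA : MeasurableSet A) {B : Set ℝ} (hB : MeasurableSet B) :
    stdGaussian (EuclideanSpace ℝ (Fin n)) {a | axialRadial S x a ∈ A ∧
        inner ℝ (orthPart S x a) y / ‖orthPart S x a‖ ∈ B}
      = stdGaussian (EuclideanSpace ℝ (Fin n)) {a | axialRadial S x a ∈ A ∧
        inner ℝ (orthPart S x a) y' / ‖orthPart S x a‖ ∈ B} := by
  set e := y - y' with he
  have heS : ∀ j ∉ S, e j = 0 := fun j hj => by simp [he, hyS j hj, hyS' j hj]
  have hex : inner ℝ e x = (0 : ℝ) := by rw [he, inner_sub_left, hyx, hyx', sub_zero]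
  set R : EuclideanSpace ℝ (Fin n) ≃ₗᵢ[ℝ] EuclideanSpace ℝ (Fin n) :=
    Submodule.reflection (Submodule.span ℝ {e})ᗮ with hR
  have hRy : R y = y' := Submodule.reflection_sub (hy.trans hy'.symm)
  have hRa : ∀ v, R v = v - (2 * (inner ℝ e v / ‖e‖ ^ 2)) • e := by
    intro v
    rw [hR, Submodule.reflection_orthogonal_apply, Submodule.reflection_singleton_apply]
    rw [neg_sub, two_smul, two_mul, add_smul]
    simp
  have hRx : ∀ v, inner ℝ (R v) x = (inner ℝ v x : ℝ) := by
    intro v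
    rw [hRa, inner_sub_left, inner_smul_left, hex]
    simp
  have hRb : ∀ v, orthPart S x (R v) = R (orthPart S x v) := by
    intro v
    rw [hRa, hRa, map_sub, map_smul, orthPart_eq_self heS hex, real_inner_comm (orthPart S x v) e,
      inner_orthPart heS hex, real_inner_comm]
  have hmeas : MeasurableSet {a | axialRadial S x a ∈ A ∧
      inner ℝ (orthPart S x a) y' / ‖orthPart S x a‖ ∈ B} := by
    refine (measurable_axialRadial hA).inter ?_
    have : Measurable fun a => inner ℝ (orthPart S x a) y' / ‖orthPart S x a‖ := by fun_prop
    exact this hB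
  conv_rhs => rw [← stdGaussian_map R, Measure.map_apply (by fun_prop) hmeas]
  congr 1
  ext a
  simp only [Set.mem_ofPred_eq, Set.mem_preimage, axialRadial]
  rw [hRx, hRb, ← hRy, R.norm_map, R.inner_map_map]

lemma ae_orthPart_ne_zero {y : EuclideanSpace ℝ (Fin n)}
    (hy : ‖y‖ = 1) (hyS : ∀ j ∉ S, y j = 0) (hyx : inner ℝ y x = (0 : ℝ)) :
    ∀ᵐ a ∂stdGaussian (EuclideanSpace ℝ (Fin n)), orthPart S x a ≠ 0 := by
  have h : stdGaussian (EuclideanSpace ℝ (Fin n)) {a | inner ℝ a y = (0 : ℝ)} = 0 := by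
    rw [show {a : EuclideanSpace ℝ (Fin n) | inner ℝ a y = (0 : ℝ)}
      = (fun a => (inner ℝ a y : ℝ)) ⁻¹' {0} from rfl,
      ← Measure.map_apply (by fun_prop) (measurableSet_singleton _), map_inner_stdGaussian hy]
    have := nullSingletonClass_gaussianReal (μ := 0) (v := 1) one_ne_zero
    simp
  refine measure_mono_null (fun a ha => ?_) h
  simp only [Set.mem_compl_iff, Set.mem_ofPred_eq, not_not] at ha ⊢
  rw [← inner_orthPart hyS hyx, ha, inner_zero_left]

/-- The direction of the orthogonal part is independent of its length and of the coordinate along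
`x`. By rotation invariance the joint law does not depend on the unit vector `y`, so `y` may be
replaced by the direction of the orthogonal part of an independent copy. -/
lemma indepFun_axialRadial_direction {y : EuclideanSpace ℝ (Fin n)}
    (hx : ‖x‖ = 1) (hxS : ∀ j ∉ S, x j = 0)
    (hy : ‖y‖ = 1) (hyS : ∀ j ∉ S, y j = 0) (hyx : inner ℝ y x = (0 : ℝ)) :
    IndepFun (axialRadial S x) (fun a => inner ℝ (orthPart S x a) y / ‖orthPart S x a‖)
      (stdGaussian (EuclideanSpace ℝ (Fin n))) := by
  set γ := stdGaussian (EuclideanSpace ℝ (Fin n)) with hγ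
  rw [indepFun_iff_measure_inter_preimage_eq_mul]
  intro A B hA hB
  set b := orthPart S x with hb
  have hunit : ∀ a, b a ≠ 0 → ‖‖b a‖⁻¹ • b a‖ = 1 ∧ (∀ j ∉ S, (‖b a‖⁻¹ • b a) j = 0) ∧
      inner ℝ (‖b a‖⁻¹ • b a) x = (0 : ℝ) := by
    intro a ha
    refine ⟨?_, ?_, ?_⟩
    · rw [norm_smul, norm_inv, norm_norm, inv_mul_cancel₀ (norm_ne_zero_iff.2 ha)]
    · intro j hj
      rw [PiLp.smul_apply, hb, orthPart_apply_eq_zero hxS a j hj, smul_zero]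
    · rw [inner_smul_left, hb, inner_orthPart_self hx hxS]
      simp
  set D : Set (EuclideanSpace ℝ (Fin n) × EuclideanSpace ℝ (Fin n)) :=
    {p | axialRadial S x p.1 ∈ A ∧ inner ℝ (b p.1) (‖b p.2‖⁻¹ • b p.2) / ‖b p.1‖ ∈ B} with hD
  have hDm : MeasurableSet D := by
    refine (measurable_axialRadial.comp measurable_fst hA).inter ?_
    have : Measurable fun p : EuclideanSpace ℝ (Fin n) × EuclideanSpace ℝ (Fin n) =>
        inner ℝ (b p.1) (‖b p.2‖⁻¹ • b p.2) / ‖b p.1‖ := by fun_prop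
    exact this hB
  have hne := ae_orthPart_ne_zero (S := S) (x := x) hy hyS hyx
  have h1 : (γ.prod γ) D = γ {a | axialRadial S x a ∈ A ∧ inner ℝ (b a) y / ‖b a‖ ∈ B} := by
    rw [Measure.prod_apply_symm hDm]
    have : ∀ᵐ h ∂γ, γ ((fun a => (a, h)) ⁻¹' D)
        = γ {a | axialRadial S x a ∈ A ∧ inner ℝ (b a) y / ‖b a‖ ∈ B} := by
      filter_upwards [hne] with h hh
      obtain ⟨u1, u2, u3⟩ := hunit h hh
      exact measure_axialRadial_direction_congr u1 u2 u3 hy hyS hyx hA hB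
    rw [lintegral_congr_ae this]
    simp
  have h2 : (γ.prod γ) D = γ (axialRadial S x ⁻¹' A) *
      γ ((fun a => inner ℝ (b a) y / ‖b a‖) ⁻¹' B) := by
    rw [Measure.prod_apply hDm]
    have : ∀ᵐ a ∂γ, γ (Prod.mk a ⁻¹' D) = (axialRadial S x ⁻¹' A).indicator
        (fun _ => γ ((fun a => inner ℝ (b a) y / ‖b a‖) ⁻¹' B)) a := by
      filter_upwards [hne] with a ha
      by_cases hmem : axialRadial S x a ∈ A
      · rw [Set.indicator_of_mem (by exact hmem)]
        obtain ⟨u1, u2, u3⟩ := hunit a ha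
        have := measure_axialRadial_direction_congr u1 u2 u3 hy hyS hyx
          (A := Set.univ) MeasurableSet.univ hB
        simp only [Set.mem_univ, true_and] at this
        refine Eq.trans ?_ this
        congr 1
        ext h
        simp only [hD, Set.mem_preimage, Set.mem_ofPred_eq, hmem, true_and]
        rw [inner_smul_right, inner_smul_right, real_inner_comm (b h) (b a)]
        rw [show ‖b h‖⁻¹ * inner ℝ (b h) (b a) / ‖b a‖ = ‖b a‖⁻¹ * inner ℝ (b h) (b a) / ‖b h‖ by
          ring]
      · rw [Set.indicator_of_notMem (by exact hmem)]
        have : Prod.mk a ⁻¹' D = ∅ := by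
          ext h
          simp [hD, hmem]
        simp [this]
    rw [lintegral_congr_ae this, lintegral_indicator_const (measurable_axialRadial hA), mul_comm]
  rw [← h2, h1]
  rfl

lemma integral_norm_sq_orthPart (hx : ‖x‖ = 1) (hxS : ∀ j ∉ S, x j = 0) :
    Integrable (fun a => ‖orthPart S x a‖ ^ 2) (stdGaussian (EuclideanSpace ℝ (Fin n))) ∧
    ∫ a, ‖orthPart S x a‖ ^ 2 ∂stdGaussian (EuclideanSpace ℝ (Fin n)) = S.card - 1 := by
  have e : ∀ a : EuclideanSpace ℝ (Fin n), ‖orthPart S x a‖ ^ 2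
      = ∑ j ∈ S, inner ℝ a (stdVec j) ^ 2 - inner ℝ a x ^ 2 := by
    intro a
    have h1 := norm_sq_coordProj_eq hx hxS a
    rw [norm_sq_coordProj] at h1
    simp_rw [inner_stdVec]
    linarith
  simp_rw [e]
  have I1 : Integrable (fun a => ∑ j ∈ S, inner ℝ a (stdVec j) ^ 2)
      (stdGaussian (EuclideanSpace ℝ (Fin n))) :=
    integrable_finsetSum _ fun j _ => integrable_inner_pow _ 2
  refine ⟨I1.sub (integrable_inner_pow x 2), ?_⟩
  rw [integral_sub I1 (integrable_inner_pow x 2),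
    integral_finsetSum _ fun j _ => integrable_inner_pow _ 2, integral_inner_sq, hx]
  simp_rw [integral_inner_sq]
  simp [stdVec]

/-- The exponential moment of the squared coordinate of the direction is dominated by the Gaussian
one: integrate the radius first and use Jensen's inequality. -/
lemma lintegral_exp_direction_le {y : EuclideanSpace ℝ (Fin n)}
    (hx : ‖x‖ = 1) (hxS : ∀ j ∉ S, x j = 0)
    (hy : ‖y‖ = 1) (hyS : ∀ j ∉ S, y j = 0) (hyx : inner ℝ y x = (0 : ℝ)) :
    ∫⁻ a, ENNReal.ofReal (Real.exp ((S.card - 1) / 4 *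
      (inner ℝ (orthPart S x a) y / ‖orthPart S x a‖) ^ 2))
      ∂stdGaussian (EuclideanSpace ℝ (Fin n)) ≤ ENNReal.ofReal √2 := by
  set γ := stdGaussian (EuclideanSpace ℝ (Fin n)) with hγ
  set w : EuclideanSpace ℝ (Fin n) → ℝ :=
    fun a => inner ℝ (orthPart S x a) y / ‖orthPart S x a‖ with hw
  have hwm : Measurable w := by fun_prop
  obtain ⟨hI, hE⟩ := integral_norm_sq_orthPart hx hxS
  set d : ℝ := S.card - 1 with hd
  have hd0 : 0 ≤ d := by
    rw [← hE]
    exact integral_nonneg fun a => by positivity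
  have hind : IndepFun w (fun a => ‖orthPart S x a‖) γ :=
    ((indepFun_axialRadial_direction hx hxS hy hyS hyx).comp (φ := Prod.snd) (ψ := fun r => r)
      measurable_snd measurable_id).symm
  have hlaw := (indepFun_iff_map_prod_eq_prod_map_map (by fun_prop) (by fun_prop)).1 hind
  have hmeas : Measurable fun p : ℝ × ℝ => ENNReal.ofReal (Real.exp (p.2 ^ 2 * p.1 ^ 2 / 4)) := by
    fun_prop
  have e := lintegral_map (μ := γ) hmeas (g := fun a => (w a, ‖orthPart S x a‖)) (by fun_prop)
  have htot : ∫⁻ a, ENNReal.ofReal (Real.exp (‖orthPart S x a‖ ^ 2 * w a ^ 2 / 4)) ∂γ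
      ≤ ENNReal.ofReal √2 := by
    refine le_trans (le_of_eq ?_) (lintegral_exp_sq_inner_div_four_le hy.le)
    refine lintegral_congr fun a => ?_
    congr 3
    rw [← mul_pow, hw, ← inner_orthPart hyS hyx a]
    rcases eq_or_ne (orthPart S x a) 0 with h0 | h0
    · simp [h0]
    · rw [mul_div_cancel₀ _ (norm_ne_zero_iff.2 h0)]
  refine le_trans ?_ htot
  simp only at e
  rw [← e, hlaw, lintegral_prod _ hmeas.aemeasurable]
  have e2 : ∫⁻ a, ENNReal.ofReal (Real.exp (d / 4 * w a ^ 2)) ∂γ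
      = ∫⁻ v, ENNReal.ofReal (Real.exp (d / 4 * v ^ 2)) ∂(γ.map w) :=
    (lintegral_map (f := fun v => ENNReal.ofReal (Real.exp (d / 4 * v ^ 2))) (by fun_prop)
      hwm).symm
  rw [e2]
  refine lintegral_mono fun v => ?_
  rw [lintegral_map (f := fun r => ENNReal.ofReal (Real.exp (r ^ 2 * v ^ 2 / 4))) (by fun_prop)
    (by fun_prop)]
  set X := Real.exp (d / 4 * v ^ 2) with hX
  have hXpos : 0 < X := Real.exp_pos _
  have hpt : ∀ a, ENNReal.ofReal (X * (1 + v ^ 2 / 4 * ‖orthPart S x a‖ ^ 2))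
      ≤ ENNReal.ofReal (Real.exp (‖orthPart S x a‖ ^ 2 * v ^ 2 / 4))
        + ENNReal.ofReal (X * (d / 4 * v ^ 2)) := by
    intro a
    rw [← ENNReal.ofReal_add (Real.exp_pos _).le (by positivity)]
    refine ENNReal.ofReal_le_ofReal ?_
    have h1 := Real.add_one_le_exp (‖orthPart S x a‖ ^ 2 * v ^ 2 / 4 - d / 4 * v ^ 2)
    have h2 : Real.exp (‖orthPart S x a‖ ^ 2 * v ^ 2 / 4)
        = X * Real.exp (‖orthPart S x a‖ ^ 2 * v ^ 2 / 4 - d / 4 * v ^ 2) := by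
      rw [hX, ← Real.exp_add]
      congr 1
      ring
    rw [h2]
    nlinarith [mul_le_mul_of_nonneg_left h1 hXpos.le]
  have hint := lintegral_mono (μ := γ) hpt
  have hI' : Integrable (fun a => X * (1 + v ^ 2 / 4 * ‖orthPart S x a‖ ^ 2)) γ :=
    ((integrable_const (1 : ℝ)).add (hI.const_mul (v ^ 2 / 4))).const_mul X
  rw [lintegral_add_right _ measurable_const, lintegral_const, measure_univ, mul_one,
    ← ofReal_integral_eq_lintegral_ofReal hI' (ae_of_all _ fun a => by positivity),
    integral_const_mul, integral_add (integrable_const (1 : ℝ)) (hI.const_mul (v ^ 2 / 4)),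
    integral_const_mul, hE] at hint
  simp only [integral_const, probReal_univ, smul_eq_mul, mul_one] at hint
  have hsplit : X * (1 + v ^ 2 / 4 * d) = X + X * (d / 4 * v ^ 2) := by ring
  rw [hsplit, ENNReal.ofReal_add hXpos.le (by positivity)] at hint
  exact (ENNReal.add_le_add_iff_right ENNReal.ofReal_ne_top).1 hint

end

/-! ### The selection of the initialization -/

lemma measure_sum_indicator_le_le {α : Type*} [MeasurableSpace α] {m : ℕ} (ρ : Measure α)
    [IsProbabilityMeasure ρ] {s : Set α} (hs : MeasurableSet s) {p : ℝ} (hp : 0 ≤ p) (hp1 : p ≤ 1)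
    (h : ENNReal.ofReal p ≤ ρ s) :
    Measure.pi (fun _ : Fin m => ρ) {a | ∑ i, s.indicator 1 (a i) ≤ m * (p / 4)}
      ≤ ENNReal.ofReal (Real.exp (-(m * (p / 4)))) := by
  have hchern := pi_chernoff_univ (m := m) ρ (f := fun a => -s.indicator 1 a)
    ((measurable_one.indicator hs).neg) (c := -(p / 4)) (b := p / 4) ?_
  · refine (measure_mono fun a ha => ?_).trans hchern
    simp only [Set.mem_ofPred_eq, Finset.sum_neg_distrib] at ha ⊢
    linarith
  · have hle : ∀ a, ENNReal.ofReal (Real.exp (-s.indicator 1 a))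
        + s.indicator (fun _ => ENNReal.ofReal (1 / 2)) a ≤ 1 := by
      intro a
      by_cases ha : a ∈ s
      · simp only [Set.indicator_of_mem ha, Pi.one_apply]
        rw [← ENNReal.ofReal_add (Real.exp_pos _).le (by norm_num)]
        refine ENNReal.ofReal_le_one.2 ?_
        have : Real.exp (-1) ≤ 1 / 2 := by
          rw [Real.exp_neg, inv_le_comm₀ (Real.exp_pos _) (by norm_num)]
          linarith [Real.exp_one_gt_d9]
        linarith
      · simp [Set.indicator_of_notMem ha]
    have hint := lintegral_mono (μ := ρ) hle
    rw [lintegral_add_right _ (measurable_const.indicator hs), lintegral_indicator_const hs,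
      lintegral_const, measure_univ, mul_one] at hint
    have h2 : ENNReal.ofReal (1 / 2) * ENNReal.ofReal p ≤ ENNReal.ofReal (1 / 2) * ρ s :=
      mul_le_mul_right h _
    rw [← ENNReal.ofReal_mul (by norm_num)] at h2
    have h3 := (add_le_add_right h2 _).trans hint
    have h4 : (1 : ℝ≥0∞) = ENNReal.ofReal (1 - 1 / 2 * p) + ENNReal.ofReal (1 / 2 * p) := by
      rw [← ENNReal.ofReal_add (by linarith) (by positivity)]
      simp
    rw [h4] at h3
    refine ((ENNReal.add_le_add_iff_right ENNReal.ofReal_ne_top).1 h3).trans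
      (ENNReal.ofReal_le_ofReal ?_)
    have := Real.add_one_le_exp (-(p / 4) - p / 4)
    linarith

section

variable {n : ℕ} {S : Finset (Fin n)} {x : EuclideanSpace ℝ (Fin n)}

/-- The selection ratio as a function of the axial coordinate and of the orthogonal radius. -/
def ratioOf (p : ℝ × ℝ) : ℝ := |p.1| / √(p.1 ^ 2 + p.2 ^ 2)

lemma measurable_ratioOf : Measurable ratioOf := by
  unfold ratioOf
  fun_prop

lemma ratioOf_axialRadial (hx : ‖x‖ = 1) (hxS : ∀ j ∉ S, x j = 0)
    (a : EuclideanSpace ℝ (Fin n)) :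
    ratioOf (axialRadial S x a) = |inner ℝ a x| / ‖restrict S a‖ := by
  rw [ratioOf, axialRadial, norm_restrict]
  simp only
  rw [← norm_sq_coordProj_eq hx hxS, Real.sqrt_sq (norm_nonneg _)]

lemma ofReal_le_measure_large_axial_small_radial (hx : ‖x‖ = 1) (hxS : ∀ j ∉ S, x j = 0) (R : ℝ) :
    gaussianReal 0 1 {g | R ≤ g ^ 2} / 2 ≤ stdGaussian (EuclideanSpace ℝ (Fin n))
      {a | R ≤ inner ℝ a x ^ 2 ∧ ‖orthPart S x a‖ ^ 2 ≤ 2 * S.card} := by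
  have hind := indepFun_inner_clm x (orthPart S x) (orthPart_self hx hxS)
  have hm1 : MeasurableSet {g : ℝ | R ≤ g ^ 2} := measurableSet_le measurable_const (by fun_prop)
  have hm2 : MeasurableSet {b : EuclideanSpace ℝ (Fin n) | ‖b‖ ^ 2 ≤ 2 * S.card} :=
    measurableSet_le (by fun_prop) measurable_const
  have h := hind.measure_inter_preimage_eq_mul _ _ hm1 hm2
  rw [show {a : EuclideanSpace ℝ (Fin n) | R ≤ inner ℝ a x ^ 2 ∧
      ‖orthPart S x a‖ ^ 2 ≤ 2 * S.card} = (fun a => (inner ℝ a x : ℝ)) ⁻¹' {g | R ≤ g ^ 2} ∩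
      (fun a => orthPart S x a) ⁻¹' {b | ‖b‖ ^ 2 ≤ 2 * S.card} from rfl, h,
    ← Measure.map_apply (by fun_prop) hm1, map_inner_stdGaussian hx, ENNReal.div_eq_inv_mul,
    mul_comm]
  refine mul_le_mul_right ?_ _
  -- Markov's inequality for the squared radius, whose mean is at most `|S|`
  obtain ⟨hI, hE⟩ := integral_norm_sq_orthPart hx hxS
  have hS : 0 < S.card := by
    rcases Nat.eq_zero_or_pos S.card with h0 | h0
    · have : x = 0 := by
        ext j
        exact hxS j (by rw [Finset.card_eq_zero.1 h0]; simp)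
      simp [this] at hx
    · exact h0
  have hSR : (0 : ℝ) < S.card := by exact_mod_cast hS
  have hmarkov := mul_meas_ge_le_integral_of_nonneg (μ := stdGaussian (EuclideanSpace ℝ (Fin n)))
    (f := fun a => ‖orthPart S x a‖ ^ 2) (ae_of_all _ fun a => by positivity) hI (2 * S.card)
  rw [hE] at hmarkov
  have hbad : (stdGaussian (EuclideanSpace ℝ (Fin n))).real
      {a | 2 * (S.card : ℝ) ≤ ‖orthPart S x a‖ ^ 2} ≤ 1 / 2 := by
    nlinarith
  have hcompl : ((fun a => orthPart S x a) ⁻¹' {b | ‖b‖ ^ 2 ≤ 2 * S.card})ᶜ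
      ⊆ {a | 2 * (S.card : ℝ) ≤ ‖orthPart S x a‖ ^ 2} := by
    intro a ha
    simp only [Set.mem_compl_iff, Set.mem_preimage, Set.mem_ofPred_eq, not_le] at ha ⊢
    exact ha.le
  have hc := (measureReal_mono (μ := stdGaussian (EuclideanSpace ℝ (Fin n))) hcompl).trans hbad
  rw [probReal_compl_eq_one_sub ((orthPart S x).measurable hm2)] at hc
  rw [← ofReal_measureReal (μ := stdGaussian (EuclideanSpace ℝ (Fin n))),
    show (2 : ℝ≥0∞)⁻¹ = ENNReal.ofReal (1 / 2) by
      rw [one_div, ENNReal.ofReal_inv_of_pos (by norm_num)]; norm_num]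
  exact ENNReal.ofReal_le_ofReal (by linarith)

lemma gaussianReal_sq_ge_pos (R : ℝ) : 0 < (gaussianReal 0 1).real {g : ℝ | R ≤ g ^ 2} := by
  refine ENNReal.toReal_pos (fun h0 => ?_) (measure_ne_top _ _)
  have hac : volume ≪ gaussianReal 0 1 := gaussianReal_absolutelyContinuous' 0 one_ne_zero
  have hv := hac h0
  have hsub : Set.Icc (max R 1) (max R 1 + 1) ⊆ {g : ℝ | R ≤ g ^ 2} := by
    intro g hg
    have h1 := le_max_left R 1
    have h2 := le_max_right R 1
    have h3 := hg.1
    simp only [Set.mem_ofPred_eq]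
    nlinarith
  have := measure_mono_null hsub hv
  rw [Real.volume_Icc] at this
  norm_num at this

open scoped Classical in
/-- Many measurements have a large coordinate along `x` and an orthogonal part of moderate
length. -/
lemma measure_card_large_axial_le {m : ℕ} (hx : ‖x‖ = 1) (hxS : ∀ j ∉ S, x j = 0) (R : ℝ) :
    designMeasure n m {a | ((Finset.univ.filter fun i => R ≤ inner ℝ (a i) x ^ 2 ∧
        ‖orthPart S x (a i)‖ ^ 2 ≤ 2 * S.card).card : ℝ)
          ≤ m * ((gaussianReal 0 1).real {g : ℝ | R ≤ g ^ 2} / 8)}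
      ≤ ENNReal.ofReal (Real.exp (-(m * ((gaussianReal 0 1).real {g : ℝ | R ≤ g ^ 2} / 8)))) := by
  set p := (gaussianReal 0 1).real {g : ℝ | R ≤ g ^ 2} with hp
  have hp1 : p ≤ 1 := measureReal_le_one
  have hp0 : 0 ≤ p := measureReal_nonneg
  have hs : MeasurableSet {a : EuclideanSpace ℝ (Fin n) | R ≤ inner ℝ a x ^ 2 ∧
      ‖orthPart S x a‖ ^ 2 ≤ 2 * S.card} := by
    have h1 : MeasurableSet {a : EuclideanSpace ℝ (Fin n) | R ≤ inner ℝ a x ^ 2} :=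
      measurableSet_le measurable_const (by fun_prop)
    have h2 : MeasurableSet {a : EuclideanSpace ℝ (Fin n) |
        ‖orthPart S x a‖ ^ 2 ≤ 2 * S.card} := measurableSet_le (by fun_prop) measurable_const
    exact h1.inter h2
  have hle : ENNReal.ofReal (p / 2) ≤ stdGaussian (EuclideanSpace ℝ (Fin n))
      {a | R ≤ inner ℝ a x ^ 2 ∧ ‖orthPart S x a‖ ^ 2 ≤ 2 * S.card} := by
    refine le_trans (le_of_eq ?_) (ofReal_le_measure_large_axial_small_radial hx hxS R)
    rw [ENNReal.ofReal_div_of_pos (by norm_num), hp, ofReal_measureReal]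
    norm_num
  have h := measure_sum_indicator_le_le (m := m) (stdGaussian (EuclideanSpace ℝ (Fin n))) hs
    (p := p / 2) (by positivity) (by linarith) hle
  rw [show p / 2 / 4 = p / 8 by ring] at h
  refine le_trans (le_of_eq ?_) h
  congr 1
  ext a
  simp [Set.indicator_apply]

/-- The selection ratio has no atoms: once the orthogonal part is nonzero, a value of the ratio and
a value of the radius leave at most two values of the axial coordinate. -/
lemma measure_ratioOf_eq (hx : ‖x‖ = 1) (hxS : ∀ j ∉ S, x j = 0)
    {y : EuclideanSpace ℝ (Fin n)}
    (hy : ‖y‖ = 1) (hyS : ∀ j ∉ S, y j = 0) (hyx : inner ℝ y x = (0 : ℝ)) (c : ℝ) :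
    stdGaussian (EuclideanSpace ℝ (Fin n)) {a | ratioOf (axialRadial S x a) = c} = 0 := by
  set γ := stdGaussian (EuclideanSpace ℝ (Fin n)) with hγ
  have hind : IndepFun (fun a => inner ℝ a x) (fun a => ‖orthPart S x a‖) γ :=
    (indepFun_inner_clm x (orthPart S x) (orthPart_self hx hxS)).comp (φ := fun g => g)
      (ψ := fun b => ‖b‖) measurable_id measurable_norm
  have hlaw := (indepFun_iff_map_prod_eq_prod_map_map (by fun_prop) (by fun_prop)).1 hind
  rw [map_inner_stdGaussian hx] at hlaw
  have hset : MeasurableSet {p : ℝ × ℝ | ratioOf p = c} :=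
    measurable_ratioOf (measurableSet_singleton c)
  rw [show {a | ratioOf (axialRadial S x a) = c}
    = (fun a => (inner ℝ a x, ‖orthPart S x a‖)) ⁻¹' {p : ℝ × ℝ | ratioOf p = c} from rfl,
    ← Measure.map_apply (by fun_prop) hset, hlaw, Measure.prod_apply_symm hset]
  have hne : ∀ᵐ r ∂γ.map (fun a => ‖orthPart S x a‖), r ≠ 0 := by
    rw [ae_map_iff (by fun_prop) (by measurability)]
    filter_upwards [ae_orthPart_ne_zero (S := S) (x := x) hy hyS hyx] with a ha
    exact norm_ne_zero_iff.2 ha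
  rw [lintegral_eq_zero_iff (measurable_measure_prodMk_right hset)]
  filter_upwards [hne] with r hr
  have := nullSingletonClass_gaussianReal (μ := 0) (v := 1) one_ne_zero
  refine measure_mono_null (t := {√(c ^ 2 * r ^ 2 / (1 - c ^ 2)), -√(c ^ 2 * r ^ 2 / (1 - c ^ 2))})
    ?_ ((Set.toFinite _).measure_zero _)
  intro g hg
  simp only [Set.mem_preimage, Set.mem_ofPred_eq, ratioOf] at hg
  have hr2 : 0 < r ^ 2 := by positivity
  have hpos : 0 < g ^ 2 + r ^ 2 := by positivity
  have h1 : g ^ 2 = c ^ 2 * (g ^ 2 + r ^ 2) := by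
    rw [← hg, div_pow, Real.sq_sqrt hpos.le, sq_abs]
    field_simp
  have h2 : 1 - c ^ 2 ≠ 0 := by
    intro h0
    nlinarith
  have h3 : g ^ 2 = c ^ 2 * r ^ 2 / (1 - c ^ 2) := by
    rw [eq_div_iff h2]
    linarith
  rw [← h3, Real.sqrt_sq_eq_abs]
  rcases abs_choice g with h | h
  · left; exact h.symm
  · right
    rw [h, neg_neg]
    rfl

lemma IsTopSet.eq_of_injective {ι : Type*} {k : ℕ} {f : ι → ℝ} {I J : Finset ι}
    (hf : Function.Injective f) (hI : IsTopSet k f I) (hJ : IsTopSet k f J) : I = J := by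
  classical
  by_contra hne
  have hIJ : ¬ I ⊆ J := fun h => hne (Finset.eq_of_subset_of_card_le h (by rw [hI.1, hJ.1]))
  have hJI : ¬ J ⊆ I := fun h => hne (Finset.eq_of_subset_of_card_le h (by rw [hI.1, hJ.1])).symm
  obtain ⟨i, hi, hi'⟩ := Finset.not_subset.1 hIJ
  obtain ⟨j, hj, hj'⟩ := Finset.not_subset.1 hJI
  have := hf (le_antisymm (hJ.2 j hj i hi') (hI.2 i hi j hj'))
  exact hi' (this ▸ hj)

lemma measurableSet_isTopSet {ι : Type*} [Fintype ι] (k : ℕ) (I : Finset ι) {α : Type*}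
    [MeasurableSpace α] {f : α → ι → ℝ} (hf : ∀ i, Measurable fun s => f s i) :
    MeasurableSet {s | IsTopSet k (f s) I} := by
  have : {s | IsTopSet k (f s) I} = {s : α | I.card = k} ∩
      ⋂ i ∈ I, ⋂ j : {j : ι // j ∉ I}, {s : α | f s j ≤ f s i} := by
    ext s
    simp [IsTopSet]
  rw [this]
  refine (MeasurableSet.const _).inter ?_
  refine Finset.measurableSet_biInter _ fun i _ => MeasurableSet.iInter fun j => ?_
  exact measurableSet_le (hf j) (hf i)

/-- Independent copies of a variable whose law has no atoms are distinct almost surely. -/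
lemma ae_injective_pi {α : Type*} [MeasurableSpace α] {m : ℕ} (ρ : Measure α)
    [IsProbabilityMeasure ρ] {q : α → ℝ} (hq : Measurable q) (h0 : ∀ c, ρ {s | q s = c} = 0) :
    ∀ᵐ s ∂Measure.pi (fun _ : Fin m => ρ), Function.Injective fun i => q (s i) := by
  have hpair : ∀ i j : Fin m, i ≠ j →
      ∀ᵐ s ∂Measure.pi (fun _ : Fin m => ρ), q (s i) ≠ q (s j) := by
    intro i j hij
    have hind : IndepFun (fun s : Fin m → α => q (s i)) (fun s => q (s j))
        (Measure.pi (fun _ : Fin m => ρ)) :=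
      (iIndepFun_pi (μ := fun _ : Fin m => ρ) (X := fun _ => q)
        fun _ => hq.aemeasurable).indepFun hij
    have hqm : ∀ i : Fin m, Measurable fun s : Fin m → α => q (s i) := fun i => by fun_prop
    have hlaw := (indepFun_iff_map_prod_eq_prod_map_map (hqm i).aemeasurable
      (hqm j).aemeasurable).1 hind
    have hdiag : MeasurableSet {p : ℝ × ℝ | p.1 = p.2} :=
      measurableSet_eq_fun measurable_fst measurable_snd
    have hz : (Measure.pi (fun _ : Fin m => ρ)) ((fun s => (q (s i), q (s j))) ⁻¹'
        {p : ℝ × ℝ | p.1 = p.2}) = 0 := by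
      rw [← Measure.map_apply (by fun_prop) hdiag, hlaw, Measure.prod_apply hdiag]
      have : ∀ c, Measure.map (fun s : Fin m → α => q (s j)) (Measure.pi (fun _ : Fin m => ρ))
          (Prod.mk c ⁻¹' {p : ℝ × ℝ | p.1 = p.2}) = 0 := by
        intro c
        have he : Prod.mk c ⁻¹' {p : ℝ × ℝ | p.1 = p.2} = {c} := by
          ext d
          simp [eq_comm]
        rw [he, Measure.map_apply (by fun_prop) (measurableSet_singleton c)]
        have hm : MeasurableSet {s | q s = c} := hq (measurableSet_singleton c)
        exact ((measurePreserving_eval (fun _ : Fin m => ρ) j).measure_preimage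
          hm.nullMeasurableSet).trans (h0 c)
      simp only [this, lintegral_zero]
    exact measure_mono_null (fun s hs => by simpa using hs) hz
  have hall : ∀ᵐ s ∂Measure.pi (fun _ : Fin m => ρ), ∀ i j : Fin m, i ≠ j → q (s i) ≠ q (s j) := by
    rw [ae_all_iff]
    intro i
    rw [ae_all_iff]
    intro j
    by_cases hij : i = j
    · exact ae_of_all _ fun s h => absurd hij h
    · filter_upwards [hpair i j hij] with s hs _ using hs
  filter_upwards [hall] with s hs i j h
  by_contra hij
  exact hs i j hij h

/-- The selected set depends only on the ratios, hence is independent of the directions of the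
orthogonal parts, whose squared coordinates therefore concentrate as for a fixed set. -/
lemma measure_exists_topSet_direction_gt_le {m l : ℕ} {y : EuclideanSpace ℝ (Fin n)}
    (hx : ‖x‖ = 1) (hxS : ∀ j ∉ S, x j = 0) (hS : 2 ≤ S.card)
    (hy : ‖y‖ = 1) (hyS : ∀ j ∉ S, y j = 0) (hyx : inner ℝ y x = (0 : ℝ)) :
    designMeasure n m {a | ∃ I, IsTopSet l (fun i => |inner ℝ (a i) x| / ‖restrict S (a i)‖) I ∧
        8 * l / (S.card - 1) <
          ∑ i ∈ I, (inner ℝ (orthPart S x (a i)) y / ‖orthPart S x (a i)‖) ^ 2}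
      ≤ ENNReal.ofReal (Real.exp (-l)) := by
  set γ := stdGaussian (EuclideanSpace ℝ (Fin n)) with hγ
  set w : EuclideanSpace ℝ (Fin n) → ℝ :=
    fun a => inner ℝ (orthPart S x a) y / ‖orthPart S x a‖ with hw
  have hwm : Measurable w := by fun_prop
  have hσm : Measurable (axialRadial S x) := measurable_axialRadial
  have hlaw := (indepFun_iff_map_prod_eq_prod_map_map hσm.aemeasurable hwm.aemeasurable).1
    (indepFun_axialRadial_direction hx hxS hy hyS hyx)
  set νσ := γ.map (axialRadial S x) with hνσ
  set νw := γ.map w with hνw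
  have : IsProbabilityMeasure νσ := Measure.isProbabilityMeasure_map hσm.aemeasurable
  have : IsProbabilityMeasure νw := Measure.isProbabilityMeasure_map hwm.aemeasurable
  set D : Set ((Fin m → ℝ × ℝ) × (Fin m → ℝ)) :=
    {p | ∃ I, IsTopSet l (fun i => ratioOf (p.1 i)) I ∧
      8 * l / (S.card - 1) < ∑ i ∈ I, p.2 i ^ 2} with hD
  have hDm : MeasurableSet D := by
    have hDU : D = ⋃ I : Finset (Fin m), ({p | IsTopSet l (fun i => ratioOf (p.1 i)) I} ∩
        {p | (8 * l / (S.card - 1) : ℝ) < ∑ i ∈ I, p.2 i ^ 2}) := by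
      ext p
      simp [hD]
    rw [hDU]
    refine MeasurableSet.iUnion fun I => MeasurableSet.inter ?_ ?_
    · refine measurableSet_isTopSet l I fun i => measurable_ratioOf.comp ?_
      fun_prop
    · exact measurableSet_lt measurable_const (Finset.measurable_sum _ fun i _ => by fun_prop)
  have hmap : (designMeasure n m).map (fun a => (fun i => axialRadial S x (a i), fun i => w (a i)))
      = (Measure.pi fun _ : Fin m => νσ).prod (Measure.pi fun _ : Fin m => νw) := by
    have h1 := (measurePreserving_arrowProdEquivProdArrow (ℝ × ℝ) ℝ (Fin m)
      (fun _ => νσ) (fun _ => νw)).map_eq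
    rw [← h1, ← hlaw]
    have h2 : (Measure.pi fun _ : Fin m => γ.map fun a => (axialRadial S x a, w a))
        = (Measure.pi fun _ : Fin m => γ).map fun a i => (axialRadial S x (a i), w (a i)) :=
      (Measure.pi_map_pi fun _ => (hσm.prodMk hwm).aemeasurable).symm
    rw [h2, Measure.map_map (MeasurableEquiv.measurable _) (by fun_prop)]
    rfl
  have hpre : {a : Fin m → EuclideanSpace ℝ (Fin n) | ∃ I,
      IsTopSet l (fun i => |inner ℝ (a i) x| / ‖restrict S (a i)‖) I ∧
        8 * l / (S.card - 1) < ∑ i ∈ I, w (a i) ^ 2}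
      = (fun a => (fun i => axialRadial S x (a i), fun i => w (a i))) ⁻¹' D := by
    ext a
    simp only [hD, Set.mem_ofPred_eq, Set.mem_preimage, ratioOf_axialRadial hx hxS]
  rw [hpre, ← Measure.map_apply (by fun_prop) hDm, hmap, Measure.prod_apply hDm]
  -- ties between the ratios have probability zero, so the ratios determine the selected set
  have hinj : ∀ᵐ s ∂Measure.pi (fun _ : Fin m => νσ),
      Function.Injective fun i => ratioOf (s i) := by
    refine ae_injective_pi νσ measurable_ratioOf fun c => ?_
    have hm : MeasurableSet {s | ratioOf s = c} := measurable_ratioOf (measurableSet_singleton c)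
    rw [hνσ, Measure.map_apply hσm hm]
    exact measure_ratioOf_eq hx hxS hy hyS hyx c
  have hd : (0 : ℝ) < S.card - 1 := by
    have : (2 : ℝ) ≤ S.card := by exact_mod_cast hS
    linarith
  have hslice : ∀ᵐ s ∂Measure.pi (fun _ : Fin m => νσ),
      (Measure.pi fun _ : Fin m => νw) (Prod.mk s ⁻¹' D) ≤ ENNReal.ofReal (Real.exp (-l)) := by
    filter_upwards [hinj] with s hs
    by_cases hex : ∃ I, IsTopSet l (fun i => ratioOf (s i)) I
    · obtain ⟨I, hI⟩ := hex
      have hch := pi_chernoff νw I (f := fun v => (S.card - 1) / 4 * v ^ 2) (by fun_prop)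
        (c := 2) (b := 1) ?_
      · refine (measure_mono fun v hv => ?_).trans (hch.trans (le_of_eq ?_))
        · obtain ⟨J, hJ, hv⟩ := hv
          have hJI : J = I := hJ.eq_of_injective hs hI
          rw [hJI, div_lt_iff₀ hd] at hv
          simp only [Set.mem_ofPred_eq, ← Finset.mul_sum]
          rw [hI.1]
          linarith
        · rw [hI.1, mul_one]
      · rw [hνw, lintegral_map (by fun_prop) hwm]
        refine (lintegral_exp_direction_le hx hxS hy hyS hyx).trans
          (ENNReal.ofReal_le_ofReal ?_)
        rw [Real.sqrt_le_left (Real.exp_pos _).le, show (2 : ℝ) - 1 = 1 by norm_num]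
        nlinarith [Real.exp_one_gt_d9]
    · have : Prod.mk s ⁻¹' D = ∅ := by
        ext v
        simp only [hD, Set.mem_preimage, Set.mem_ofPred_eq, Set.mem_empty_iff_false, iff_false]
        rintro ⟨I, hI, -⟩
        exact hex ⟨I, hI⟩
      simp [this]
  refine (lintegral_mono_ae hslice).trans ?_
  simp

/-- The selected normalized measurements carry little energy orthogonally to the signal. -/
def SmallOrthogonalEnergy {m : ℕ} (S : Finset (Fin n)) (x : EuclideanSpace ℝ (Fin n)) (l : ℕ)
    (a : Fin m → EuclideanSpace ℝ (Fin n)) : Prop :=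
  ∀ I, IsTopSet l (fun i => |inner ℝ (a i) x| / ‖restrict S (a i)‖) I →
    ∀ y : EuclideanSpace ℝ (Fin n), (∀ j ∉ S, y j = 0) →
      ∑ i ∈ I, inner ℝ (‖orthPart S x (a i)‖⁻¹ • orthPart S x (a i)) y ^ 2
        ≤ 64 * l / S.card * ‖y‖ ^ 2

/-- The directions are tested on the grid points supported on `S`; a grid point may be replaced by
its component orthogonal to `x`. -/
lemma measure_not_smallOrthogonalEnergy_le {m l : ℕ} (hx : ‖x‖ = 1) (hxS : ∀ j ∉ S, x j = 0)
    (hS : 2 ≤ S.card) :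
    designMeasure n m {a | ¬ SmallOrthogonalEnergy S x l a}
      ≤ ENNReal.ofReal ((4 * S.card + 1) ^ S.card * Real.exp (-l)) := by
  have hne : S.Nonempty := Finset.card_pos.1 (by omega)
  obtain ⟨θ, hθ⟩ := exists_tuple_covering hne le_rfl
  have hS2 : (2 : ℝ) ≤ S.card := by exact_mod_cast hS
  set bad : (Fin S.card → Fin (4 * S.card + 1)) → Set (Fin m → EuclideanSpace ℝ (Fin n)) :=
    fun c => {a | ‖(gridPoint (θ, c) : EuclideanSpace ℝ (Fin n))‖ ≤ 1 ∧
      ∃ I, IsTopSet l (fun i => |inner ℝ (a i) x| / ‖restrict S (a i)‖) I ∧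
        8 * l / (S.card - 1) < ∑ i ∈ I,
          inner ℝ (‖orthPart S x (a i)‖⁻¹ • orthPart S x (a i)) (gridPoint (θ, c)) ^ 2} with hbad
  have hsub : {a : Fin m → EuclideanSpace ℝ (Fin n) | ¬ SmallOrthogonalEnergy S x l a}
      ⊆ ⋃ c, bad c := by
    intro a ha
    by_contra hcon
    refine ha fun I hI y hyS => ?_
    simp only [Set.mem_iUnion, not_exists, hbad, Set.mem_ofPred_eq, not_and, not_lt] at hcon
    refine (sum_sq_inner_le_of_gridPoint_le I
      (fun i => ‖orthPart S x (a i)‖⁻¹ • orthPart S x (a i)) θ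
      (fun c hc => hcon c hc I hI) fun j hj => hyS j (hθ j hj)).trans ?_
    refine mul_le_mul_of_nonneg_right ?_ (by positivity)
    rw [← mul_div_assoc, div_le_div_iff₀ (by linarith) (by linarith)]
    have hl : (0 : ℝ) ≤ l := Nat.cast_nonneg l
    nlinarith [mul_nonneg hl (sub_nonneg.2 hS2)]
  refine (measure_mono hsub).trans ((measure_iUnion_fintype_le _ _).trans ?_)
  have hone : ∀ c, designMeasure n m (bad c) ≤ ENNReal.ofReal (Real.exp (-l)) := by
    intro c
    set g : EuclideanSpace ℝ (Fin n) := gridPoint (θ, c) with hg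
    by_cases hgn : ‖g‖ ≤ 1
    swap
    · have : bad c = ∅ := by
        ext a
        simp only [hbad, Set.mem_ofPred_eq, Set.mem_empty_iff_false, iff_false]
        exact fun h => hgn h.1
      simp [this]
    -- only the component of the grid point orthogonal to `x` matters
    set v := orthPart S x g with hv
    have hvS := orthPart_apply_eq_zero (S := S) hxS g
    have hvx : inner ℝ v x = (0 : ℝ) := inner_orthPart_self hx hxS g
    have hinner : ∀ a, inner ℝ (orthPart S x a) g = (inner ℝ (orthPart S x a) v : ℝ) := by
      intro a
      have h1 : inner ℝ (orthPart S x a) g = (inner ℝ (orthPart S x a) (coordProj S g) : ℝ) := by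
        rw [real_inner_comm, real_inner_comm (coordProj S g),
          inner_coordProj g (orthPart_apply_eq_zero hxS a)]
      rw [h1, hv, orthPart_apply S x g, inner_sub_right, inner_smul_right,
        inner_orthPart_self hx hxS]
      simp
    have hvn : ‖v‖ ≤ 1 := by
      have h1 := norm_sq_coordProj_eq hx hxS g
      have h2 : ‖coordProj S g‖ ^ 2 ≤ ‖g‖ ^ 2 := by
        rw [norm_sq_coordProj, EuclideanSpace.real_norm_sq_eq]
        exact Finset.sum_le_sum_of_subset_of_nonneg (Finset.subset_univ _)
          fun j _ _ => sq_nonneg _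
      have h3 : ‖g‖ ^ 2 ≤ 1 := pow_le_one₀ (norm_nonneg _) hgn
      have h4 : ‖v‖ ^ 2 ≤ 1 := by nlinarith [sq_nonneg (inner ℝ g x : ℝ)]
      nlinarith [norm_nonneg v]
    by_cases hv0 : v = 0
    · have : bad c = ∅ := by
        ext a
        simp only [hbad, Set.mem_ofPred_eq, Set.mem_empty_iff_false, iff_false, not_and,
          not_exists, not_lt]
        intro _ I _
        have : ∀ i ∈ I, inner ℝ (‖orthPart S x (a i)‖⁻¹ • orthPart S x (a i)) g ^ 2 = (0 : ℝ) := by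
          intro i _
          rw [inner_smul_left, hinner, hv0]
          simp
        rw [Finset.sum_congr rfl this]
        simp only [Finset.sum_const_zero]
        exact div_nonneg (by positivity) (by linarith)
      simp [this]
    have hvpos : 0 < ‖v‖ := norm_pos_iff.2 hv0
    refine (measure_mono ?_).trans (measure_exists_topSet_direction_gt_le (y := ‖v‖⁻¹ • v)
      hx hxS hS ?_ ?_ ?_)
    · rintro a ⟨-, I, hI, hlt⟩
      refine ⟨I, hI, hlt.trans_le (Finset.sum_le_sum fun i _ => ?_)⟩
      rw [inner_smul_left, hinner, inner_smul_right]
      have e : (starRingEnd ℝ) ‖orthPart S x (a i)‖⁻¹ * inner ℝ (orthPart S x (a i)) v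
          = ‖v‖ * (‖v‖⁻¹ * inner ℝ (orthPart S x (a i)) v / ‖orthPart S x (a i)‖) := by
        rw [conj_trivial]
        field_simp
      rw [e, mul_pow]
      have : ‖v‖ ^ 2 ≤ 1 := pow_le_one₀ hvpos.le hvn
      exact mul_le_of_le_one_left (sq_nonneg _) this
    · rw [norm_smul, norm_inv, norm_norm, inv_mul_cancel₀ hvpos.ne']
    · intro j hj
      rw [PiLp.smul_apply, hvS j hj, smul_zero]
    · rw [inner_smul_left, hvx, mul_zero]
  refine (Finset.sum_le_sum fun c _ => hone c).trans (le_of_eq ?_)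
  rw [Finset.sum_const, Finset.card_univ, nsmul_eq_mul, ENNReal.ofReal_mul (by positivity)]
  congr 1
  rw [← ENNReal.ofReal_natCast]
  congr 1
  simp

end

/-! ### Top sets and hard thresholding -/

lemma IsTopSet.eq_of_separated {ι : Type*} {f : ι → ℝ} {S T : Finset ι}
    (hT : IsTopSet S.card f T) (h : ∀ i ∈ S, ∀ j ∉ S, f j < f i) : T = S := by
  classical
  by_contra hne
  have hTS : ¬ T ⊆ S := fun hs => hne (Finset.eq_of_subset_of_card_le hs (by rw [hT.1]))
  have hST : ¬ S ⊆ T := fun hs => hne (Finset.eq_of_subset_of_card_le hs (by rw [hT.1])).symm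
  obtain ⟨i, hi, hi'⟩ := Finset.not_subset.1 hTS
  obtain ⟨j, hj, hj'⟩ := Finset.not_subset.1 hST
  exact absurd (hT.2 i hi j hj') (not_le.2 (h j hj i hi'))

lemma IsTopSet.le_of_card_le {ι : Type*} [Fintype ι] {l : ℕ} {f : ι → ℝ} {I J : Finset ι}
    (hI : IsTopSet l f I) (hJ : l ≤ J.card) {c : ℝ} (hc : ∀ j ∈ J, c ≤ f j) :
    ∀ i ∈ I, c ≤ f i := by
  classical
  intro i hi
  by_contra hlt
  rw [not_le] at hlt
  have hsub : J ⊆ I.erase i := by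
    intro j hj
    refine Finset.mem_erase.2 ⟨fun h => ?_, ?_⟩
    · exact absurd (hc j hj) (not_le.2 (h ▸ hlt))
    · by_contra hjI
      exact absurd ((hc j hj).trans (hI.2 i hi j hjI)) (not_le.2 hlt)
  have h1 := Finset.card_le_card hsub
  rw [Finset.card_erase_of_mem hi, hI.1] at h1
  have h2 : 0 < l := hI.1 ▸ Finset.card_pos.2 ⟨i, hi⟩
  omega

lemma sum_le_sum_of_card_eq {ι : Type*} {A B : Finset ι} {f : ι → ℝ} (hc : A.card = B.card)
    (h : ∀ i ∈ A, ∀ j ∈ B, f i ≤ f j) : ∑ i ∈ A, f i ≤ ∑ j ∈ B, f j := by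
  rcases B.eq_empty_or_nonempty with rfl | hB
  · rw [Finset.card_empty, Finset.card_eq_zero] at hc
    simp [hc]
  · obtain ⟨j, hj, hmin⟩ := Finset.exists_min_image B f hB
    calc ∑ i ∈ A, f i ≤ A.card • f j := Finset.sum_le_card_nsmul _ _ _ fun i hi => h i hi j hj
      _ = B.card • f j := by rw [hc]
      _ ≤ ∑ j ∈ B, f j := Finset.card_nsmul_le_sum _ _ _ hmin

/-- Hard thresholding at most doubles the error on the union of the two supports: the entries
discarded from the support of `x` are dominated by the entries kept outside it. -/
lemma norm_threshold_sub_le {n : ℕ} {S T : Finset (Fin n)} {x u v : EuclideanSpace ℝ (Fin n)}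
    (hxS : ∀ j ∉ S, x j = 0) (hT : IsTopSet S.card (fun j => |u j|) T)
    (hv : ∀ j, v j = if j ∈ T then u j else 0) :
    ‖v - x‖ ≤ 2 * ‖coordProj (T ∪ S) (u - x)‖ := by
  have hsplit : v - x = coordProj (T ∪ S) (u - x) - coordProj (S \ T) u := by
    ext j
    simp only [PiLp.sub_apply, coordProj_apply, hv, Finset.mem_union, Finset.mem_sdiff]
    by_cases hjT : j ∈ T
    · simp [hjT]
    · by_cases hjS : j ∈ S
      · simp [hjT, hjS]
      · simp [hjT, hjS, hxS j hjS]
  have hle : ‖coordProj (S \ T) u‖ ≤ ‖coordProj (T ∪ S) (u - x)‖ := by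
    refine (pow_le_pow_iff_left₀ (norm_nonneg _) (norm_nonneg _) two_ne_zero).1 ?_
    rw [norm_sq_coordProj, norm_sq_coordProj]
    have hcard : (S \ T).card = (T \ S).card :=
      Finset.card_sdiff_comm hT.1.symm
    have h1 : ∑ j ∈ S \ T, u j ^ 2 ≤ ∑ j ∈ T \ S, u j ^ 2 := by
      refine sum_le_sum_of_card_eq hcard fun i hi j hj => ?_
      exact sq_le_sq.2 (hT.2 j (Finset.mem_sdiff.1 hj).1 i (Finset.mem_sdiff.1 hi).2)
    have h2 : ∑ j ∈ T \ S, u j ^ 2 = ∑ j ∈ T \ S, (u - x) j ^ 2 := by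
      refine Finset.sum_congr rfl fun j hj => ?_
      rw [PiLp.sub_apply, hxS j (Finset.mem_sdiff.1 hj).2, sub_zero]
    rw [h2] at h1
    refine h1.trans (Finset.sum_le_sum_of_subset_of_nonneg ?_ fun j _ _ => sq_nonneg _)
    exact Finset.sdiff_subset.trans Finset.subset_union_left
  rw [hsplit]
  linarith [norm_sub_le (coordProj (T ∪ S) (u - x)) (coordProj (S \ T) u)]

/-! ### Contraction of the refinement step -/

lemma truncSet_top {n m : ℕ} (a : Fin m → EuclideanSpace ℝ (Fin n)) (ψ : Fin m → ℝ)
    (z : EuclideanSpace ℝ (Fin n)) : truncSet a ψ ⊤ z = Finset.univ := by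
  simp [truncSet]

/-- The error made by the sign of `p + q` in place of the sign of `p`. -/
lemma abs_sub_abs_mul_sign_le (p q : ℝ) :
    |p - |p| * ((p + q) / |p + q|)| ≤ 2 * |p| ∧
      (|q| < |p| → p - |p| * ((p + q) / |p + q|) = 0) := by
  constructor
  · have h1 : |((p + q) / |p + q|)| ≤ 1 := by
      rw [abs_div, abs_abs]
      exact div_self_le_one _
    calc |p - |p| * ((p + q) / |p + q|)| ≤ |p| + |(|p| * ((p + q) / |p + q|))| := abs_sub _ _
      _ = |p| + |p| * |((p + q) / |p + q|)| := by rw [abs_mul, abs_abs]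
      _ ≤ |p| + |p| * 1 := by gcongr
      _ = 2 * |p| := by ring
  · intro h
    rcases lt_trichotomy p 0 with hp | hp | hp
    · have hq : p + q < 0 := by
        rw [abs_of_neg hp] at h
        linarith [(abs_lt.1 h).2]
      rw [abs_of_neg hp, abs_of_neg hq, div_neg, div_self hq.ne]
      ring
    · rw [hp, abs_zero] at h
      exact absurd h (not_lt.2 (abs_nonneg q))
    · have hq : 0 < p + q := by
        rw [abs_of_pos hp] at h
        linarith [(abs_lt.1 h).1]
      rw [abs_of_pos hp, abs_of_pos hq, div_self hq.ne']
      ring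

open scoped Classical in
/-- The measurements whose sign may be wrong are few: either the signal is nearly orthogonal to the
measurement vector, or the error has an exceptionally large inner product with it. -/
lemma card_mismatch_le {n m s : ℕ} {a : Fin m → EuclideanSpace ℝ (Fin n)} {t η η₁ ρ : ℝ}
    (hG : GramClose t a) (ht : 0 ≤ t) (hts : t * s ≤ 1) (hη₁ : 0 < η₁)
    {X h : EuclideanSpace ℝ (Fin n)} (hX : 0 < ‖X‖) {Θ : Finset (Fin n)}
    (hs : ∀ j ∉ Θ, h j = 0) (hc : Θ.card ≤ s)
    (hsmall : ((Finset.univ.filter fun i => |inner ℝ (a i) (‖X‖⁻¹ • X)| ≤ η₁).card : ℝ)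
      ≤ η / 2 * m)
    (hh : ‖h‖ ≤ ρ * ‖X‖) (hρ : 2 * ρ ^ 2 ≤ η / 2 * η₁ ^ 2) :
    ((Finset.univ.filter fun i => |inner ℝ (a i) X| ≤ |inner ℝ (a i) h|).card : ℝ) ≤ η * m := by
  have hsub : (Finset.univ.filter fun i => |inner ℝ (a i) X| ≤ |inner ℝ (a i) h|) ⊆
      (Finset.univ.filter fun i => |inner ℝ (a i) (‖X‖⁻¹ • X)| ≤ η₁) ∪
      (Finset.univ.filter fun i => η₁ * ‖X‖ < |inner ℝ (a i) h|) := by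
    intro i hi
    simp only [Finset.mem_filter, Finset.mem_univ, true_and, Finset.mem_union] at hi ⊢
    by_contra hcon
    rw [not_or, not_le, not_lt, inner_smul_right, abs_mul, abs_inv, abs_norm,
      lt_inv_mul_iff₀ hX] at hcon
    linarith [hcon.1, hcon.2]
  have hlarge : ((Finset.univ.filter fun i => η₁ * ‖X‖ < |inner ℝ (a i) h|).card : ℝ)
      ≤ η / 2 * m := by
    have h1 : ((Finset.univ.filter fun i => η₁ * ‖X‖ < |inner ℝ (a i) h|).card : ℝ)
        * (η₁ * ‖X‖) ^ 2 ≤ ∑ i, inner ℝ (a i) h ^ 2 := by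
      rw [← nsmul_eq_mul]
      refine (Finset.card_nsmul_le_sum _ (fun i => (inner ℝ (a i) h : ℝ) ^ 2) _
        fun i hi => ?_).trans
        (Finset.sum_le_sum_of_subset_of_nonneg (Finset.filter_subset _ _)
          fun i _ _ => sq_nonneg _)
      rw [← sq_abs (inner ℝ (a i) h)]
      exact pow_le_pow_left₀ (by positivity) (Finset.mem_filter.1 hi).2.le 2
    have h2 := (abs_le.1 (hG.abs_sum_sq_inner_sub_le ht hs hc)).2
    have hm : (0 : ℝ) ≤ m := Nat.cast_nonneg m
    have h3 : ∑ i, inner ℝ (a i) h ^ 2 ≤ m * (2 * ‖h‖ ^ 2) := by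
      nlinarith [mul_nonneg (mul_nonneg hm (sub_nonneg.2 hts)) (sq_nonneg ‖h‖)]
    have h4 : ‖h‖ ^ 2 ≤ ρ ^ 2 * ‖X‖ ^ 2 := by
      rw [← mul_pow]
      exact pow_le_pow_left₀ (norm_nonneg _) hh 2
    have h5 : m * (2 * ‖h‖ ^ 2) ≤ (η / 2 * m) * (η₁ * ‖X‖) ^ 2 := by
      calc m * (2 * ‖h‖ ^ 2) ≤ m * (2 * (ρ ^ 2 * ‖X‖ ^ 2)) := by gcongr
        _ = m * ((2 * ρ ^ 2) * ‖X‖ ^ 2) := by ring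
        _ ≤ m * ((η / 2 * η₁ ^ 2) * ‖X‖ ^ 2) := by gcongr
        _ = (η / 2 * m) * (η₁ * ‖X‖) ^ 2 := by ring
    exact le_of_mul_le_mul_right (h1.trans (h3.trans h5)) (by positivity)
  have h6 := (Finset.card_le_card hsub).trans (Finset.card_union_le _ _)
  have h7 : ((Finset.univ.filter fun i => |inner ℝ (a i) X| ≤ |inner ℝ (a i) h|).card : ℝ)
      ≤ (Finset.univ.filter fun i => |inner ℝ (a i) (‖X‖⁻¹ • X)| ≤ η₁).card
        + (Finset.univ.filter fun i => η₁ * ‖X‖ < |inner ℝ (a i) h|).card := by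
    exact_mod_cast h6
  linarith

open scoped Classical in
/-- One refinement step halves the error, once the error is small compared with the signal. The
gradient is the one of least squares up to the sign mismatches, which carry little energy; least
squares contracts by the restricted isometry. -/
lemma norm_refine_sub_le {n m : ℕ} {a : Fin m → EuclideanSpace ℝ (Fin n)} (hm : 0 < m)
    {t η η₁ ρ μ : ℝ} {S Tz : Finset (Fin n)} {X z v : EuclideanSpace ℝ (Fin n)}
    (hG : GramClose t a) (ht : 0 ≤ t) (hts : t * (2 * S.card) ≤ 1 / 100) (hη₁ : 0 < η₁)
    (hE : SmallSubsetEnergy η (1 / 1000) (2 * S.card) a)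
    (hX : 0 < ‖X‖) (hXS : ∀ j ∉ S, X j = 0)
    (hzT : ∀ j ∉ Tz, z j = 0) (hTz : Tz.card = S.card)
    (hsmall : ((Finset.univ.filter fun i => |inner ℝ (a i) (‖X‖⁻¹ • X)| ≤ η₁).card : ℝ)
      ≤ η / 2 * m)
    (hρ : 2 * ρ ^ 2 ≤ η / 2 * η₁ ^ 2) (hμ : μ ∈ Set.Icc (9 / 10 : ℝ) 1)
    (hz : ‖z - X‖ ≤ ρ * ‖X‖)
    (hv : IsHardThreshold S.card (z - μ • truncGrad a (measurement a X) ⊤ z) v) :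
    ‖v - X‖ ≤ 1 / 2 * ‖z - X‖ := by
  obtain ⟨T, hT, hvT⟩ := hv
  set h := z - X with hh
  set u := z - μ • truncGrad a (measurement a X) ⊤ z with hu
  set e := coordProj (T ∪ S) (u - X) with he
  have hmR : (0 : ℝ) < m := by exact_mod_cast hm
  have hhΘ : ∀ j ∉ Tz ∪ S, h j = 0 := by
    intro j hj
    rw [Finset.mem_union, not_or] at hj
    rw [hh, PiLp.sub_apply, hzT j hj.1, hXS j hj.2, sub_zero]
  have hΘc : (Tz ∪ S).card ≤ 2 * S.card := by
    have := Finset.card_union_le Tz S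
    omega
  have heΘ : ∀ j ∉ T ∪ S, e j = 0 := by
    intro j hj
    rw [he, coordProj_apply, if_neg hj]
  have hΘc' : (T ∪ S).card ≤ 2 * S.card := by
    have := Finset.card_union_le T S
    have := hT.1
    omega
  have hts' : t * ((2 * S.card : ℕ) : ℝ) ≤ 1 / 100 := by push_cast; exact hts
  -- the part of the gradient due to sign mismatches
  set ξ : Fin m → ℝ := fun i => inner ℝ (a i) X - |inner ℝ (a i) X| *
    ((inner ℝ (a i) X + inner ℝ (a i) h) / |inner ℝ (a i) X + inner ℝ (a i) h|) with hξ
  have hgrad : truncGrad a (measurement a X) ⊤ z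
      = (1 / (m : ℝ)) • ∑ i, (inner ℝ (a i) h + ξ i) • a i := by
    rw [truncGrad, truncSet_top]
    congr 1
    refine Finset.sum_congr rfl fun i _ => ?_
    congr 1
    have : inner ℝ (a i) z = (inner ℝ (a i) X + inner ℝ (a i) h : ℝ) := by
      rw [← inner_add_right, hh, add_sub_cancel]
    rw [this, measurement, hξ]
    ring
  set B := Finset.univ.filter fun i => |inner ℝ (a i) X| ≤ |inner ℝ (a i) h| with hB
  have hBc : (B.card : ℝ) ≤ η * m :=
    card_mismatch_le hG ht (hts'.trans (by norm_num)) hη₁ hX hhΘ hΘc hsmall hz hρ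
  have hξsum : ∑ i, ξ i ^ 2 ≤ m * (4 / 1000) * ‖h‖ ^ 2 := by
    have h1 : ∑ i, ξ i ^ 2 = ∑ i ∈ B, ξ i ^ 2 := by
      symm
      refine Finset.sum_subset (Finset.subset_univ _) fun i _ hi => ?_
      have hlt : |inner ℝ (a i) h| < |inner ℝ (a i) X| := by
        simpa [hB] using hi
      have h0 : ξ i = 0 := (abs_sub_abs_mul_sign_le _ _).2 hlt
      rw [h0]
      norm_num
    rw [h1]
    have h2 : ∑ i ∈ B, ξ i ^ 2 ≤ ∑ i ∈ B, 4 * inner ℝ (a i) h ^ 2 := by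
      refine Finset.sum_le_sum fun i hi => ?_
      have hle : |inner ℝ (a i) X| ≤ |inner ℝ (a i) h| := (Finset.mem_filter.1 hi).2
      have h3 : |ξ i| ≤ 2 * |inner ℝ (a i) h| :=
        ((abs_sub_abs_mul_sign_le (inner ℝ (a i) X) (inner ℝ (a i) h)).1).trans (by linarith)
      rw [← sq_abs (ξ i), ← sq_abs (inner ℝ (a i) h)]
      calc |ξ i| ^ 2 ≤ (2 * |inner ℝ (a i) h|) ^ 2 := by gcongr
        _ = 4 * |inner ℝ (a i) h| ^ 2 := by ring
    rw [← Finset.mul_sum] at h2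
    have h4 := hE B hBc h (Tz ∪ S) hΘc hhΘ
    linarith
  have hesum : ∑ i, inner ℝ (a i) e ^ 2 ≤ m * (101 / 100) * ‖e‖ ^ 2 := by
    have := (abs_le.1 (hG.abs_sum_sq_inner_sub_le ht heΘ hΘc')).2
    nlinarith [mul_nonneg (mul_nonneg hmR.le (sub_nonneg.2 hts')) (sq_nonneg ‖e‖)]
  have hcross : |∑ i, ξ i * inner ℝ (a i) e| ≤ m * (7 / 100) * (‖h‖ * ‖e‖) := by
    refine abs_le_of_sq_le_sq ?_ (by positivity)
    refine (Finset.sum_mul_sq_le_sq_mul_sq _ _ _).trans ?_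
    calc (∑ i, ξ i ^ 2) * ∑ i, inner ℝ (a i) e ^ 2
        ≤ (m * (4 / 1000) * ‖h‖ ^ 2) * (m * (101 / 100) * ‖e‖ ^ 2) := by
          refine mul_le_mul hξsum hesum (Finset.sum_nonneg fun i _ => sq_nonneg _) (by positivity)
      _ ≤ (m * (7 / 100) * (‖h‖ * ‖e‖)) ^ 2 := by
          have : (m * (7 / 100) * (‖h‖ * ‖e‖)) ^ 2 - (m * (4 / 1000) * ‖h‖ ^ 2) *
              (m * (101 / 100) * ‖e‖ ^ 2)
              = (49 / 10000 - 404 / 100000) * (m * ‖h‖ * ‖e‖) ^ 2 := by ring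
          nlinarith [sq_nonneg (m * ‖h‖ * ‖e‖)]
  have hgram := hG.abs_sum_inner_mul_inner_sub_le ht hhΘ hΘc heΘ hΘc'
  -- least squares step, deviation of the Gram matrix, and sign mismatches
  have hid : ‖e‖ ^ 2 = (1 - μ) * inner ℝ h e
      - μ / m * (∑ i, inner ℝ (a i) h * inner ℝ (a i) e - m * inner ℝ h e)
      - μ / m * ∑ i, ξ i * inner ℝ (a i) e := by
    have h1 : ‖e‖ ^ 2 = inner ℝ (u - X) e := by
      rw [← real_inner_self_eq_norm_sq]
      exact inner_coordProj (S := T ∪ S) (u - X) heΘ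
    have h2 : u - X = h - μ • truncGrad a (measurement a X) ⊤ z := by
      rw [hu, hh]
      abel
    rw [h1, h2, inner_sub_left, inner_smul_left, hgrad, inner_smul_left, sum_inner]
    simp only [inner_smul_left, conj_trivial, add_mul, Finset.sum_add_distrib]
    field_simp
    ring
  have hhe := abs_real_inner_le_norm h e
  obtain ⟨hμ1, hμ2⟩ := hμ
  have hbound : ‖e‖ ^ 2 ≤ (1 / 4) * ‖h‖ * ‖e‖ := by
    have hP : 0 ≤ ‖h‖ * ‖e‖ := by positivity
    have g1 : (1 - μ) * inner ℝ h e ≤ 1 / 10 * (‖h‖ * ‖e‖) := by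
      have := (abs_le.1 hhe).2
      nlinarith [mul_nonneg (sub_nonneg.2 hμ2) (sub_nonneg.2 this)]
    have hμm : 0 ≤ μ / m := by positivity
    have g2 : -(μ / m * (∑ i, inner ℝ (a i) h * inner ℝ (a i) e - m * inner ℝ h e))
        ≤ 1 / 100 * (‖h‖ * ‖e‖) := by
      have h1 := (abs_le.1 hgram).1
      have h2 : -(∑ i, inner ℝ (a i) h * inner ℝ (a i) e - m * inner ℝ h e)
          ≤ m * (1 / 100) * (‖h‖ * ‖e‖) := by
        have : m * (t * ((2 * S.card : ℕ) : ℝ)) * (‖h‖ * ‖e‖) ≤ m * (1 / 100) * (‖h‖ * ‖e‖) := by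
          gcongr
        linarith
      calc -(μ / m * (∑ i, inner ℝ (a i) h * inner ℝ (a i) e - m * inner ℝ h e))
          = μ / m * -(∑ i, inner ℝ (a i) h * inner ℝ (a i) e - m * inner ℝ h e) := by ring
        _ ≤ μ / m * (m * (1 / 100) * (‖h‖ * ‖e‖)) := by gcongr
        _ = μ * (1 / 100 * (‖h‖ * ‖e‖)) := by field_simp
        _ ≤ 1 / 100 * (‖h‖ * ‖e‖) := mul_le_of_le_one_left (by positivity) hμ2
    have g3 : -(μ / m * ∑ i, ξ i * inner ℝ (a i) e) ≤ 7 / 100 * (‖h‖ * ‖e‖) := by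
      have h1 := (abs_le.1 hcross).1
      calc -(μ / m * ∑ i, ξ i * inner ℝ (a i) e) = μ / m * -(∑ i, ξ i * inner ℝ (a i) e) := by ring
        _ ≤ μ / m * (m * (7 / 100) * (‖h‖ * ‖e‖)) := by
          refine mul_le_mul_of_nonneg_left ?_ hμm
          linarith
        _ = μ * (7 / 100 * (‖h‖ * ‖e‖)) := by field_simp
        _ ≤ 7 / 100 * (‖h‖ * ‖e‖) := mul_le_of_le_one_left (by positivity) hμ2
    rw [hid]
    nlinarith
  have he4 : ‖e‖ ≤ 1 / 4 * ‖h‖ := by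
    rcases eq_or_lt_of_le (norm_nonneg e) with h0 | h0
    · rw [← h0]
      positivity
    · rw [pow_two] at hbound
      exact le_of_mul_le_mul_right hbound h0
  have := norm_threshold_sub_le hXS hT hvT
  linarith

/-! ### Accuracy of the spectral initialization -/

lemma zeroPad_apply_eq_zero {n : ℕ} {S : Finset (Fin n)} (w : EuclideanSpace ℝ S) :
    ∀ j ∉ S, zeroPad S w j = 0 := by
  intro j hj
  simp [zeroPad, hj]

lemma sum_zeroPad {n : ℕ} {S : Finset (Fin n)} (w : EuclideanSpace ℝ S) (f : Fin n → ℝ → ℝ)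
    (hf : ∀ j, f j 0 = 0) : ∑ j, f j (zeroPad S w j) = ∑ j : S, f j (w j) := by
  have h1 : ∑ j, f j (zeroPad S w j) = ∑ j ∈ S, f j (zeroPad S w j) := by
    symm
    refine Finset.sum_subset (Finset.subset_univ _) fun j _ hj => ?_
    rw [zeroPad_apply_eq_zero w j hj, hf]
  rw [h1, ← Finset.sum_coe_sort S]
  refine Finset.sum_congr rfl fun j _ => ?_
  simp [zeroPad]

lemma norm_zeroPad {n : ℕ} {S : Finset (Fin n)} (w : EuclideanSpace ℝ S) :
    ‖zeroPad S w‖ = ‖w‖ := by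
  rw [EuclideanSpace.norm_eq, EuclideanSpace.norm_eq,
    sum_zeroPad w (fun _ y => ‖y‖ ^ 2) (by simp)]

lemma zeroPad_restrict {n : ℕ} {S : Finset (Fin n)} {x : EuclideanSpace ℝ (Fin n)}
    (hxS : ∀ j ∉ S, x j = 0) : zeroPad S (restrict S x) = x := by
  ext j
  by_cases hj : j ∈ S
  · simp [zeroPad, restrict, hj]
  · simp [zeroPad, hj, hxS j hj]

lemma dotProduct_restrict {n : ℕ} (S : Finset (Fin n)) (a : EuclideanSpace ℝ (Fin n))
    (w : EuclideanSpace ℝ S) :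
    (restrict S a).ofLp ⬝ᵥ w.ofLp = inner ℝ a (zeroPad S w) := by
  rw [inner_eq_sum, sum_zeroPad w (fun j y => a j * y) (by simp)]
  rfl

lemma dotProduct_initMatrix {n m : ℕ} (a : Fin m → EuclideanSpace ℝ (Fin n)) (S : Finset (Fin n))
    (I : Finset (Fin m)) (w : EuclideanSpace ℝ S) :
    w.ofLp ⬝ᵥ (initMatrix a S I).mulVec w.ofLp
      = 1 / (I.card : ℝ) * ∑ i ∈ I, (inner ℝ (a i) (zeroPad S w) / ‖restrict S (a i)‖) ^ 2 := by
  have h1 : ∀ i, w.ofLp ⬝ᵥ ((1 / ‖restrict S (a i)‖ ^ 2) • Matrix.vecMulVec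
      (restrict S (a i)).ofLp (restrict S (a i)).ofLp).mulVec w.ofLp
      = (inner ℝ (a i) (zeroPad S w) / ‖restrict S (a i)‖) ^ 2 := by
    intro i
    rw [Matrix.smul_mulVec, dotProduct_smul, Matrix.vecMulVec_mulVec, dotProduct_restrict,
      dotProduct_smul, dotProduct_comm, dotProduct_restrict]
    simp
    ring
  rw [initMatrix, Matrix.smul_mulVec, dotProduct_smul, Matrix.sum_mulVec, dotProduct_sum]
  simp_rw [h1]
  rfl

/-- If the direction `α p + q` has at least the energy of `p` while `q` is small compared with
`p`, then `α` is close to `±1`. -/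
lemma le_of_sum_sq_le_sum_sq {ι : Type*} {I : Finset ι} {p q : ι → ℝ} {α β s : ℝ}
    (hP : 0 < ∑ i ∈ I, p i ^ 2) (hαβ : α ^ 2 + β ^ 2 = 1) (hβ : 0 ≤ β) (hs : 0 ≤ s)
    (hs1 : s ^ 2 ≤ 1 / 2) (hle : ∑ i ∈ I, p i ^ 2 ≤ ∑ i ∈ I, (α * p i + q i) ^ 2)
    (hq : ∑ i ∈ I, q i ^ 2 ≤ s ^ 2 * β ^ 2 * ∑ i ∈ I, p i ^ 2) : β ≤ 4 * s := by
  set P := ∑ i ∈ I, p i ^ 2 with hPdef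
  set Q := ∑ i ∈ I, q i ^ 2 with hQdef
  have hcs : |∑ i ∈ I, p i * q i| ≤ s * β * P := by
    refine abs_le_of_sq_le_sq ?_ (by positivity)
    refine (Finset.sum_mul_sq_le_sq_mul_sq _ _ _).trans ?_
    calc P * Q ≤ P * (s ^ 2 * β ^ 2 * P) := by gcongr
      _ = (s * β * P) ^ 2 := by ring
  have hexp : ∑ i ∈ I, (α * p i + q i) ^ 2 = α ^ 2 * P + 2 * α * ∑ i ∈ I, p i * q i + Q := by
    rw [hPdef, hQdef, Finset.mul_sum, Finset.mul_sum, ← Finset.sum_add_distrib,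
      ← Finset.sum_add_distrib]
    exact Finset.sum_congr rfl fun i _ => by ring
  rw [hexp] at hle
  have hα : |α| ≤ 1 := by
    rw [abs_le_one_iff_mul_self_le_one]
    nlinarith [sq_nonneg β]
  have hcross : α * ∑ i ∈ I, p i * q i ≤ s * β * P := by
    refine (le_abs_self _).trans ?_
    rw [abs_mul]
    calc |α| * |∑ i ∈ I, p i * q i| ≤ 1 * (s * β * P) := by gcongr
      _ = s * β * P := one_mul _
  have hmain : β ^ 2 * P ≤ (2 * s * β + s ^ 2 * β ^ 2) * P := by
    have : α ^ 2 = 1 - β ^ 2 := by linarith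
    rw [this] at hle
    linarith
  have hmain' := le_of_mul_le_mul_right hmain hP
  rcases eq_or_lt_of_le hβ with h0 | h0
  · rw [← h0]; positivity
  · have h1 : β * β ≤ (2 * s + s ^ 2 * β) * β := by nlinarith
    have h2 := le_of_mul_le_mul_right h1 h0
    have h3 : s ^ 2 * β ≤ 1 / 2 * β := by gcongr
    linarith

lemma IsTopSet.congr_mul {ι : Type*} {k : ℕ} {f g : ι → ℝ} {I : Finset ι} {c : ℝ} (hc : 0 < c)
    (h : ∀ i, f i = c * g i) (hI : IsTopSet k f I) : IsTopSet k g I := by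
  refine ⟨hI.1, fun i hi j hj => ?_⟩
  have := hI.2 i hi j hj
  rw [h, h] at this
  exact le_of_mul_le_mul_left this hc

lemma measurement_eq {n m : ℕ} (a : Fin m → EuclideanSpace ℝ (Fin n))
    {X : EuclideanSpace ℝ (Fin n)} (hX : 0 < ‖X‖) (i : Fin m) :
    measurement a X i = ‖X‖ * |inner ℝ (a i) (‖X‖⁻¹ • X)| := by
  rw [measurement, inner_smul_right, abs_mul, abs_inv, abs_norm, mul_inv_cancel_left₀ hX.ne']

open scoped Classical in
/-- The principal eigenvector is close to `x` or to `-x`: it has at least the energy of `x`, which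
is large by the selection, and the energy orthogonal to `x` is small. -/
lemma principal_eigenvector_close {n m l : ℕ} {a : Fin m → EuclideanSpace ℝ (Fin n)}
    {S : Finset (Fin n)} {x : EuclideanSpace ℝ (Fin n)} (hx : ‖x‖ = 1)
    (hxS : ∀ j ∉ S, x j = 0) {R s : ℝ} (hR : 0 < R) (hRS : R ≤ S.card) (hs : 0 ≤ s)
    (hs1 : s ^ 2 ≤ 1 / 2) (hsR : 192 ≤ s ^ 2 * R) (hl : 0 < l)
    (hcount : l ≤ (Finset.univ.filter fun i => R ≤ inner ℝ (a i) x ^ 2 ∧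
        ‖orthPart S x (a i)‖ ^ 2 ≤ 2 * S.card).card)
    (hOE : SmallOrthogonalEnergy S x l a) {I : Finset (Fin m)}
    (hI : IsTopSet l (fun i => |inner ℝ (a i) x| / ‖restrict S (a i)‖) I)
    {w : EuclideanSpace ℝ S} (hw : IsPrincipalEigenvector (initMatrix a S I) w) :
    ‖zeroPad S w - x‖ ≤ 6 * s ∨ ‖zeroPad S w + x‖ ≤ 6 * s := by
  have hk : (0 : ℝ) < S.card := hR.trans_le hRS
  set W := zeroPad S w with hW
  have hWn : ‖W‖ = 1 := (norm_zeroPad w).trans hw.1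
  set α : ℝ := inner ℝ W x with hα
  set Y := W - α • x with hY
  have hYS : ∀ j ∉ S, Y j = 0 := by
    intro j hj
    rw [hY, PiLp.sub_apply, PiLp.smul_apply, hxS j hj, hW, zeroPad_apply_eq_zero w j hj]
    simp
  have hYx : inner ℝ Y x = (0 : ℝ) := by
    rw [hY, inner_sub_left, inner_smul_left, real_inner_self_eq_norm_sq, hx]
    simp [hα]
  have hYn : α ^ 2 + ‖Y‖ ^ 2 = 1 := by
    rw [hY, norm_sub_sq_real, norm_smul, inner_smul_right, hx, hWn, ← hα, Real.norm_eq_abs, mul_one,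
      sq_abs]
    ring
  -- every selected ratio is at least the ratio of the typical large measurements
  have hratio : ∀ i ∈ I, √(R / (R + 2 * S.card)) ≤ |inner ℝ (a i) x| / ‖restrict S (a i)‖ := by
    refine hI.le_of_card_le hcount fun i hi => ?_
    obtain ⟨h1, h2⟩ := (Finset.mem_filter.1 hi).2
    rw [norm_restrict, ← Real.sqrt_sq_eq_abs, ← Real.sqrt_sq (norm_nonneg (coordProj S (a i))),
      ← Real.sqrt_div (sq_nonneg _), norm_sq_coordProj_eq hx hxS]
    refine Real.sqrt_le_sqrt ?_
    rw [div_le_div_iff₀ (by positivity)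
      (add_pos_of_pos_of_nonneg (hR.trans_le h1) (sq_nonneg ‖orthPart S x (a i)‖))]
    nlinarith [mul_nonneg (sub_nonneg.2 h1) hk.le, mul_nonneg hR.le (sub_nonneg.2 h2)]
  set p : Fin m → ℝ := fun i => inner ℝ (a i) x / ‖restrict S (a i)‖ with hp
  set q : Fin m → ℝ := fun i => inner ℝ (a i) Y / ‖restrict S (a i)‖ with hq
  have hpl : ∀ i ∈ I, R / (3 * S.card) ≤ p i ^ 2 := by
    intro i hi
    have h1 := pow_le_pow_left₀ (Real.sqrt_nonneg _) (hratio i hi) 2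
    rw [Real.sq_sqrt (by positivity), div_pow, sq_abs, ← div_pow] at h1
    refine le_trans ?_ h1
    gcongr
    linarith
  have hP : l * (R / (3 * S.card)) ≤ ∑ i ∈ I, p i ^ 2 := by
    rw [← hI.1, ← nsmul_eq_mul]
    exact Finset.card_nsmul_le_sum _ _ _ hpl
  have hlR : (0 : ℝ) < l := by exact_mod_cast hl
  have hP0 : 0 < ∑ i ∈ I, p i ^ 2 := lt_of_lt_of_le (by positivity) hP
  -- the maximality of the principal eigenvector, compared with `x`
  have hle : ∑ i ∈ I, p i ^ 2 ≤ ∑ i ∈ I, (α * p i + q i) ^ 2 := by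
    have hrx : ‖restrict S x‖ = 1 := by
      rw [norm_restrict, coordProj_eq_self hxS, hx]
    have h1 := hw.2 (restrict S x) hrx
    rw [dotProduct_initMatrix, dotProduct_initMatrix, zeroPad_restrict hxS] at h1
    have h2 := le_of_mul_le_mul_left h1 (by rw [hI.1]; positivity)
    refine h2.trans (le_of_eq (Finset.sum_congr rfl fun i _ => ?_))
    have : inner ℝ (a i) (zeroPad S w) = α * inner ℝ (a i) x + inner ℝ (a i) Y := by
      rw [← inner_smul_right, ← inner_add_right, hY]
      congr 1
      rw [add_sub_cancel]
    rw [this, hp, hq]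
    ring
  have hQ : ∑ i ∈ I, q i ^ 2 ≤ s ^ 2 * ‖Y‖ ^ 2 * ∑ i ∈ I, p i ^ 2 := by
    have h1 := hOE I hI Y hYS
    have h2 : ∑ i ∈ I, q i ^ 2 ≤ ∑ i ∈ I,
        inner ℝ (‖orthPart S x (a i)‖⁻¹ • orthPart S x (a i)) Y ^ 2 := by
      refine Finset.sum_le_sum fun i _ => ?_
      rw [inner_smul_left, conj_trivial, inner_orthPart hYS hYx, hq]
      simp only
      rw [div_eq_inv_mul, mul_pow, mul_pow]
      rcases eq_or_ne (orthPart S x (a i)) 0 with h0 | h0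
      · have : inner ℝ (a i) Y = (0 : ℝ) := by
          rw [← inner_orthPart hYS hYx, h0, inner_zero_left]
        simp [this]
      · have hb : 0 < ‖orthPart S x (a i)‖ := norm_pos_iff.2 h0
        have hle : ‖orthPart S x (a i)‖ ≤ ‖restrict S (a i)‖ := by
          rw [norm_restrict]
          refine (pow_le_pow_iff_left₀ (norm_nonneg _) (norm_nonneg _) two_ne_zero).1 ?_
          rw [norm_sq_coordProj_eq hx hxS]
          linarith [sq_nonneg (inner ℝ (a i) x : ℝ)]
        gcongr
    have h3 : 64 * l / S.card ≤ s ^ 2 * ∑ i ∈ I, p i ^ 2 := by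
      calc 64 * (l : ℝ) / S.card = 192 * (l / (3 * S.card)) := by field_simp; norm_num
        _ ≤ (s ^ 2 * R) * (l / (3 * S.card)) := by gcongr
        _ = s ^ 2 * (l * (R / (3 * S.card))) := by ring
        _ ≤ s ^ 2 * ∑ i ∈ I, p i ^ 2 := by gcongr
    calc ∑ i ∈ I, q i ^ 2 ≤ 64 * l / S.card * ‖Y‖ ^ 2 := h2.trans h1
      _ ≤ (s ^ 2 * ∑ i ∈ I, p i ^ 2) * ‖Y‖ ^ 2 := by gcongr
      _ = s ^ 2 * ‖Y‖ ^ 2 * ∑ i ∈ I, p i ^ 2 := by ring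
  have hβ := le_of_sum_sq_le_sum_sq hP0 hYn (norm_nonneg Y) hs hs1 hle hQ
  have hβ2 : ‖Y‖ ^ 2 ≤ 16 * s ^ 2 := by
    calc ‖Y‖ ^ 2 ≤ (4 * s) ^ 2 := by gcongr
      _ = 16 * s ^ 2 := by ring
  have hα1 : |α| ≤ 1 := by
    rw [abs_le_one_iff_mul_self_le_one]
    nlinarith [sq_nonneg ‖Y‖]
  rcases le_total 0 α with h0 | h0
  · left
    refine (pow_le_pow_iff_left₀ (norm_nonneg _) (by positivity) two_ne_zero).1 ?_
    rw [norm_sub_sq_real, hWn, hx, ← hα]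
    rw [abs_of_nonneg h0] at hα1
    nlinarith
  · right
    refine (pow_le_pow_iff_left₀ (norm_nonneg _) (by positivity) two_ne_zero).1 ?_
    rw [norm_add_sq_real, hWn, hx, ← hα]
    rw [abs_of_nonpos h0] at hα1
    nlinarith

open scoped Classical in
/-- The direction of the initialization is accurate by the spectral estimate, its length by the
concentration of `∑ᵢ ψᵢ² / m`, that is, by the restricted isometry at `X`. -/
lemma initialization_close {n m l : ℕ} {a : Fin m → EuclideanSpace ℝ (Fin n)} (hm : 0 < m)
    {S : Finset (Fin n)} {X : EuclideanSpace ℝ (Fin n)} (hX : 0 < ‖X‖)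
    (hXS : ∀ j ∉ S, X j = 0) {R ρ t : ℝ} (hR : 0 < R) (hRS : R ≤ S.card) (hρ : 0 ≤ ρ)
    (hρ1 : ρ ≤ 1) (hρR : 192 * 144 ≤ ρ ^ 2 * R) (hl : 0 < l)
    (hG : GramClose t a) (ht : 0 ≤ t) (hts : t * S.card ≤ ρ / 2)
    (hcount : l ≤ (Finset.univ.filter fun i => R ≤ inner ℝ (a i) (‖X‖⁻¹ • X) ^ 2 ∧
        ‖orthPart S (‖X‖⁻¹ • X) (a i)‖ ^ 2 ≤ 2 * S.card).card)
    (hOE : SmallOrthogonalEnergy S (‖X‖⁻¹ • X) l a)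
    (hsupp : ∀ T, IsSupportEstimate a (measurement a X) S.card T → T = S)
    {z : EuclideanSpace ℝ (Fin n)} (hz : IsInitialization a (measurement a X) S.card l z) :
    (∀ j ∉ S, z j = 0) ∧ (‖z - X‖ ≤ ρ * ‖X‖ ∨ ‖z + X‖ ≤ ρ * ‖X‖) := by
  obtain ⟨T, I, w, hT, hI, hw, rfl⟩ := hz
  obtain rfl := hsupp T hT
  set x := ‖X‖⁻¹ • X with hx
  have hxn : ‖x‖ = 1 := by rw [hx, norm_smul, norm_inv, norm_norm, inv_mul_cancel₀ hX.ne']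
  have hxS : ∀ j ∉ T, x j = 0 := fun j hj => by
    rw [hx, PiLp.smul_apply, hXS j hj, smul_zero]
  have hXx : X = ‖X‖ • x := by rw [hx, smul_smul, mul_inv_cancel₀ hX.ne', one_smul]
  have hI' : IsTopSet l (fun i => |inner ℝ (a i) x| / ‖restrict T (a i)‖) I :=
    hI.congr_mul hX fun i => by rw [measurement_eq a hX, mul_div_assoc]
  have hclose := principal_eigenvector_close hxn hxS hR hRS (s := ρ / 12) (by positivity)
    (by nlinarith) (by nlinarith) hl hcount hOE hI' hw
  rw [show 6 * (ρ / 12) = ρ / 2 by ring] at hclose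
  have hmR : (0 : ℝ) < m := by exact_mod_cast hm
  set r := √((∑ i, inner ℝ (a i) x ^ 2) / m) with hr
  have hscale : √((∑ i, measurement a X i ^ 2) / m) = ‖X‖ * r := by
    rw [hr, ← Real.sqrt_sq hX.le, ← Real.sqrt_mul (sq_nonneg _)]
    congr 1
    rw [← mul_div_assoc, Finset.mul_sum]
    congr 1
    refine Finset.sum_congr rfl fun i _ => ?_
    rw [measurement_eq a hX, mul_pow, sq_abs]
  have hr1 : |r - 1| ≤ ρ / 2 := by
    have h1 := hG.abs_sum_sq_inner_sub_le ht hxS le_rfl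
    rw [hxn] at h1
    have h2 : r ^ 2 = (∑ i, inner ℝ (a i) x ^ 2) / m := by
      rw [hr, Real.sq_sqrt (div_nonneg (Finset.sum_nonneg fun i _ => sq_nonneg _) hmR.le)]
    have h3 : |r ^ 2 - 1| ≤ ρ / 2 := by
      rw [h2, div_sub_one hmR.ne', abs_div, abs_of_pos hmR, div_le_iff₀ hmR]
      calc |∑ i, inner ℝ (a i) x ^ 2 - (m : ℝ)| ≤ m * (t * T.card) := by simpa using h1
        _ ≤ m * (ρ / 2) := by gcongr
        _ = ρ / 2 * m := by ring
    have h4 : |r - 1| * 1 ≤ |r - 1| * |r + 1| := by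
      refine mul_le_mul_of_nonneg_left ?_ (abs_nonneg _)
      rw [abs_of_nonneg (by positivity)]
      linarith [Real.sqrt_nonneg ((∑ i, inner ℝ (a i) x ^ 2) / m)]
    rw [← abs_mul, show (r - 1) * (r + 1) = r ^ 2 - 1 by ring, mul_one] at h4
    exact h4.trans h3
  have hWn : ‖zeroPad T w‖ = 1 := (norm_zeroPad w).trans hw.1
  rw [hscale]
  refine ⟨fun j hj => by rw [PiLp.smul_apply, zeroPad_apply_eq_zero w j hj, smul_zero], ?_⟩
  have hfinal : ∀ x' : EuclideanSpace ℝ (Fin n), ‖zeroPad T w - x'‖ ≤ ρ / 2 →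
      ‖(‖X‖ * r) • zeroPad T w - ‖X‖ • x'‖ ≤ ρ * ‖X‖ := by
    intro x' hx'
    have e : (‖X‖ * r) • zeroPad T w - ‖X‖ • x'
        = ‖X‖ • ((r - 1) • zeroPad T w + (zeroPad T w - x')) := by
      module
    rw [e, norm_smul, norm_norm, mul_comm]
    refine mul_le_mul_of_nonneg_right ((norm_add_le _ _).trans ?_) hX.le
    rw [norm_smul, hWn, mul_one, Real.norm_eq_abs]
    linarith
  rcases hclose with h | h
  · left
    have := hfinal x h
    rwa [← hXx] at this
  · right
    have := hfinal (-x) (by rwa [sub_neg_eq_add])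
    rwa [smul_neg, ← hXx, sub_neg_eq_add] at this

/-! ### Linear convergence -/

lemma measurement_neg {n m : ℕ} (a : Fin m → EuclideanSpace ℝ (Fin n))
    (X : EuclideanSpace ℝ (Fin n)) : measurement a (-X) = measurement a X := by
  funext i
  rw [measurement, measurement, inner_neg_right, abs_neg]

open scoped Classical in
lemma norm_iterate_sub_le {n m : ℕ} {a : Fin m → EuclideanSpace ℝ (Fin n)} (hm : 0 < m)
    {t η η₁ ρ μ : ℝ} {S : Finset (Fin n)} {X : EuclideanSpace ℝ (Fin n)}
    (hG : GramClose t a) (ht : 0 ≤ t) (hts : t * (2 * S.card) ≤ 1 / 100) (hη₁ : 0 < η₁)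
    (hE : SmallSubsetEnergy η (1 / 1000) (2 * S.card) a)
    (hX : 0 < ‖X‖) (hXS : ∀ j ∉ S, X j = 0)
    (hsmall : ((Finset.univ.filter fun i => |inner ℝ (a i) (‖X‖⁻¹ • X)| ≤ η₁).card : ℝ)
      ≤ η / 2 * m)
    (hρ0 : 0 ≤ ρ) (hρ : 2 * ρ ^ 2 ≤ η / 2 * η₁ ^ 2) (hμ : μ ∈ Set.Icc (9 / 10 : ℝ) 1)
    {z : ℕ → EuclideanSpace ℝ (Fin n)} (hzS : ∀ j ∉ S, z 0 j = 0)
    (hz : ‖z 0 - X‖ ≤ ρ * ‖X‖)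
    (hstep : ∀ r, IsHardThreshold S.card
      (z r - μ • truncGrad a (measurement a X) ⊤ (z r)) (z (r + 1))) (r : ℕ) :
    ‖z r - X‖ ≤ ρ * (1 / 2) ^ r * ‖X‖ := by
  have hsparse : ∀ r, ∃ T : Finset (Fin n), T.card = S.card ∧ ∀ j ∉ T, z r j = 0 := by
    rintro (_ | r)
    · exact ⟨S, rfl, hzS⟩
    · obtain ⟨T, hT, hvT⟩ := hstep r
      exact ⟨T, hT.1, fun j hj => by rw [hvT, if_neg hj]⟩
  induction r with
  | zero => simpa using hz
  | succ r ih =>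
    obtain ⟨T, hTc, hT⟩ := hsparse r
    have hρr : ρ * (1 / 2) ^ r * ‖X‖ ≤ ρ * ‖X‖ := by
      refine mul_le_mul_of_nonneg_right ?_ hX.le
      exact mul_le_of_le_one_right hρ0 (pow_le_one₀ (by norm_num) (by norm_num))
    have := norm_refine_sub_le hm hG ht hts hη₁ hE hX hXS hT hTc hsmall hρ hμ (ih.trans hρr)
      (hstep r)
    calc ‖z (r + 1) - X‖ ≤ 1 / 2 * (ρ * (1 / 2) ^ r * ‖X‖) := this.trans (by linarith)
      _ = ρ * (1 / 2) ^ (r + 1) * ‖X‖ := by ring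

/-- The sign of the limit is decided by the initialization; the problem is symmetric under
`X ↦ -X`. -/
lemma signDist_iterate_le {n m : ℕ} {a : Fin m → EuclideanSpace ℝ (Fin n)} (hm : 0 < m)
    {t η η₁ ρ μ : ℝ} {S : Finset (Fin n)} {X : EuclideanSpace ℝ (Fin n)}
    (hG : GramClose t a) (ht : 0 ≤ t) (hts : t * (2 * S.card) ≤ 1 / 100) (hη₁ : 0 < η₁)
    (hE : SmallSubsetEnergy η (1 / 1000) (2 * S.card) a)
    (hX : 0 < ‖X‖) (hXS : ∀ j ∉ S, X j = 0)
    (hsmall : ((Finset.univ.filter fun i => |inner ℝ (a i) (‖X‖⁻¹ • X)| ≤ η₁).card : ℝ)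
      ≤ η / 2 * m)
    (hρ0 : 0 ≤ ρ) (hρ : 2 * ρ ^ 2 ≤ η / 2 * η₁ ^ 2) (hμ : μ ∈ Set.Icc (9 / 10 : ℝ) 1)
    {z : ℕ → EuclideanSpace ℝ (Fin n)} (hzS : ∀ j ∉ S, z 0 j = 0)
    (hz : ‖z 0 - X‖ ≤ ρ * ‖X‖ ∨ ‖z 0 + X‖ ≤ ρ * ‖X‖)
    (hstep : ∀ r, IsHardThreshold S.card
      (z r - μ • truncGrad a (measurement a X) ⊤ (z r)) (z (r + 1))) (r : ℕ) :
    signDist (z r) X ≤ ρ * (1 / 2) ^ r * ‖X‖ := by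
  classical
  rcases hz with hz | hz
  · refine (min_le_right _ _).trans ?_
    exact norm_iterate_sub_le hm hG ht hts hη₁ hE hX hXS (by convert hsmall) hρ0 hρ hμ hzS hz
      hstep r
  · refine (min_le_left _ _).trans ?_
    have := norm_iterate_sub_le (X := -X) hm hG ht hts hη₁ hE (by rwa [norm_neg])
      (fun j hj => by rw [PiLp.neg_apply, hXS j hj, neg_zero])
      (by simpa only [norm_neg, smul_neg, inner_neg_right, abs_neg] using by convert hsmall)
      hρ0 hρ hμ hzS (by rwa [sub_neg_eq_add, norm_neg])
      (fun r => by rw [measurement_neg]; exact hstep r) r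
    rwa [sub_neg_eq_add, norm_neg] at this

/-! ### Exact support recovery -/

/-- Only the law of the whole design matters. The bad set need not be measurable. -/
lemma IsGaussianDesign.exists_event {Ω : Type*} [MeasurableSpace Ω] {P : Measure Ω}
    [IsProbabilityMeasure P] {n m : ℕ} {a : Fin m → Ω → EuclideanSpace ℝ (Fin n)}
    (ha : IsGaussianDesign P a) {bad : Set (Fin m → EuclideanSpace ℝ (Fin n))} {δ : ℝ}
    (hδ : 0 ≤ δ) (hbad : designMeasure n m bad ≤ ENNReal.ofReal δ) :
    ∃ E : Set Ω, MeasurableSet E ∧ 1 - δ ≤ P.real E ∧ ∀ ω ∈ E, (fun i => a i ω) ∉ bad := by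
  have hmeas : ∀ i, AEMeasurable (a i) P := fun i => (ha.2 i).aemeasurable
  have hlaw : P.map (fun ω i => a i ω) = designMeasure n m := by
    rw [ha.1.map_fun_eq_pi_map hmeas]
    congr 1
    funext i
    exact (ha.2 i).map_eq
  set F := toMeasurable P ((fun ω i => a i ω) ⁻¹' bad) with hF
  have hFm : MeasurableSet F := measurableSet_toMeasurable _ _
  have hFle : P F ≤ ENNReal.ofReal δ := by
    rw [hF, measure_toMeasurable]
    refine (Measure.le_map_apply (aemeasurable_pi_lambda _ hmeas) bad).trans ?_
    rwa [hlaw]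
  refine ⟨Fᶜ, hFm.compl, ?_, fun ω hω hb => hω (subset_toMeasurable _ _ hb)⟩
  rw [probReal_compl_eq_one_sub hFm]
  have : P.real F ≤ δ := ENNReal.toReal_le_of_le_ofReal hδ hFle
  linarith

lemma IsAdmissibleSignal.pos {n k : ℕ} {C₁ : ℝ} {X : EuclideanSpace ℝ (Fin n)}
    (h : IsAdmissibleSignal C₁ k X) : 0 < k ∧ k ≤ n ∧ 0 < ‖X‖ := by
  obtain ⟨hk, r, ⟨⟨j, hj, -⟩, -⟩, -⟩ := h
  refine ⟨hk ▸ Finset.card_pos.2 ⟨j, hj⟩, ?_, norm_pos_iff.2 fun h0 => ?_⟩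
  · simpa [hk] using Finset.card_le_univ (supp X)
  · simp [supp, h0] at hj

lemma IsAdmissibleSignal.le_sq {n k : ℕ} {C₁ : ℝ} {X : EuclideanSpace ℝ (Fin n)}
    (h : IsAdmissibleSignal C₁ k X) {j : Fin n} (hj : X j ≠ 0) :
    C₁ / k * ‖X‖ ^ 2 ≤ X j ^ 2 := by
  obtain ⟨-, r, ⟨⟨i, -, hi⟩, hmin⟩, hr⟩ := h
  rw [← hr, ← sq_abs (X j)]
  refine pow_le_pow_left₀ (hi ▸ abs_nonneg _) (hmin ⟨j, ?_, rfl⟩) 2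
  simpa [supp] using hj

lemma suppStat_eq {n m : ℕ} (a : Fin m → EuclideanSpace ℝ (Fin n))
    {X : EuclideanSpace ℝ (Fin n)} (hX : 0 < ‖X‖) (j : Fin n) :
    suppStat a (measurement a X) j = ‖X‖ ^ 2 / m *
      ∑ i, inner ℝ (a i) (‖X‖⁻¹ • X) ^ 2 * inner ℝ (a i) (stdVec j) ^ 2 := by
  rw [suppStat, Finset.mul_sum, Finset.mul_sum]
  refine Finset.sum_congr rfl fun i _ => ?_
  rw [measurement_eq a hX, inner_stdVec, mul_pow, sq_abs]
  ring

lemma card_mul_exp_neg_le {n m : ℕ} (hm : 0 < m) (hn : 0 < n) {A : ℝ}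
    (hA : Real.log ((m : ℝ) * n) ≤ A) : n * Real.exp (-A) ≤ 1 / (m : ℝ) := by
  have hm' : (0 : ℝ) < m := by exact_mod_cast hm
  have hn' : (0 : ℝ) < n := by exact_mod_cast hn
  have h : Real.exp (-A) ≤ ((m : ℝ) * n)⁻¹ := by
    rw [← Real.exp_log (mul_pos hm' hn'), ← Real.exp_neg]
    exact Real.exp_le_exp.2 (by linarith)
  calc n * Real.exp (-A) ≤ n * ((m : ℝ) * n)⁻¹ := by gcongr
    _ = 1 / m := by field_simp

/-- The support statistics separate the support from its complement. On the support only a lower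
bound is needed; off the support the signal component is truncated at `M = 12 log m`, which
with high probability changes nothing, and the statistic then has an exponential moment. -/
lemma measure_support_failure_le {n m k : ℕ} {C₁ : ℝ} (hC₁ : 0 < C₁) (hm : 2 ≤ m)
    {X : EuclideanSpace ℝ (Fin n)} (hX : IsAdmissibleSignal C₁ k X)
    (h₁ : 80 * momentBound * k ^ 2 * Real.log ((m : ℝ) * n) ≤ C₁ ^ 2 * m)
    (h₂ : 192 * k * Real.log m * Real.log ((m : ℝ) * n) ≤ C₁ * m) :
    designMeasure n m {a | ¬ ∀ T, IsSupportEstimate a (measurement a X) k T → T = supp X}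
      ≤ ENNReal.ofReal (2 / m) := by
  classical
  obtain ⟨hk, hkn, hXpos⟩ := hX.pos
  have hn : 0 < n := hk.trans_le hkn
  have hk' : (0 : ℝ) < k := by exact_mod_cast hk
  have hm2 : (2 : ℝ) ≤ m := by exact_mod_cast hm
  have hm' : (0 : ℝ) < m := by linarith
  have hK := one_le_momentBound
  have hK0 : 0 < momentBound := by linarith
  set x := ‖X‖⁻¹ • X with hx
  have hxn : ‖x‖ = 1 := by rw [hx, norm_smul, norm_inv, norm_norm, inv_mul_cancel₀ hXpos.ne']
  have hlog : 0 < Real.log m := Real.log_pos (by linarith)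
  set L := Real.log ((m : ℝ) * n) with hL
  set t := C₁ / k with ht
  have ht0 : 0 < t := by positivity
  set M := 12 * Real.log m with hM
  have hM0 : 0 < M := by positivity
  -- the exponent for the upper tail, limited by the truncation and by the second order term
  set c := min (1 / (4 * M)) (t / (20 * momentBound)) with hc
  have hc0 : 0 < c := lt_min (by positivity) (by positivity)
  have hxj : ∀ j, inner ℝ (stdVec j) x = ‖X‖⁻¹ * X j := fun j => by
    rw [real_inner_comm, inner_stdVec, hx, PiLp.smul_apply, smul_eq_mul]
  have hun : ∀ j : Fin n, ‖(stdVec j : EuclideanSpace ℝ (Fin n))‖ = 1 := fun j => by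
    simp [stdVec]
  set bad : Fin n → Set (Fin m → EuclideanSpace ℝ (Fin n)) := fun j =>
    if X j ≠ 0 then
      {a | ∑ i, inner ℝ (a i) x ^ 2 * inner ℝ (a i) (stdVec j) ^ 2 ≤ m * (1 + t / 2)}
    else
      {a | m * (c * (1 + t / 2)) ≤ ∑ i, c * ({g : ℝ | g ^ 2 ≤ M}.indicator (fun g => g ^ 2)
        (inner ℝ (a i) x) * inner ℝ (a i) (stdVec j) ^ 2)} with hbad
  have hbad_le : ∀ j, designMeasure n m (bad j) ≤ ENNReal.ofReal (Real.exp (-L)) := by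
    intro j
    by_cases hj : X j ≠ 0
    · simp only [hbad, if_pos hj]
      refine (measure_sum_sq_mul_sq_le hxn (hun j) ht0 ?_).trans
        (ENNReal.ofReal_le_ofReal (Real.exp_le_exp.2 (neg_le_neg ?_)))
      · have := hX.le_sq hj
        rw [hxj, mul_pow, inv_pow, inv_mul_eq_div, le_div_iff₀ (by positivity)]
        exact this
      · rw [ht, div_pow, div_div, ← mul_div_assoc, le_div_iff₀ (by positivity)]
        by_cases hL0 : 0 ≤ L
        · have : 0 ≤ momentBound * k ^ 2 * L := by positivity
          nlinarith
        · have : L * (k ^ 2 * (8 * momentBound)) ≤ 0 :=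
            mul_nonpos_of_nonpos_of_nonneg (by linarith) (by positivity)
          have : 0 ≤ m * C₁ ^ 2 := by positivity
          linarith
    · simp only [hbad, if_neg hj]
      rw [ne_eq, not_not] at hj
      refine (measure_sum_trunc_sq_mul_sq_ge hxn (hun j) (by rw [hxj, hj, mul_zero]) hc0.le
        ?_ ?_).trans (ENNReal.ofReal_le_ofReal (Real.exp_le_exp.2 (neg_le_neg ?_)))
      · calc c * M ≤ 1 / (4 * M) * M := by gcongr; exact min_le_left _ _
          _ = 1 / 4 := by field_simp
      · calc 20 * momentBound * c ≤ 20 * momentBound * (t / (20 * momentBound)) := by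
              gcongr; exact min_le_right _ _
          _ = t := by field_simp
      · rcases min_choice (1 / (4 * M)) (t / (20 * momentBound)) with h | h
        · rw [hc, h, hM, ht, show m * (1 / (4 * (12 * Real.log m)) * (C₁ / k) / 4)
            = C₁ * m / (192 * k * Real.log m) by field_simp; norm_num, le_div_iff₀ (by positivity)]
          linarith
        · rw [hc, h, ht, show m * (C₁ / k / (20 * momentBound) * (C₁ / k) / 4)
            = C₁ ^ 2 * m / (80 * momentBound * k ^ 2) by field_simp; norm_num,
            le_div_iff₀ (by positivity)]
          linarith
  have hsub : {a | ¬ ∀ T, IsSupportEstimate a (measurement a X) k T → T = supp X}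
      ⊆ {a | ∃ i, M < inner ℝ (a i) x ^ 2} ∪ ⋃ j, bad j := by
    intro a ha
    by_contra hgood
    rw [Set.mem_union, not_or] at hgood
    obtain ⟨hmax, hgood⟩ := hgood
    simp only [Set.mem_iUnion, not_exists, Set.mem_ofPred_eq, not_lt] at hgood hmax
    refine ha fun T hT => ?_
    obtain rfl := hX.1
    refine IsTopSet.eq_of_separated hT fun i hi j hj => ?_
    have hi' : X i ≠ 0 := by simpa [supp] using hi
    have hj' : ¬ X j ≠ 0 := by simpa [supp] using hj
    have h1 := hgood i
    have h2 := hgood j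
    simp only [hbad, if_pos hi', if_neg hj', Set.mem_ofPred_eq, not_le] at h1 h2
    rw [suppStat_eq a hXpos, suppStat_eq a hXpos]
    refine mul_lt_mul_of_pos_left (lt_trans ?_ h1) (by positivity)
    rw [← Finset.mul_sum] at h2
    have h3 : ∀ i, {g : ℝ | g ^ 2 ≤ M}.indicator (fun g => g ^ 2) (inner ℝ (a i) x)
        = inner ℝ (a i) x ^ 2 := fun i => 
      Set.indicator_of_mem (show _ ∈ {g : ℝ | g ^ 2 ≤ M} from hmax i) _
    simp only [h3] at h2
    nlinarith
  have hmaxle : designMeasure n m {a | ∃ i, M < inner ℝ (a i) x ^ 2}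
      ≤ ENNReal.ofReal (1 / m) := by
    refine (measure_exists_sq_inner_gt_le hxn M).trans (ENNReal.ofReal_le_ofReal ?_)
    rw [show -(M / 4) = -(((3 : ℕ) : ℝ) * Real.log m) by rw [hM]; push_cast; ring, Real.exp_neg,
      Real.exp_nat_mul, Real.exp_log hm', le_div_iff₀ hm', show (m : ℝ) * (2 * ((m : ℝ) ^ 3)⁻¹) * m
        = 2 / m by field_simp, div_le_one hm']
    exact hm2
  have hunion : designMeasure n m (⋃ j, bad j) ≤ ENNReal.ofReal (1 / m) := by
    refine (measure_iUnion_fintype_le _ _).trans ((Finset.sum_le_sum fun j _ => hbad_le j).trans ?_)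
    rw [Finset.sum_const, Finset.card_univ, Fintype.card_fin, nsmul_eq_mul,
      ← ENNReal.ofReal_natCast, ← ENNReal.ofReal_mul (by positivity)]
    exact ENNReal.ofReal_le_ofReal (card_mul_exp_neg_le (by omega) hn le_rfl)
  refine (measure_mono hsub).trans ((measure_union_le _ _).trans
    ((add_le_add hmaxle hunion).trans (le_of_eq ?_)))
  rw [← ENNReal.ofReal_add (by positivity) (by positivity)]
  congr 1
  ring

/-! ### Choice of the constants -/

lemma exp_neg_le_one_div {n m : ℕ} (hm : 0 < m) (hn : 0 < n) {A : ℝ}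
    (hA : Real.log ((m : ℝ) * n) ≤ A) : Real.exp (-A) ≤ 1 / (m : ℝ) := by
  refine le_trans ?_ (card_mul_exp_neg_le hm hn hA)
  have : (1 : ℝ) ≤ n := by exact_mod_cast hn
  nlinarith [Real.exp_pos (-A)]

/-- The assumptions on the sample size in the form needed for the support recovery. The second
one, caused by the truncation at a multiple of `log m`, is where the assumption `log m ≤ k` or
`log (m n) ^ 3 ≤ m` enters. -/
lemma support_sample_size {C₁ C₀ : ℝ} {n m k : ℕ} (hC₁ : 0 < C₁) (hm : 0 < m) (hn : 0 < n)
    (hk : 0 < k) (hC₀ : 80 * momentBound / C₁ ^ 2 + 192 / C₁ + (192 / C₁) ^ 2 ≤ C₀)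
    (h : C₀ * (k : ℝ) ^ 2 * Real.log ((m : ℝ) * n) ≤ m)
    (hcase : Real.log m ≤ k ∨ Real.log ((m : ℝ) * n) ^ 3 ≤ m) :
    80 * momentBound * k ^ 2 * Real.log ((m : ℝ) * n) ≤ C₁ ^ 2 * m ∧
      192 * k * Real.log m * Real.log ((m : ℝ) * n) ≤ C₁ * m := by
  have hm1 : (1 : ℝ) ≤ m := by exact_mod_cast hm
  have hn1 : (1 : ℝ) ≤ n := by exact_mod_cast hn
  have hk1 : (1 : ℝ) ≤ k := by exact_mod_cast hk
  have hK := one_le_momentBound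
  have hlm : 0 ≤ Real.log m := Real.log_nonneg hm1
  have hlL : Real.log m ≤ Real.log ((m : ℝ) * n) :=
    Real.log_le_log (by linarith) (by nlinarith)
  set L := Real.log ((m : ℝ) * n) with hL
  have hL0 : 0 ≤ L := hlm.trans hlL
  have e1 : 0 ≤ 80 * momentBound / C₁ ^ 2 := by positivity
  have e2 : 0 ≤ 192 / C₁ := by positivity
  have e3 : 0 ≤ (192 / C₁) ^ 2 := by positivity
  have hweak : ∀ D, D ≤ C₀ → D * k ^ 2 * L ≤ m := fun D hD =>
    le_trans (by gcongr) h
  constructor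
  · have := hweak (80 * momentBound / C₁ ^ 2) (by linarith)
    calc 80 * momentBound * k ^ 2 * L = C₁ ^ 2 * (80 * momentBound / C₁ ^ 2 * k ^ 2 * L) := by
          field_simp
      _ ≤ C₁ ^ 2 * m := by gcongr
  · rcases hcase with hc | hc
    · have := hweak (192 / C₁) (by linarith)
      calc 192 * k * Real.log m * L ≤ 192 * k * k * L := by gcongr
        _ = C₁ * (192 / C₁ * k ^ 2 * L) := by field_simp
        _ ≤ C₁ * m := by gcongr
    · -- here `m ^ 2 ≥ C₀ k ^ 2 L · L ^ 3` is the square of the required bound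
      have h1 := hweak ((192 / C₁) ^ 2) (by linarith)
      have h2 : (192 * k * L * L) ^ 2 ≤ (C₁ * m) ^ 2 := by
        calc (192 * k * L * L) ^ 2 = C₁ ^ 2 * (((192 / C₁) ^ 2 * k ^ 2 * L) * L ^ 3) := by
              field_simp
          _ ≤ C₁ ^ 2 * (m * m) := by gcongr
          _ = (C₁ * m) ^ 2 := by ring
      calc 192 * k * Real.log m * L ≤ 192 * k * L * L := by gcongr
        _ ≤ C₁ * m := abs_le_of_sq_le_sq' h2 (by positivity) |>.2

lemma log_mul_bounds {n m k : ℕ} (hm : 8 ≤ m) (hk : 0 < k) (hkn : k ≤ n) :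
    0 < Real.log ((m : ℝ) * n) ∧ 1 ≤ Real.log ((m : ℝ) * n) ∧
      Real.exp (Real.log ((m : ℝ) * n)) = m * n ∧ (8 : ℝ) * n ≤ m * n ∧ (k : ℝ) ≤ n := by
  have hm8 : (8 : ℝ) ≤ m := by exact_mod_cast hm
  have hkn' : (k : ℝ) ≤ n := by exact_mod_cast hkn
  have hn1 : (1 : ℝ) ≤ n := by exact_mod_cast (by omega : 1 ≤ n)
  have hmn : (8 : ℝ) * n ≤ m * n := by gcongr
  have h1 : 1 ≤ Real.log ((m : ℝ) * n) := by
    rw [Real.le_log_iff_exp_le (by linarith)]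
    linarith [Real.exp_one_lt_d9]
  exact ⟨by linarith, h1, Real.exp_log (by linarith), hmn, hkn'⟩

lemma four_mul_sq_mul_exp_neg_le {n m : ℕ} (hm : 8 ≤ m) (hn : 0 < n) {A : ℝ}
    (hA : 4 * Real.log ((m : ℝ) * n) ≤ A) : 4 * (n : ℝ) ^ 2 * Real.exp (-A) ≤ 1 / m := by
  obtain ⟨-, -, hexpL, hmn, -⟩ := log_mul_bounds hm hn le_rfl
  have hm8 : (8 : ℝ) ≤ m := by exact_mod_cast hm
  have hn0 : (0 : ℝ) < n := by exact_mod_cast hn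
  have h : Real.exp (-A) ≤ ((m * n : ℝ) ^ 4)⁻¹ := by
    rw [← hexpL, ← Real.exp_nat_mul, ← Real.exp_neg]
    exact Real.exp_le_exp.2 (by push_cast; linarith)
  refine (mul_le_mul_of_nonneg_left h (by positivity)).trans ?_
  have h1 : (1 : ℝ) ≤ n := by exact_mod_cast hn
  rw [← div_eq_mul_inv, div_le_div_iff₀ (by positivity) (by linarith), one_mul]
  calc 4 * (n : ℝ) ^ 2 * m = (4 * n) * (m * n) * 1 * 1 := by ring
    _ ≤ (m * n) * (m * n) * (m * n) * (m * n) := by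
        have h2 : 1 ≤ (m : ℝ) * n := by linarith
        gcongr
        linarith
    _ = (m * n : ℝ) ^ 4 := by ring

lemma sparse_net_mul_exp_neg_le {n m k : ℕ} (hm : 8 ≤ m) (hk : 0 < k) (hkn : k ≤ n) {A : ℝ}
    (hA : 7 * (k * Real.log ((m : ℝ) * n)) ≤ A) :
    ((n : ℝ) * (4 * (2 * k : ℕ) + 1)) ^ (2 * k) * Real.exp (-A) ≤ 1 / m := by
  obtain ⟨hL0, -, hexpL, hmn, hkn'⟩ := log_mul_bounds hm hk hkn
  have hk1 : (1 : ℝ) ≤ k := by exact_mod_cast hk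
  set L := Real.log ((m : ℝ) * n) with hL
  have h : (n : ℝ) * (4 * (2 * k : ℕ) + 1) ≤ Real.exp (3 * L) := by
    rw [show 3 * L = ((3 : ℕ) : ℝ) * L by norm_num, Real.exp_nat_mul, hexpL]
    push_cast
    calc (n : ℝ) * (4 * (2 * k) + 1) ≤ (8 * n) * ((8 * n) * (8 * n)) := by
          have h1 : (n : ℝ) ≤ 8 * n := by linarith
          have h2 : (4 * (2 * k) + 1 : ℝ) ≤ (8 * n) * (8 * n) := by nlinarith
          gcongr
      _ ≤ (m * n) * ((m * n) * (m * n)) := by gcongr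
      _ = (m * n : ℝ) ^ 3 := by ring
  calc ((n : ℝ) * (4 * (2 * k : ℕ) + 1)) ^ (2 * k) * Real.exp (-A)
      ≤ Real.exp (3 * L) ^ (2 * k) * Real.exp (-A) := by gcongr
    _ = Real.exp (-(A - 6 * (k * L))) := by
        rw [← Real.exp_nat_mul, ← Real.exp_add]
        congr 1
        push_cast
        ring
    _ ≤ 1 / m := exp_neg_le_one_div (by omega) (hk.trans_le hkn) (by nlinarith)

lemma net_mul_exp_neg_le {n m k : ℕ} (hm : 8 ≤ m) (hk : 0 < k) (hkn : k ≤ n) {A : ℝ}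
    (hA : 2 * (k * Real.log ((m : ℝ) * n)) ≤ A) :
    (4 * (k : ℝ) + 1) ^ k * Real.exp (-A) ≤ 1 / m := by
  obtain ⟨hL0, -, hexpL, hmn, hkn'⟩ := log_mul_bounds hm hk hkn
  have hk1 : (1 : ℝ) ≤ k := by exact_mod_cast hk
  set L := Real.log ((m : ℝ) * n) with hL
  have h : 4 * (k : ℝ) + 1 ≤ Real.exp L := by
    rw [hexpL]
    linarith
  calc (4 * (k : ℝ) + 1) ^ k * Real.exp (-A) ≤ Real.exp L ^ k * Real.exp (-A) := by gcongr
    _ = Real.exp (-(A - k * L)) := by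
        rw [← Real.exp_nat_mul, ← Real.exp_add]
        congr 1
        ring
    _ ≤ 1 / m := exp_neg_le_one_div (by omega) (hk.trans_le hkn) (by nlinarith)

/-- The failure probabilities of all the events that the convergence needs add up to `7 / m`, when
the sample size dominates the complexity of each of them. -/
lemma measure_divergence_le {n m l : ℕ} {C₁ η c ρ R τ μ : ℝ} {X : EuclideanSpace ℝ (Fin n)}
    (hC₁ : 0 < C₁) (hm : 8 ≤ m) (hX : IsAdmissibleSignal C₁ (supp X).card X)
    (h₁ : 80 * momentBound * (supp X).card ^ 2 * Real.log ((m : ℝ) * n) ≤ C₁ ^ 2 * m)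
    (h₂ : 192 * (supp X).card * Real.log m * Real.log ((m : ℝ) * n) ≤ C₁ * m)
    (hη : 0 < η) (hρ : 0 < ρ) (hρ1 : ρ ≤ 1 / 10) (hρη : 2 * ρ ^ 2 ≤ η / 2 * (η / 16) ^ 2)
    (hR0 : 0 < R) (hR2 : 2 ≤ R) (hρR : 192 * 144 ≤ ρ ^ 2 * R) (hRk : R ≤ (supp X).card)
    (hτ : 0 < τ) (hτ1 : τ ≤ 1 / 200) (hτ2 : τ ≤ ρ / 2)
    (hsub : designMeasure n m {a | ¬ SmallSubsetEnergy η (1 / 1000) (2 * (supp X).card) a}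
      ≤ ENNReal.ofReal ((n * (4 * (2 * (supp X).card : ℕ) + 1)) ^ (2 * (supp X).card)
        * Real.exp (-(c * m))))
    (d1 : 4 * Real.log ((m : ℝ) * n) ≤ m * ((τ / (supp X).card) ^ 2 / 8))
    (d2 : 7 * ((supp X).card * Real.log ((m : ℝ) * n)) ≤ c * m)
    (d3 : Real.log ((m : ℝ) * n) ≤ m * (η / 2 / 2))
    (d4 : Real.log ((m : ℝ) * n) ≤ m * ((gaussianReal 0 1).real {g : ℝ | R ≤ g ^ 2} / 8))
    (d5 : 2 * ((supp X).card * Real.log ((m : ℝ) * n)) ≤ l)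
    (hlm : (l : ℝ) ≤ m * ((gaussianReal 0 1).real {g : ℝ | R ≤ g ^ 2} / 8))
    (hμ : μ ∈ Set.Icc (9 / 10 : ℝ) 1) :
    designMeasure n m {a | ¬ ∀ z, IsSpartaSequence a (measurement a X) (supp X).card l μ ⊤ z →
      ∀ t : ℕ, signDist (z t) X ≤ 1 / 10 * (1 / 2) ^ t * ‖X‖} ≤ ENNReal.ofReal (7 / m) := by
  classical
  obtain ⟨hk, hkn, hXpos⟩ := hX.pos
  have hn : 0 < n := hk.trans_le hkn
  have hm0 : 0 < m := by omega
  have hm8 : (8 : ℝ) ≤ m := by exact_mod_cast hm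
  obtain ⟨hL0, -⟩ := log_mul_bounds hm hk hkn
  have hk1 : (1 : ℝ) ≤ (supp X).card := by exact_mod_cast hk
  have hl : 0 < l := by
    have : (0 : ℝ) < l := lt_of_lt_of_le (by positivity) d5
    exact_mod_cast this
  set S := supp X with hS
  have hXS : ∀ j ∉ S, X j = 0 := fun j hj => by simpa [hS, supp] using hj
  have hS2 : 2 ≤ S.card := by
    have : (2 : ℝ) ≤ S.card := hR2.trans hRk
    exact_mod_cast this
  set x := ‖X‖⁻¹ • X with hx
  have hxn : ‖x‖ = 1 := by rw [hx, norm_smul, norm_inv, norm_norm, inv_mul_cancel₀ hXpos.ne']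
  have hxS : ∀ j ∉ S, x j = 0 := fun j hj => by
    rw [hx, PiLp.smul_apply, hXS j hj, smul_zero]
  have hk0 : (0 : ℝ) < S.card := by linarith
  -- the six bad events
  have b1 : designMeasure n m {a | ¬ ∀ T, IsSupportEstimate a (measurement a X) S.card T → T = S}
      ≤ ENNReal.ofReal (2 / m) :=
    measure_support_failure_le hC₁ (by omega) hX h₁ h₂
  have b2 : designMeasure n m {a | ¬ GramClose (τ / S.card) a} ≤ ENNReal.ofReal (1 / m) := by
    refine (measure_not_gramClose_le (by positivity) ?_).trans (ENNReal.ofReal_le_ofReal ?_)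
    · rw [div_le_one hk0]
      linarith
    · exact four_mul_sq_mul_exp_neg_le hm hn d1
  have b3 : designMeasure n m {a | ¬ SmallSubsetEnergy η (1 / 1000) (2 * S.card) a}
      ≤ ENNReal.ofReal (1 / m) := by
    exact hsub.trans (ENNReal.ofReal_le_ofReal (sparse_net_mul_exp_neg_le hm hk hkn d2))
  have b4 : designMeasure n m {a | m * (η / 2)
      ≤ (Finset.univ.filter fun i => |inner ℝ (a i) x| ≤ η / 16).card}
      ≤ ENNReal.ofReal (1 / m) := by
    refine (le_of_eq ?_).trans ((measure_card_small_inner_ge_le (m := m) hxn (η := η / 16)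
      (c := η / 2) (by positivity) (by linarith)).trans (ENNReal.ofReal_le_ofReal
        (exp_neg_le_one_div hm0 hn d3)))
    congr!
  have b5 : designMeasure n m {a | ((Finset.univ.filter fun i => R ≤ inner ℝ (a i) x ^ 2 ∧
      ‖orthPart S x (a i)‖ ^ 2 ≤ 2 * S.card).card : ℝ)
      ≤ m * ((gaussianReal 0 1).real {g : ℝ | R ≤ g ^ 2} / 8)}
      ≤ ENNReal.ofReal (1 / m) := by
    refine (le_of_eq ?_).trans ((measure_card_large_axial_le (m := m) hxn hxS R).trans
      (ENNReal.ofReal_le_ofReal (exp_neg_le_one_div hm0 hn d4)))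
    congr!
  have b6 : designMeasure n m {a | ¬ SmallOrthogonalEnergy S x l a} ≤ ENNReal.ofReal (1 / m) := by
    exact (measure_not_smallOrthogonalEnergy_le hxn hxS hS2).trans (ENNReal.ofReal_le_ofReal
      (net_mul_exp_neg_le hm hk hkn d5))
  refine (measure_mono ?_).trans ((measure_union_le _ _).trans ((add_le_add b1
    ((measure_union_le _ _).trans (add_le_add b2 ((measure_union_le _ _).trans (add_le_add b3
    ((measure_union_le _ _).trans (add_le_add b4 ((measure_union_le _ _).trans
      (add_le_add b5 b6))))))))).trans ?_))
  · intro a ha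
    by_contra hgood
    simp only [Set.mem_union, Set.mem_ofPred_eq, not_or, not_not, not_le] at hgood
    obtain ⟨g1, g2, g3, g4, g5, g6⟩ := hgood
    refine ha fun z hz t => ?_
    have hcount : l ≤ (Finset.univ.filter fun i => R ≤ inner ℝ (a i) x ^ 2 ∧
        ‖orthPart S x (a i)‖ ^ 2 ≤ 2 * S.card).card := by
      exact_mod_cast hlm.trans g5.le
    have hτk : τ / S.card * S.card = τ := div_mul_cancel₀ _ hk0.ne'
    obtain ⟨hz0, hzX⟩ := initialization_close hm0 hXpos hXS hR0 hRk hρ.le (by linarith)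
      hρR hl g2 (by positivity) (by rw [hτk]; exact hτ2)
      (by convert hcount) g6 g1 hz.1
    refine (signDist_iterate_le hm0 g2 (by positivity)
      (by rw [mul_left_comm, hτk]; linarith) (by positivity) g3 hXpos hXS
      (by rw [mul_comm]; convert g4.le) hρ.le hρη hμ hz0 hzX hz.2 t).trans ?_
    gcongr
  · rw [← ENNReal.ofReal_add (by positivity) (by positivity),
      ← ENNReal.ofReal_add (by positivity) (by positivity),
      ← ENNReal.ofReal_add (by positivity) (by positivity),
      ← ENNReal.ofReal_add (by positivity) (by positivity),
      ← ENNReal.ofReal_add (by positivity) (by positivity)]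
    refine ENNReal.ofReal_le_ofReal (le_of_eq ?_)
    ring

/-- The case `m ≥ 8`, `log m < k` of the convergence, in which the failure probability is at most
`7 / m`. Otherwise the asserted probability is negative. -/
lemma exists_measure_divergence_le : ∃ C₂ D : ℝ, 0 < C₂ ∧ 0 < D ∧
    ∀ (n m k l : ℕ) (C₁ : ℝ) (X : EuclideanSpace ℝ (Fin n)), 0 < C₁ → 8 ≤ m →
      IsAdmissibleSignal C₁ k X →
      80 * momentBound * k ^ 2 * Real.log ((m : ℝ) * n) ≤ C₁ ^ 2 * m →
      192 * k * Real.log m * Real.log ((m : ℝ) * n) ≤ C₁ * m →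
      C₂ * (l : ℝ) ≤ m → D * (k : ℝ) ^ 2 * Real.log ((m : ℝ) * n) ≤ C₂ * l →
      Real.log m < k → ∀ μ ∈ Set.Icc (9 / 10 : ℝ) 1,
      designMeasure n m {a | ¬ ∀ z, IsSpartaSequence a (measurement a X) k l μ ⊤ z →
        ∀ t : ℕ, signDist (z t) X ≤ 1 / 10 * (1 / 2) ^ t * ‖X‖} ≤ ENNReal.ofReal (7 / m) := by
  classical
  obtain ⟨η, c, hη, hη1, hc, hsub⟩ :=
    exists_measure_not_smallSubsetEnergy_le (ε := 1 / 1000) (by norm_num)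
  -- the refinement with the threshold `η / 16` needs `2 ρ ^ 2 ≤ η ^ 3 / 512`
  set ρ : ℝ := η ^ 2 / 32 with hρdef
  have hρ : 0 < ρ := by positivity
  have hρ1 : ρ ≤ 1 / 10 := by nlinarith
  have hρη : 2 * ρ ^ 2 ≤ η / 2 * (η / 16) ^ 2 := by
    have : η ^ 4 ≤ η ^ 3 := pow_le_pow_of_le_one hη.le hη1 (by norm_num)
    rw [hρdef]
    nlinarith [pow_pos hη 3]
  -- the accuracy `ρ / 2` of the direction of the initialization requires this level
  set R : ℝ := 192 * 144 / ρ ^ 2 with hR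
  have hR0 : 0 < R := by positivity
  have hR2 : 2 ≤ R := by
    rw [hR, le_div_iff₀ (by positivity)]
    nlinarith
  set p := (gaussianReal 0 1).real {g : ℝ | R ≤ g ^ 2} with hpdef
  have hp : 0 < p := gaussianReal_sq_ge_pos R
  set τ := min (1 / 200) (ρ / 2) with hτdef
  have hτ : 0 < τ := lt_min (by norm_num) (by positivity)
  have hτ1 : τ ≤ 1 / 200 := min_le_left _ _
  have hτ2 : τ ≤ ρ / 2 := min_le_right _ _
  refine ⟨8 / p, 32 / τ ^ 2 + 7 / c + 4 / η + 8 / p + 2 * (8 / p) + Real.exp R, by positivity,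
    by positivity, fun n m k l C₁ X hC₁ hm hX h₁ h₂ hlm hkl hlogk μ hμ => ?_⟩
  obtain ⟨hk, hkn, hXpos⟩ := hX.pos
  have hn : 0 < n := hk.trans_le hkn
  have hm0 : 0 < m := by omega
  have hm8 : (8 : ℝ) ≤ m := by exact_mod_cast hm
  have hk1 : (1 : ℝ) ≤ k := by exact_mod_cast hk
  obtain ⟨hL0, hL1, -⟩ := log_mul_bounds hm hk hkn
  set L := Real.log ((m : ℝ) * n) with hL
  set Q := (k : ℝ) ^ 2 * L with hQ
  have hkQ : k * L ≤ Q := by rw [hQ]; nlinarith [mul_nonneg (sub_nonneg.2 hk1) hL0.le]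
  have hLQ : L ≤ Q := by nlinarith
  have hQ0 : 0 < Q := by linarith
  rw [mul_assoc, ← hQ] at hkl
  have e1 : 0 < 32 / τ ^ 2 := by positivity
  have e2 : 0 < 7 / c := by positivity
  have e3 : 0 < 4 / η := by positivity
  have e4 : 0 < 8 / p := by positivity
  have e5 := Real.exp_pos R
  set D := 32 / τ ^ 2 + 7 / c + 4 / η + 8 / p + 2 * (8 / p) + Real.exp R with hD
  have hweak : ∀ α β, 0 < β → α / β ≤ D → α * Q ≤ β * m := fun α β hβ h => by
    have h' : α / β * Q ≤ m := le_trans (by gcongr) (hkl.trans hlm)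
    rwa [div_mul_eq_mul_div, div_le_iff₀' hβ] at h'
  -- each summand of the constant serves one event
  have d1 : 4 * L ≤ m * ((τ / k) ^ 2 / 8) := by
    have h := hweak 32 (τ ^ 2) (by positivity) (by linarith only [hD, e1, e2, e3, e4, e5])
    rw [div_pow, div_div, ← mul_div_assoc, le_div_iff₀ (by positivity)]
    linarith only [h, hQ]
  have d2 := hweak 7 c hc (by linarith only [hD, e1, e2, e3, e4, e5])
  have d3 := hweak 4 η hη (by linarith only [hD, e1, e2, e3, e4, e5])
  have d4 := hweak 8 p hp (by linarith only [hD, e1, e2, e3, e4, e5])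
  have d5 : 2 * Q ≤ l := by
    refine le_of_mul_le_mul_left (le_trans ?_ hkl) e4
    rw [← mul_assoc, mul_comm (8 / p)]
    exact mul_le_mul_of_nonneg_right (by linarith only [hD, e1, e2, e3, e4, e5]) hQ0.le
  -- `k > log m` exceeds `R` because `m ≥ exp R`
  have hRk : R ≤ k := by
    have h := hweak (Real.exp R) 1 one_pos
      (by rw [div_one]; linarith only [hD, e1, e2, e3, e4, e5])
    have h2 : Real.exp R ≤ m := by
      rw [one_mul] at h
      exact (le_mul_of_one_le_right e5.le (hL1.trans hLQ)).trans h
    exact ((Real.le_log_iff_exp_le (by linarith)).2 h2).trans hlogk.le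
  obtain rfl := hX.1
  refine measure_divergence_le hC₁ hm hX h₁ h₂ hη hρ hρ1 hρη hR0 hR2
    (le_of_eq (by rw [hR]; field_simp)) hRk hτ hτ1 hτ2 (hsub n m _) d1
    (by linarith only [d2, hkQ]) (by linarith only [d3, hLQ]) (by linarith only [d4, hLQ])
    (by linarith only [d5, hkQ]) ?_ hμ
  rw [div_mul_eq_mul_div, div_le_iff₀ hp] at hlm
  linarith only [hlm]

end Sparta

end

theorem theorem1 :
    ∃ c₀ c₁ C₂ : ℝ, 0 < c₀ ∧ 0 < c₁ ∧ 0 < C₂ ∧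
    ∀ C₁ : ℝ, 0 < C₁ → ∃ C₀ : ℝ, 0 < C₀ ∧
    -- exact support recovery
    (∀ (n m k : ℕ) (x : EuclideanSpace ℝ (Fin n)), 0 < m →
      Sparta.IsAdmissibleSignal C₁ k x →
      C₀ * (k : ℝ) ^ 2 * Real.log ((m : ℝ) * n) ≤ m →
      (Real.log m ≤ k ∨ Real.log ((m : ℝ) * n) ^ 3 ≤ m) →
      ∀ (Ω : Type*) [MeasurableSpace Ω] (P : Measure Ω) [IsProbabilityMeasure P]
        (a : Fin m → Ω → EuclideanSpace ℝ (Fin n)), Sparta.IsGaussianDesign P a →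
      ∃ E : Set Ω, MeasurableSet E ∧ 1 - 6 / (m : ℝ) ≤ P.real E ∧
        ∀ ω ∈ E, ∀ S : Finset (Fin n),
          Sparta.IsSupportEstimate (fun i => a i ω) (Sparta.measurement (fun i => a i ω) x) k S →
          S = Sparta.supp x) ∧
    -- linear convergence
    (∃ μlow μhigh : ℝ, 0 < μlow ∧ μlow < μhigh ∧ ∀ μ ∈ Set.Icc μlow μhigh,
      ∃ ν : ℝ, 0 < ν ∧ ν < 1 ∧
      ∀ (n m k l : ℕ) (x : EuclideanSpace ℝ (Fin n)), 0 < m →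
      Sparta.IsAdmissibleSignal C₁ k x →
      C₂ * (l : ℝ) ≤ m →
      C₀ * (k : ℝ) ^ 2 * Real.log ((m : ℝ) * n) ≤ C₂ * (l : ℝ) →
      ∀ (Ω : Type*) [MeasurableSpace Ω] (P : Measure Ω) [IsProbabilityMeasure P]
        (a : Fin m → Ω → EuclideanSpace ℝ (Fin n)), Sparta.IsGaussianDesign P a →
      ∃ E : Set Ω, MeasurableSet E ∧
        1 - c₁ * m * Real.exp (-c₀ * k) - 7 / (m : ℝ) < P.real E ∧
        ∀ ω ∈ E, ∀ z : ℕ → EuclideanSpace ℝ (Fin n),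
          Sparta.IsSpartaSequence (fun i => a i ω) (Sparta.measurement (fun i => a i ω) x)
            k l μ ⊤ z →
          ∀ t : ℕ, Sparta.signDist (z t) x ≤ 1 / 10 * (1 - ν) ^ t * ‖x‖) := by
  obtain ⟨C₂, D, hC₂, hD, hdiv⟩ := Sparta.exists_measure_divergence_le
  have hK := Sparta.one_le_momentBound
  refine ⟨1, 1, C₂, one_pos, one_pos, hC₂, fun C₁ hC₁ => ?_⟩
  have hsupp : 0 < 80 * Sparta.momentBound / C₁ ^ 2 + 192 / C₁ + (192 / C₁) ^ 2 := by positivity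
  set C₀ := 80 * Sparta.momentBound / C₁ ^ 2 + 192 / C₁ + (192 / C₁) ^ 2 + D with hC₀
  refine ⟨C₀, by positivity, ?_, 9 / 10, 1, by norm_num, by norm_num, fun μ hμ => ⟨1 / 2, by
    norm_num, by norm_num, ?_⟩⟩
  · intro n m k x hm hx hsample hcase Ω _ P _ a ha
    have hm' : (0 : ℝ) < m := by exact_mod_cast hm
    rcases Nat.lt_or_ge m 2 with h2 | h2
    · refine ⟨∅, MeasurableSet.empty, ?_, fun ω hω => absurd hω (Set.notMem_empty ω)⟩
      obtain rfl : m = 1 := by omega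
      norm_num
    obtain ⟨hk, hkn, -⟩ := hx.pos
    obtain ⟨h₁, h₂⟩ := Sparta.support_sample_size hC₁ hm (hk.trans_le hkn) hk
      (by linarith) hsample hcase
    obtain ⟨E, hE, hPE, hgood⟩ := ha.exists_event (by positivity)
      (Sparta.measure_support_failure_le hC₁ h2 hx h₁ h₂)
    refine ⟨E, hE, le_trans ?_ hPE, fun ω hω => not_not.1 (hgood ω hω)⟩
    have : 2 / (m : ℝ) ≤ 6 / m := by gcongr; norm_num
    linarith
  · intro n m k l x hm hx hlm hsample Ω _ P _ a ha
    have hm' : (0 : ℝ) < m := by exact_mod_cast hm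
    have hexp : 0 < (m : ℝ) * Real.exp (-k) := by positivity
    rw [show (1 : ℝ) * m * Real.exp (-1 * k) = m * Real.exp (-k) by
      rw [one_mul, neg_one_mul]]
    -- otherwise the asserted probability is negative
    by_cases hmain : 8 ≤ m ∧ (m : ℝ) * Real.exp (-k) < 1
    · obtain ⟨h8, hmk⟩ := hmain
      obtain ⟨hk, hkn, -⟩ := hx.pos
      have hlog : Real.log m < k := by
        rw [Real.exp_neg, mul_inv_lt_iff₀ (Real.exp_pos _), one_mul] at hmk
        exact (Real.log_lt_iff_lt_exp hm').2 hmk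
      obtain ⟨hL0, -⟩ := Sparta.log_mul_bounds h8 hk hkn
      obtain ⟨h₁, h₂⟩ := Sparta.support_sample_size hC₁ hm (hk.trans_le hkn) hk
        (by linarith) (hsample.trans hlm) (Or.inl hlog.le)
      have hDl : D * (k : ℝ) ^ 2 * Real.log ((m : ℝ) * n) ≤ C₂ * l := by
        refine le_trans ?_ hsample
        gcongr
        linarith
      obtain ⟨E, hE, hPE, hgood⟩ := ha.exists_event (by positivity)
        (hdiv n m k l C₁ x hC₁ h8 hx h₁ h₂ hlm hDl hlog μ hμ)
      refine ⟨E, hE, by linarith, fun ω hω z hz t => ?_⟩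
      have h := not_not.1 (hgood ω hω) z hz t
      rwa [show (1 : ℝ) - 1 / 2 = 1 / 2 by norm_num]
    · refine ⟨∅, MeasurableSet.empty, ?_, fun ω hω => absurd hω (Set.notMem_empty ω)⟩
      rw [measureReal_empty]
      rw [not_and_or, not_le, not_lt] at hmain
      rcases hmain with h | h
      · have h7 : (m : ℝ) ≤ 7 := by exact_mod_cast (by omega : m ≤ 7)
        have : 1 ≤ 7 / (m : ℝ) := (one_le_div hm').2 h7
        linarith
      · have : 0 < 7 / (m : ℝ) := by positivity
        linarith
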